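/- **Conventions.** Let $\mathcal H_1,\mathcal H_2$ be complex Hilbert spaces, $\mathcal H=\mathcal H_1\otimes\mathcal H_2$ their Hilbert tensor product, $\Omega\subset\mathbb C$ a domain and $\psi\in(0,\pi)$; $\arg\lambda\in[-\pi,\pi]$. *Meromorphic families.* A map $T(\omega,\lambda)$ from a domain $W\subset\mathbb C^2$ to a Banach space $\mathcal X$ is called a meromorphic family with divisor $Z$, where $Z$ is a (relatively) closed subset of $W$, if $T$ is norm-holomorphic on $W\setminus Z$, and near each $(\omega_0,\lambda_0)\in Z$ one can write $T=S/X$ with $S$ holomorphic with values in $\mathcal X$ and $X$ holomorphic with values in $\mathbb C$, such that $Z=\{X=0\}$ near $(\omega_0,\lambda_0)$ and for each $\omega$ close to $\omega_0$ there exists $\lambda$ (close to $\lambda_0$) with $X(\omega,\lambda)\ne0$. If $T$ takes values in the bounded operators on a Hilbert space, it has poles of finite rank if for every $(\omega_0,\lambda_0)\in Z$ and every $k\ge0$, in the Laurent decomposition $\partial_\omega^kT(\omega_0,\lambda)=T_H(\lambda)+\sum_{j=1}^N T_j(\lambda-\lambda_0)^{-j}$ near $\lambda_0$, with $T_H$ holomorphic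 near $\lambda_0$, all operators $T_j$ have finite rank. A one-variable family $R(\omega)$ of operators is meromorphic on $\Omega$ with poles of finite rank if near each $\omega_0\in\Omega$, $\omega\neq\omega_0$, it is the sum of a holomorphic family and a finite sum $\sum_{j=1}^N A_j(\omega-\omega_0)^{-j}$ with all $A_j$ of finite rank. *Assumptions.* For $j=1,2$ let $R_j(\omega,\lambda)$, $(\omega,\lambda)\in\Omega\times\mathbb C$, be families of bounded operators on $\mathcal H_j$ such that: (A) $R_j$ is a meromorphic family on $\Omega\times\mathbb C$, with divisor $Z_j$, with poles of finite rank. (B) For every compact $K\subset\Omega$ there are constants $C$ and $\rho>0$ such that for all $\omega\in K$ and $|\lambda|\ge\rho$: if $|\arg\lambda|\le\psi$, then $(\omega,\lambda)\notin Z_1$ and $\|R_1(\omega,\lambda)\|\le C/|\lambda|$; if $|\arg\lambda|\ge\psi$, then $(\omega,\lambda)\notin Z_2$ and $\|R_2(\omega,\lambda)\|\le C/|\lambda|$. (C) The set $\Omega_R$ of regular points is nonempty, where $\omega\in\Omega$ is called regular if the sets $Z_j(\omega)=\{\lambda\in\mathbb C:(\omega,\lambda)\in Z_j\}$, $j=1,2$,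 do not intersect. *Admissible contours.* For $\omega\in\Omega_R$, a smooth simple contour $\gamma$ in $\mathbb C$ (possibly with several components: one unbounded curve and finitely many closed curves, pairwise disjoint) is called admissible at $\omega$ if outside of a compact set it is given by the rays $\arg\lambda=\pm\psi$, and it separates $\mathbb C$ into two open regions $\Gamma_1,\Gamma_2$ (possibly disconnected) such that all sufficiently large positive real numbers lie in $\Gamma_2$ and $Z_j(\omega)\subset\Gamma_j$ for $j=1,2$. It is oriented so that $\Gamma_1$ always stays on the left. **Proposition.** Under assumptions (A)–(C): 1. The set of non-regular points is a closed discrete subset of $\Omega$: every $\omega_0\in\Omega$ has a punctured neighborhood consisting of regular points. In particular $\Omega_R$ is open. 2. At every $\omega\in\Omega_R$ there exists an admissible contour, and for every admissible contour $\gamma$ at $\omega$ the integral $$R(\omega)=\frac1{2\pi i}\int_\gamma R_1(\omega,\lambda)\otimes R_2(\omega,\lambda)\,d\lambda$$ converges absolutely in operator norm and does not depend on the choice of $\gamma$. 3. The operator $R(\omega)$ on $\mathcal H$ so defined is holomorphic on $\Omega_R$ and is meromorphic in $\omega\in\Omega$ with poles of finite rank. -/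

import Mathlib

open Set Filter Topology MeasureTheory
open scoped TensorProduct ContDiff

namespace SepMer

/-! ### Hilbert tensor product -/

/-- The Hilbert tensor product: the completion of the algebraic tensor product with respect to the
inner product determined by `⟪x ⊗ y, x' ⊗ y'⟫ = ⟪x, x'⟫ * ⟪y, y'⟫`. -/
abbrev HilbertTensor (H₁ H₂ : Type*) [NormedAddCommGroup H₁] [InnerProductSpace ℂ H₁]
    [NormedAddCommGroup H₂] [InnerProductSpace ℂ H₂] : Type _ :=
  UniformSpace.Completion (H₁ ⊗[ℂ] H₂)

/-- The tensor product `A₁ ⊗ A₂` of two bounded operators, as a bounded operator on the Hilbert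
tensor product. -/
noncomputable def tensorOp {H₁ H₂ : Type*} [NormedAddCommGroup H₁] [InnerProductSpace ℂ H₁]
    [NormedAddCommGroup H₂] [InnerProductSpace ℂ H₂] (A₁ : H₁ →L[ℂ] H₁) (A₂ : H₂ →L[ℂ] H₂) :
    HilbertTensor H₁ H₂ →L[ℂ] HilbertTensor H₁ H₂ :=
  (TensorProduct.mapL A₁ A₂).completion

/-! ### Meromorphic families -/

/-- `T` is an (`ω`-nondegenerate) meromorphic map from `W ⊆ ℂ²` to the Banach space `X`, with
divisor `Z`. A point of `ℂ²` is a pair `(ω, λ)`. The values of `T` on `Z` are irrelevant. -/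
structure IsMeromorphicFamily {X : Type*} [NormedAddCommGroup X] [NormedSpace ℂ X]
    (W Z : Set (ℂ × ℂ)) (T : ℂ × ℂ → X) : Prop where
  divisor_subset : Z ⊆ W
  isClosed_divisor : IsClosed ((↑) ⁻¹' Z : Set W)
  holomorphic : DifferentiableOn ℂ T (W \ Z)
  quotient : ∀ p₀ ∈ Z, ∃ r > 0, ∃ (S : ℂ × ℂ → X) (D : ℂ × ℂ → ℂ),
    Metric.ball p₀.1 r ×ˢ Metric.ball p₀.2 r ⊆ W ∧
    DifferentiableOn ℂ S (Metric.ball p₀.1 r ×ˢ Metric.ball p₀.2 r) ∧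
    DifferentiableOn ℂ D (Metric.ball p₀.1 r ×ˢ Metric.ball p₀.2 r) ∧
    (∀ w ∈ Metric.ball p₀.1 r, ∃ l ∈ Metric.ball p₀.2 r, D (w, l) ≠ 0) ∧
    (∀ p ∈ Metric.ball p₀.1 r ×ˢ Metric.ball p₀.2 r, p ∈ Z ↔ D p = 0) ∧
    (∀ p ∈ Metric.ball p₀.1 r ×ˢ Metric.ball p₀.2 r, p ∉ Z → T p = (D p)⁻¹ • S p)

/-- Near `z₀`, off `z₀`, the operator-valued function `f` is the sum of a holomorphic function and
of a finite principal part `∑ A_j / (z - z₀) ^ j`, `1 ≤ j ≤ N`, whose coefficients have finite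
rank. -/
def HasFiniteRankPrincipalPartAt {E : Type*} [NormedAddCommGroup E] [NormedSpace ℂ E]
    (f : ℂ → E →L[ℂ] E) (z₀ : ℂ) : Prop :=
  ∃ (N : ℕ) (A : ℕ → E →L[ℂ] E) (h : ℂ → E →L[ℂ] E),
    AnalyticAt ℂ h z₀ ∧
    (∀ j, FiniteDimensional ℂ (LinearMap.range (A j).toLinearMap)) ∧
    ∀ᶠ z in 𝓝[≠] z₀, f z = h z + ∑ j ∈ Finset.Icc 1 N, ((z - z₀) ^ j)⁻¹ • A j

/-- The two-variable family `T` with divisor `Z` has poles of finite rank: at each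
`(ω₀, λ₀) ∈ Z` and for every `ω`-derivative of `T`, the Laurent expansion in `λ` at `λ₀` of
`λ ↦ ∂_ω ^ k T (ω₀, λ)` has a principal part with coefficients of finite rank. -/
def HasPolesOfFiniteRank {E : Type*} [NormedAddCommGroup E] [NormedSpace ℂ E]
    (Z : Set (ℂ × ℂ)) (T : ℂ × ℂ → E →L[ℂ] E) : Prop :=
  ∀ p₀ ∈ Z, ∀ k : ℕ,
    HasFiniteRankPrincipalPartAt (fun l => iteratedDeriv k (fun w => T (w, l)) p₀.1) p₀.2

/-- The one-variable operator family `R` is meromorphic on `U` with poles of finite rank. -/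
def IsMeromorphicWithFiniteRankPoles {E : Type*} [NormedAddCommGroup E] [NormedSpace ℂ E]
    (R : ℂ → E →L[ℂ] E) (U : Set ℂ) : Prop :=
  MeromorphicOn R U ∧ ∀ w₀ ∈ U, HasFiniteRankPrincipalPartAt R w₀

/-! ### Regular points and the decay condition -/

/-- The slice `Z(ω) = {λ | (ω, λ) ∈ Z}`. -/
def slice (Z : Set (ℂ × ℂ)) (w : ℂ) : Set ℂ := {l | (w, l) ∈ Z}

/-- The regular points: those `ω ∈ Ω` for which `Z₁(ω)` and `Z₂(ω)` do not meet. -/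
def regularPoints (Ω : Set ℂ) (Z₁ Z₂ : Set (ℂ × ℂ)) : Set ℂ :=
  {w | w ∈ Ω ∧ Disjoint (slice Z₁ w) (slice Z₂ w)}

/-- Locally uniformly in `ω`, for large `λ`, the family `R₁` has no poles and is `O(1/|λ|)` in the
sector `|arg λ| ≤ ψ`, and the same holds for `R₂` in the sector `|arg λ| ≥ ψ`. -/
def DecaysInSectors {X₁ X₂ : Type*} [NormedAddCommGroup X₁] [NormedAddCommGroup X₂]
    (Ω : Set ℂ) (ψ : ℝ) (Z₁ Z₂ : Set (ℂ × ℂ)) (R₁ : ℂ × ℂ → X₁) (R₂ : ℂ × ℂ → X₂) : Prop :=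
  ∀ K : Set ℂ, IsCompact K → K ⊆ Ω → ∃ C ρ : ℝ, 0 < ρ ∧ ∀ w ∈ K, ∀ l : ℂ, ρ ≤ ‖l‖ →
    (|l.arg| ≤ ψ → (w, l) ∉ Z₁ ∧ ‖R₁ (w, l)‖ ≤ C / ‖l‖) ∧
    (ψ ≤ |l.arg| → (w, l) ∉ Z₂ ∧ ‖R₂ (w, l)‖ ≤ C / ‖l‖)

/-! ### Admissible contours -/

/-- A smooth simple oriented contour in `ℂ` with one unbounded component, parametrised by `ℝ`, and
finitely many bounded components, which are smooth Jordan curves parametrised with period `1`. -/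
structure Contour where
  line : ℝ → ℂ
  n : ℕ
  loop : Fin n → ℝ → ℂ
  line_smooth : ContDiff ℝ ∞ line
  line_deriv : ∀ t, deriv line t ≠ 0
  line_injective : Function.Injective line
  loop_smooth : ∀ i, ContDiff ℝ ∞ (loop i)
  loop_deriv : ∀ i t, deriv (loop i) t ≠ 0
  loop_periodic : ∀ i, Function.Periodic (loop i) 1
  loop_injOn : ∀ i, InjOn (loop i) (Ico 0 1)
  line_loop_disjoint : ∀ i, Disjoint (range line) (range (loop i))
  loop_disjoint : ∀ i j, i ≠ j → Disjoint (range (loop i)) (range (loop j))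

namespace Contour

/-- The point set of the contour. -/
def image (γ : Contour) : Set ℂ := range γ.line ∪ ⋃ i, range (γ.loop i)

/-- Absolute integrability of `F(λ) dλ` along the contour. -/
def IntegrableAlong {E : Type*} [NormedAddCommGroup E] [NormedSpace ℂ E]
    (γ : Contour) (F : ℂ → E) : Prop :=
  Integrable (fun t => deriv γ.line t • F (γ.line t)) ∧
  ∀ i, IntervalIntegrable (fun t => deriv (γ.loop i) t • F (γ.loop i t)) volume 0 1

/-- The contour integral `∫_γ F(λ) dλ`. -/
noncomputable def integral {E : Type*} [NormedAddCommGroup E] [NormedSpace ℂ E]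
    (γ : Contour) (F : ℂ → E) : E :=
  (∫ t, deriv γ.line t • F (γ.line t)) +
    ∑ i, ∫ t in (0 : ℝ)..1, deriv (γ.loop i) t • F (γ.loop i t)

end Contour

/-- The curve `c` has the set `Γ₁` immediately on its left and `Γ₂` immediately on its right. -/
def HasSides (c : ℝ → ℂ) (Γ₁ Γ₂ : Set ℂ) : Prop :=
  ∀ t, ∀ᶠ ε : ℝ in 𝓝[>] 0,
    c t + ε * Complex.I * deriv c t ∈ Γ₁ ∧ c t - ε * Complex.I * deriv c t ∈ Γ₂

/-- `γ` is an admissible contour of angle `ψ` for the sets `P₁`, `P₂` (the slices `Z₁(ω)`,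
`Z₂(ω)`), oriented with `Γ₁` on the left. Outside of a compact set `γ` consists of the rays
`arg λ = ± ψ`; they are parametrised by arc length, and the orientation runs inwards along
`arg λ = -ψ` and outwards along `arg λ = ψ`, as it must when large positive numbers lie in the
region on the right. -/
def IsAdmissible (ψ : ℝ) (P₁ P₂ : Set ℂ) (γ : Contour) : Prop :=
  (∃ τ : ℝ, 0 < τ ∧ ∀ t : ℝ, τ ≤ t →
    γ.line t = t * Complex.exp (ψ * Complex.I) ∧
    γ.line (-t) = t * Complex.exp (-(ψ * Complex.I))) ∧
  ∃ Γ₁ Γ₂ : Set ℂ, IsOpen Γ₁ ∧ IsOpen Γ₂ ∧ Disjoint Γ₁ Γ₂ ∧ Γ₁ ∪ Γ₂ = γ.imageᶜ ∧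
    HasSides γ.line Γ₁ Γ₂ ∧ (∀ i, HasSides (γ.loop i) Γ₁ Γ₂) ∧
    (∀ᶠ x : ℝ in atTop, (x : ℂ) ∈ Γ₂) ∧ P₁ ⊆ Γ₁ ∧ P₂ ⊆ Γ₂

end SepMer

/-! The operator tensor product enters only as a bounded bilinear map `T` that sends pairs of finite
rank operators to finite rank operators. The rest is complex analysis of `T (R₁ (w, z)) (R₂ (w,
z))`.

Independence of the contour. Two admissible contours have the same tails, so only truncated
integrals have to be compared. In a large disc the integrand is a holomorphic function plus finitely
many principal parts (`exists_principalParts`). The holomorphic part and the poles of order at least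
two have primitives, so they contribute equal boundary terms. Simple poles contribute the Cauchy
integral of `1 / (z - p)`. No Jordan curve theorem is needed: this Cauchy integral, minus `2πi`
times the indicator function of the left region, minus an explicit logarithm, is locally constant
off the contour and has no jump across it, so it is constant in the disc
(`Separates.exists_cauchy_eq`). Comparing two contours along large positive numbers identifies the
constants (`Separates.cauchy_eq`).

Existence. A smooth graph following the two rays, bent far to the left near the real axis, has all
but finitely many poles on the correct side. The exceptions are poles of `R₁`, and they are
encircled (`exists_separates`).

Discreteness. Near a common pole write `Rⱼ = Sⱼ / Xⱼ`. The product of the values of `X₂ (w, ·)` over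
the zeros of `X₁ (w, ·)` in a small disc is a holomorphic function `f w`, by Newton's identities and
contour integrals for the power sums. It vanishes exactly when there is a common zero
(`exists_elimination`). So the non-regular set is locally an analytic set, and connectedness of `Ω`
together with one regular point makes it discrete.

Meromorphy. Fix a contour at `w₀` that separates all poles, except that common poles stay on the
right. For regular `w` near `w₀`, an admissible contour arises by adding small circles about the
poles of `R₁` that lie near the common poles. The integral over the fixed contour is holomorphic in
`w`. For the residues, elimination also gives `f = X₁ v + X₂ u`. With `χ = X₁ v`, the sum of
residues times `f` is the integral of `(f - χ) T R₁ R₂` over a fixed circle. There both factors may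
be replaced by the principal parts of their Taylor polynomials in `w`: the holomorphic parts drop
out by Cauchy's theorem, up to a multiple of `f`, and the Taylor remainders have the order of
vanishing of `f`. Division by `f` therefore leaves a bounded error (`exists_local_residue`). The
replaced integral is a finite sum of scalar meromorphic functions times finite rank operators. The
bounded error is holomorphic off `w₀`, so its singularity is removable. -/

namespace SepMer

/-! ### Operator tensor products on the Hilbert tensor product -/

section Tensor

variable {H₁ H₂ : Type*} [NormedAddCommGroup H₁] [InnerProductSpace ℂ H₁]
    [NormedAddCommGroup H₂] [InnerProductSpace ℂ H₂]

lemma tensorOp_coe (A : H₁ →L[ℂ] H₁) (B : H₂ →L[ℂ] H₂) (x : H₁ ⊗[ℂ] H₂) :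
    tensorOp A B (x : HilbertTensor H₁ H₂) = (TensorProduct.mapL A B x : H₁ ⊗[ℂ] H₂) :=
  ContinuousLinearMap.completion_apply_coe _ _

lemma ext_on_coe {f g : HilbertTensor H₁ H₂ →L[ℂ] HilbertTensor H₁ H₂}
    (h : ∀ x : H₁ ⊗[ℂ] H₂, f x = g x) : f = g := by
  ext x
  induction x using UniformSpace.Completion.induction_on with
  | hp => exact isClosed_eq f.continuous g.continuous
  | ih a => exact h a

lemma norm_tensorOp_le (A : H₁ →L[ℂ] H₁) (B : H₂ →L[ℂ] H₂) :
    ‖tensorOp A B‖ ≤ ‖A‖ * ‖B‖ := by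
  refine ContinuousLinearMap.opNorm_le_bound _ (by positivity) fun x => ?_
  induction x using UniformSpace.Completion.induction_on with
  | hp => exact isClosed_le (by fun_prop) (by fun_prop)
  | ih a =>
    rw [tensorOp_coe, UniformSpace.Completion.norm_coe, UniformSpace.Completion.norm_coe]
    exact (ContinuousLinearMap.le_opNorm _ _).trans
      (mul_le_mul_of_nonneg_right (TensorProduct.norm_mapL_le A B) (norm_nonneg _))

lemma tensorOp_add_left (A A' : H₁ →L[ℂ] H₁) (B : H₂ →L[ℂ] H₂) :
    tensorOp (A + A') B = tensorOp A B + tensorOp A' B := ext_on_coe fun x => by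
  rw [add_apply, tensorOp_coe, tensorOp_coe, tensorOp_coe,
    TensorProduct.mapL_add_left, ← UniformSpace.Completion.coe_add, add_apply]

lemma tensorOp_add_right (A : H₁ →L[ℂ] H₁) (B B' : H₂ →L[ℂ] H₂) :
    tensorOp A (B + B') = tensorOp A B + tensorOp A B' := ext_on_coe fun x => by
  rw [add_apply, tensorOp_coe, tensorOp_coe, tensorOp_coe,
    TensorProduct.mapL_add_right, ← UniformSpace.Completion.coe_add, add_apply]

lemma tensorOp_smul_left (c : ℂ) (A : H₁ →L[ℂ] H₁) (B : H₂ →L[ℂ] H₂) :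
    tensorOp (c • A) B = c • tensorOp A B := ext_on_coe fun x => by
  rw [smul_apply, tensorOp_coe, tensorOp_coe,
    TensorProduct.mapL_smul_left, ← UniformSpace.Completion.coe_smul, smul_apply]

lemma tensorOp_smul_right (c : ℂ) (A : H₁ →L[ℂ] H₁) (B : H₂ →L[ℂ] H₂) :
    tensorOp A (c • B) = c • tensorOp A B := ext_on_coe fun x => by
  rw [smul_apply, tensorOp_coe, tensorOp_coe,
    TensorProduct.mapL_smul_right, ← UniformSpace.Completion.coe_smul, smul_apply]

variable (H₁ H₂) in
/-- The operator tensor product as a bilinear map. -/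
noncomputable def tensorOpBilin : (H₁ →L[ℂ] H₁) →ₗ[ℂ] (H₂ →L[ℂ] H₂) →ₗ[ℂ]
    (HilbertTensor H₁ H₂ →L[ℂ] HilbertTensor H₁ H₂) :=
  LinearMap.mk₂ ℂ (fun A B => tensorOp A B) tensorOp_add_left tensorOp_smul_left
    tensorOp_add_right tensorOp_smul_right

lemma norm_tensorOpBilin_le (A : H₁ →L[ℂ] H₁) (B : H₂ →L[ℂ] H₂) :
    ‖tensorOpBilin H₁ H₂ A B‖ ≤ 1 * ‖A‖ * ‖B‖ := by
  rw [one_mul]; exact norm_tensorOp_le A B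

variable (H₁ H₂) in
/-- The operator tensor product as a bounded bilinear map. -/
noncomputable def tensorOpL : (H₁ →L[ℂ] H₁) →L[ℂ] (H₂ →L[ℂ] H₂) →L[ℂ]
    (HilbertTensor H₁ H₂ →L[ℂ] HilbertTensor H₁ H₂) :=
  LinearMap.mkContinuous₂ (E := H₁ →L[ℂ] H₁) (F := H₂ →L[ℂ] H₂)
    (G := HilbertTensor H₁ H₂ →L[ℂ] HilbertTensor H₁ H₂)
    (σ₂₃ := RingHom.id ℂ) (σ₁₃ := RingHom.id ℂ) (tensorOpBilin H₁ H₂) 1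
    norm_tensorOpBilin_le

/-- On the algebraic tensor product the values lie in the image of `range A ⊗ range B`. Its image in
the completion is finite dimensional, hence closed, so it still contains the values after passage to
the completion. -/
lemma finiteDimensional_range_tensorOp (A : H₁ →L[ℂ] H₁) (B : H₂ →L[ℂ] H₂)
    (hA : FiniteDimensional ℂ (LinearMap.range A.toLinearMap))
    (hB : FiniteDimensional ℂ (LinearMap.range B.toLinearMap)) :
    FiniteDimensional ℂ (LinearMap.range (tensorOp A B).toLinearMap) := by
  set V : Submodule ℂ (H₁ ⊗[ℂ] H₂) := LinearMap.range (TensorProduct.map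
    (LinearMap.range A.toLinearMap).subtype (LinearMap.range B.toLinearMap).subtype) with hV
  have hVfin : FiniteDimensional ℂ V := inferInstance
  have hmem : ∀ x, TensorProduct.mapL A B x ∈ V := by
    intro x
    refine ⟨TensorProduct.map A.toLinearMap.rangeRestrict B.toLinearMap.rangeRestrict x, ?_⟩
    rw [TensorProduct.mapL_apply, ← LinearMap.comp_apply, ← TensorProduct.map_comp]
    rfl
  set V' : Submodule ℂ (HilbertTensor H₁ H₂) :=
    V.map (UniformSpace.Completion.toComplL (𝕜 := ℂ) (E := H₁ ⊗[ℂ] H₂)).toLinearMap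
  have hV'fin : FiniteDimensional ℂ V' := inferInstance
  have hle : LinearMap.range (tensorOp A B).toLinearMap ≤ V' := by
    rintro _ ⟨x, rfl⟩
    change tensorOp A B x ∈ V'
    induction x using UniformSpace.Completion.induction_on with
    | hp => exact (Submodule.closed_of_finiteDimensional V').preimage (tensorOp A B).continuous
    | ih a =>
      rw [tensorOp_coe]
      exact Submodule.mem_map_of_mem (hmem a)
  exact Submodule.finiteDimensional_of_le hle

end Tensor

/-! ### Integrals depending holomorphically on a parameter -/

section Param

variable {E : Type*} [NormedAddCommGroup E] [NormedSpace ℂ E]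

/-- Holomorphy of an integral depending holomorphically on a parameter. -/
lemma differentiableOn_integral_of_dominated [CompleteSpace E] {α : Type*} [MeasurableSpace α] {μ :
    Measure α}
    {f : ℂ → α → E} {U : Set ℂ} (hU : IsOpen U) {g : α → ℝ}
    (hmeas : ∀ w ∈ U, AEStronglyMeasurable (f w) μ)
    (hdiff : ∀ᵐ t ∂μ, DifferentiableOn ℂ (fun w => f w t) U)
    (hbound : ∀ᵐ t ∂μ, ∀ w ∈ U, ‖f w t‖ ≤ g t) (hg : Integrable g μ) :
    DifferentiableOn ℂ (fun w => ∫ t, f w t ∂μ) U := by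
  intro w₀ hw₀
  obtain ⟨r, hr, hball⟩ := Metric.isOpen_iff.1 hU w₀ hw₀
  have hr2 : 0 < r / 2 := by positivity
  have hsub : ∀ w ∈ Metric.ball w₀ (r / 2), Metric.closedBall w (r / 4) ⊆ U := by
    intro w hw z hz
    apply hball
    rw [Metric.mem_ball] at hw ⊢
    rw [Metric.mem_closedBall] at hz
    linarith [dist_triangle z w w₀]
  have hderiv : ∀ᵐ t ∂μ, ∀ w ∈ Metric.ball w₀ (r / 2),
      HasDerivAt (fun w => f w t) (deriv (fun w => f w t) w) w := by
    filter_upwards [hdiff] with t ht w hw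
    have hwU : w ∈ U := hsub w hw (Metric.mem_closedBall_self (by positivity))
    exact ((ht w hwU).differentiableAt (hU.mem_nhds hwU)).hasDerivAt
  -- No bound on the derivative is assumed: Cauchy's estimate on circles of radius `r / 4` turns the
  -- domination of `f` into one of its derivative.
  have hb : ∀ᵐ t ∂μ, ∀ w ∈ Metric.ball w₀ (r / 2),
      ‖deriv (fun w => f w t) w‖ ≤ g t / (r / 4) := by
    filter_upwards [hdiff, hbound] with t ht hbt w hw
    refine Complex.norm_deriv_le_of_forall_mem_sphere_norm_le (by positivity) ?_ ?_
    · exact (ht.mono (hsub w hw)).diffContOnCl_ball subset_rfl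
    · intro z hz
      exact hbt z (hsub w hw (Metric.sphere_subset_closedBall hz))
  -- The derivative is measurable in `t` as a limit of difference quotients. The increments `r / 2 /
  -- (n + 2)` are nonzero and keep the points inside the ball of radius `r`.
  have hF'meas : AEStronglyMeasurable (fun t => deriv (fun w => f w t) w₀) μ := by
    have hlim : Tendsto (fun n : ℕ => ((r / 2 / (n + 2) : ℝ) : ℂ)) atTop (𝓝[≠] 0) := by
      rw [tendsto_nhdsWithin_iff]
      constructor
      · have : Tendsto (fun n : ℕ => (r / 2 / (n + 2) : ℝ)) atTop (𝓝 0) := by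
          apply Tendsto.div_atTop tendsto_const_nhds
          exact tendsto_atTop_add_const_right _ _ tendsto_natCast_atTop_atTop
        exact_mod_cast (Complex.continuous_ofReal.tendsto 0).comp this
      · filter_upwards with n
        simp only [mem_compl_iff, mem_singleton_iff, Complex.ofReal_eq_zero]
        positivity
    refine aestronglyMeasurable_of_tendsto_ae atTop
      (f := fun (n : ℕ) t => ((r / 2 / (n + 2) : ℝ) : ℂ)⁻¹ •
        (f (w₀ + ((r / 2 / (n + 2) : ℝ) : ℂ)) t - f w₀ t)) ?_ ?_
    · intro n
      refine AEStronglyMeasurable.const_smul (AEStronglyMeasurable.sub (hmeas _ ?_) (hmeas _ hw₀)) _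
      apply hball
      rw [Metric.mem_ball, dist_eq_norm, add_sub_cancel_left, Complex.norm_real, Real.norm_eq_abs,
        abs_of_pos (by positivity), div_lt_iff₀ (by positivity)]
      nlinarith [(Nat.cast_nonneg n : (0 : ℝ) ≤ n)]
    · filter_upwards [hderiv] with t ht
      exact (hasDerivAt_iff_tendsto_slope_zero.1 (ht w₀ (Metric.mem_ball_self hr2))).comp hlim
  have hint : Integrable (f w₀) μ :=
    hg.mono' (hmeas w₀ hw₀) (by filter_upwards [hbound] with t ht using ht w₀ hw₀)
  exact (hasDerivAt_integral_of_dominated_loc_of_deriv_le (Metric.ball_mem_nhds w₀ hr2)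
    (by filter_upwards [hU.mem_nhds hw₀] with w hw using hmeas w hw) hint hF'meas hb
    (hg.div_const _) hderiv).2.differentiableAt.differentiableWithinAt

/-- Locally uniform bounds of a jointly continuous function over a compact set. -/
lemma exists_ball_bound {E : Type*} [NormedAddCommGroup E] {K : Set ℂ} (hK : IsCompact K) {U : Set
    ℂ} (hU : IsOpen U)
    {φ : ℂ × ℂ → E} (hφ : ContinuousOn φ (U ×ˢ K)) {w₀ : ℂ} (hw₀ : w₀ ∈ U) :
    ∃ r > 0, Metric.closedBall w₀ r ⊆ U ∧ ∃ B : ℝ, ∀ w ∈ Metric.closedBall w₀ r, ∀ l ∈ K,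
      ‖φ (w, l)‖ ≤ B := by
  obtain ⟨r, hr, hball⟩ := Metric.nhds_basis_closedBall.mem_iff.1 (hU.mem_nhds hw₀)
  obtain ⟨B, hB⟩ := ((isCompact_closedBall w₀ r).prod hK).exists_bound_of_continuousOn
    (hφ.mono (prod_mono hball subset_rfl))
  exact ⟨r, hr, hball, B, fun w hw l hl => hB (w, l) ⟨hw, hl⟩⟩

lemma differentiableOn_circleIntegral [CompleteSpace E] {U : Set ℂ} (hU : IsOpen U)
    {φ : ℂ × ℂ → E} {c : ℂ} {r : ℝ} (hr : 0 ≤ r)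
    (hφ : ContinuousOn φ (U ×ˢ Metric.sphere c r))
    (hdiff : ∀ l ∈ Metric.sphere c r, DifferentiableOn ℂ (fun w => φ (w, l)) U) :
    DifferentiableOn ℂ (fun w => ∮ l in C(c, r), φ (w, l)) U := by
  intro w₀ hw₀
  obtain ⟨ε, hε, hball, B, hB⟩ := exists_ball_bound (isCompact_sphere c r) hU hφ hw₀
  have hsub : Metric.ball w₀ ε ⊆ U := Metric.ball_subset_closedBall.trans hball
  have key : DifferentiableOn ℂ (fun w => ∮ l in C(c, r), φ (w, l)) (Metric.ball w₀ ε) := by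
    simp only [circleIntegral, intervalIntegral.integral_of_le Real.two_pi_pos.le]
    refine differentiableOn_integral_of_dominated Metric.isOpen_ball (g := fun _ => r * B) ?_ ?_ ?_
      ?_
    · intro w hw
      apply Continuous.aestronglyMeasurable
      have h1 : Continuous fun θ => φ (w, circleMap c r θ) :=
        hφ.comp_continuous (by fun_prop) fun θ => ⟨hsub hw, circleMap_mem_sphere c hr θ⟩
      simp only [deriv_circleMap]
      exact ((continuous_circleMap 0 r).mul continuous_const).smul h1
    · refine Eventually.of_forall fun θ => DifferentiableOn.const_smul ?_ _
      exact (hdiff _ (circleMap_mem_sphere c hr θ)).mono hsub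
    · refine Eventually.of_forall fun θ w hw => ?_
      rw [norm_smul, deriv_circleMap]
      have : ‖circleMap 0 r θ * Complex.I‖ = r := by simp [abs_of_nonneg hr]
      rw [this]
      exact mul_le_mul_of_nonneg_left
        (hB w (Metric.ball_subset_closedBall hw) _ (circleMap_mem_sphere c hr θ)) hr
    · exact integrable_const _
  exact (key.differentiableAt (Metric.ball_mem_nhds _ hε)).differentiableWithinAt

end Param

/-! ### Splitting off principal parts -/

section PrincipalPart

variable {E : Type*} [NormedAddCommGroup E] [NormedSpace ℂ E] [CompleteSpace E]

/-- Repeated use of `g z = g p + (z - p) • dslope g p z`: each step produces the coefficient of the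
highest negative power and leaves the analytic function `dslope g p` with one power less. -/
lemma AnalyticAt.exists_principalPart_of_pow (n : ℕ) :
    ∀ {g : ℂ → E} {p : ℂ}, AnalyticAt ℂ g p →
    ∃ (A : ℕ → E) (h : ℂ → E), AnalyticAt ℂ h p ∧
      ∀ z ≠ p, ((z - p) ^ n)⁻¹ • g z = h z + ∑ j ∈ Finset.Icc 1 n, ((z - p) ^ j)⁻¹ • A j := by
  induction n with
  | zero => intro g p hg; exact ⟨0, g, hg, fun z _ => by simp⟩
  | succ n ih =>
    intro g p hg
    have hd : AnalyticAt ℂ (dslope g p) p := by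
      obtain ⟨s, hs, hgs⟩ := hg.eventually_analyticAt.exists_mem
      have h2 : DifferentiableOn ℂ (dslope g p) s :=
        (Complex.differentiableOn_dslope hs).2 fun z hz => (hgs z
          hz).differentiableAt.differentiableWithinAt
      exact h2.analyticAt hs
    obtain ⟨A, h, hh, hA⟩ := ih hd
    refine ⟨fun j => if j = n + 1 then g p else A j, h, hh, fun z hz => ?_⟩
    have hz' : z - p ≠ 0 := sub_ne_zero.2 hz
    have h1 : g z = g p + (z - p) • dslope g p z := by rw [sub_smul_dslope]; abel
    rw [Finset.sum_Icc_succ_top (by omega)]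
    have h3 : ∑ j ∈ Finset.Icc 1 n, ((z - p) ^ j)⁻¹ • (if j = n + 1 then g p else A j)
        = ∑ j ∈ Finset.Icc 1 n, ((z - p) ^ j)⁻¹ • A j := by
      refine Finset.sum_congr rfl fun j hj => ?_
      rw [if_neg]; have := Finset.mem_Icc.1 hj; omega
    rw [h3]
    simp only [if_true]
    rw [← add_assoc, ← hA z hz]
    conv_lhs => rw [h1]
    rw [smul_add, smul_smul, add_comm, pow_succ]
    congr 2
    field_simp

lemma MeromorphicAt.exists_principalPart {f : ℂ → E} {p : ℂ} (hf : MeromorphicAt f p) :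
    ∃ (N : ℕ) (A : ℕ → E) (h : ℂ → E), AnalyticAt ℂ h p ∧
      ∀ᶠ z in 𝓝[≠] p, f z = h z + ∑ j ∈ Finset.Icc 1 N, ((z - p) ^ j)⁻¹ • A j := by
  obtain ⟨n, hn⟩ := hf
  obtain ⟨A, h, hh, hA⟩ := AnalyticAt.exists_principalPart_of_pow n hn
  refine ⟨n, A, h, hh, ?_⟩
  filter_upwards [self_mem_nhdsWithin] with z hz
  rw [← hA z hz, smul_smul, inv_mul_cancel₀ (pow_ne_zero _ (sub_ne_zero.2 hz)), one_smul]

/-- A function with finitely many poles is the sum of its principal parts and of a holomorphic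
function. -/
lemma exists_principalParts {U : Set ℂ} (hU : IsOpen U) (S : Finset ℂ) :
    ∀ {F : ℂ → E}, DifferentiableOn ℂ F (U \ S) → (∀ p ∈ S, MeromorphicAt F p) →
    ∃ (N : ℂ → ℕ) (a : ℂ → ℕ → E) (A : ℂ → E), DifferentiableOn ℂ A U ∧
      ∀ z ∈ U, z ∉ S → F z = A z + ∑ p ∈ S, ∑ j ∈ Finset.Icc 1 (N p), ((z - p) ^ j)⁻¹ • a p j := by
  classical
  induction S using Finset.induction_on with
  | empty => intro F hF _; exact ⟨0, 0, F, by simpa using hF, fun z _ _ => by simp⟩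
  | insert p S hp ih =>
    intro F hF hm
    obtain ⟨N₀, a₀, h, hh, hFh⟩ := MeromorphicAt.exists_principalPart (hm p (Finset.mem_insert_self
      p S))
    set PP : ℂ → E := fun z => ∑ j ∈ Finset.Icc 1 N₀, ((z - p) ^ j)⁻¹ • a₀ j with hPP
    have hPPd : ∀ z ≠ p, DifferentiableAt ℂ PP z := by
      intro z hz
      refine DifferentiableAt.fun_sum fun j _ => DifferentiableAt.smul_const ?_ _
      exact DifferentiableAt.inv (by fun_prop) (pow_ne_zero _ (sub_ne_zero.2 hz))
    -- Once the principal part at `p` is subtracted, the singularity is removable, and inserting the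
    -- value `h p` makes the function holomorphic at `p`. The induction then has one pole fewer.
    set F₁ : ℂ → E := Function.update (fun z => F z - PP z) p (h p) with hF₁
    have hF₁ne : ∀ z ≠ p, F₁ z = F z - PP z := fun z hz => by simp [hF₁, hz]
    have hF₁p : F₁ =ᶠ[𝓝 p] h := by
      filter_upwards [eventually_nhdsWithin_iff.1 hFh] with z hz
      by_cases hzp : z = p
      · simp [hF₁, hzp]
      · rw [hF₁ne z hzp, hz hzp, hPP, add_sub_cancel_right]
    have hF₁at : ∀ z ≠ p, F₁ =ᶠ[𝓝 z] fun z => F z - PP z := fun z hz => by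
      filter_upwards [isOpen_ne.mem_nhds hz] with y hy using hF₁ne y hy
    have hF₁d : DifferentiableOn ℂ F₁ (U \ S) := by
      intro z hz
      by_cases hzp : z = p
      · subst hzp
        exact (hh.differentiableAt.congr_of_eventuallyEq hF₁p).differentiableWithinAt
      · have hopen : IsOpen (U \ (↑(insert p S) : Set ℂ)) :=
          hU.sdiff (Finset.finite_toSet _).isClosed
        have hmem : z ∈ U \ (↑(insert p S) : Set ℂ) := ⟨hz.1, by simpa [hzp] using hz.2⟩
        have := ((hF z hmem).differentiableAt (hopen.mem_nhds hmem)).sub (hPPd z hzp)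
        exact (this.congr_of_eventuallyEq (hF₁at z hzp)).differentiableWithinAt
    have hF₁m : ∀ q ∈ S, MeromorphicAt F₁ q := by
      intro q hq
      have hqp : q ≠ p := fun h => hp (h ▸ hq)
      have hPPa : AnalyticAt ℂ PP q := by
        have : DifferentiableOn ℂ PP {p}ᶜ := fun z hz => (hPPd z hz).differentiableWithinAt
        exact this.analyticAt (isOpen_ne.mem_nhds hqp)
      exact ((hm q (Finset.mem_insert_of_mem hq)).sub hPPa.meromorphicAt).congr
        ((hF₁at q hqp).symm.filter_mono nhdsWithin_le_nhds)
    obtain ⟨N, a, A, hA, hFA⟩ := ih hF₁d hF₁m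
    refine ⟨Function.update N p N₀, Function.update a p a₀, A, hA, fun z hzU hz => ?_⟩
    rw [Finset.mem_insert, not_or] at hz
    rw [Finset.sum_insert hp]
    have h1 : ∑ q ∈ S, ∑ j ∈ Finset.Icc 1 (Function.update N p N₀ q),
        ((z - q) ^ j)⁻¹ • Function.update a p a₀ q j
        = ∑ q ∈ S, ∑ j ∈ Finset.Icc 1 (N q), ((z - q) ^ j)⁻¹ • a q j := by
      refine Finset.sum_congr rfl fun q hq => ?_
      have hqp : q ≠ p := fun h => hp (h ▸ hq)
      simp [hqp]
    rw [h1, add_left_comm, ← hFA z hzU hz.2, hF₁ne z hz.1]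
    simp [hPP]

end PrincipalPart

end SepMer


namespace SepMer

/-! ### Circle integrals and residues -/

section Circle

variable {E : Type*} [NormedAddCommGroup E] [NormedSpace ℂ E] [CompleteSpace E]

lemma circleIntegral_sub_pow_inv_smul_of_mem_ball {c b : ℂ} {r : ℝ} (hb : b ∈ Metric.ball c r)
    {j : ℕ} (hj : 1 ≤ j) (a : E) :
    (∮ z in C(c, r), ((z - b) ^ j)⁻¹ • a) = if j = 1 then (2 * Real.pi * Complex.I : ℂ) • a else 0
      := by
  rw [circleIntegral.integral_smul_const]
  split_ifs with h
  · subst h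
    simp only [pow_one]
    rw [circleIntegral.integral_sub_inv_of_mem_ball hb]
  · have : (∮ z in C(c, r), ((z - b) ^ j)⁻¹) = ∮ z in C(c, r), (z - b) ^ (-(j : ℤ)) := by
      simp only [zpow_neg, zpow_natCast]
    rw [this, circleIntegral.integral_sub_zpow_of_ne (by omega), zero_smul]

lemma circleIntegral_sub_pow_inv_smul_of_notMem {X : Type*} [NormedAddCommGroup X]
    [NormedSpace ℂ X] {c b : ℂ} {r : ℝ} (hr : 0 ≤ r)
    (hb : b ∉ Metric.closedBall c r) (j : ℕ) (a : X) :
    (∮ z in C(c, r), ((z - b) ^ j)⁻¹ • a) = 0 := by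
  have h : ∀ z ∈ Metric.closedBall c r, DifferentiableAt ℂ (fun z => ((z - b) ^ j)⁻¹ • a) z := by
    intro z hz
    refine DifferentiableAt.smul_const (DifferentiableAt.inv (by fun_prop) ?_) _
    exact pow_ne_zero _ (sub_ne_zero.2 fun h => hb (h ▸ hz))
  exact Complex.circleIntegral_eq_zero_of_differentiable_on_off_countable hr countable_empty
    (fun z hz => (h z hz).continuousAt.continuousWithinAt)
    (fun z hz => h z (Metric.ball_subset_closedBall hz.1))

lemma circleIntegral_eq_zero_of_differentiableOn {X : Type*} [NormedAddCommGroup X]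
    [NormedSpace ℂ X] {U : Set ℂ} (hU : IsOpen U) {c : ℂ} {r : ℝ} (hr : 0 ≤ r)
    (hsub : Metric.closedBall c r ⊆ U) {A : ℂ → X} (hA : DifferentiableOn ℂ A U) :
    (∮ z in C(c, r), A z) = 0 :=
  Complex.circleIntegral_eq_zero_of_differentiable_on_off_countable hr countable_empty
    (hA.continuousOn.mono hsub)
    (fun _ hz => hA.differentiableAt (hU.mem_nhds (hsub (Metric.ball_subset_closedBall hz.1))))

open Classical in
/-- The circle integral of a sum of a holomorphic function and principal parts. -/
lemma circleIntegral_principalParts {U : Set ℂ} (hU : IsOpen U) {c : ℂ} {r : ℝ}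
    (hr : 0 ≤ r) (hsub : Metric.closedBall c r ⊆ U) {S : Finset ℂ}
    (hS : ∀ p ∈ S, p ∉ Metric.sphere c r) {F A : ℂ → E} {N : ℂ → ℕ} {a : ℂ → ℕ → E}
    (hA : DifferentiableOn ℂ A U)
    (hF : ∀ z ∈ U, z ∉ S → F z = A z + ∑ p ∈ S, ∑ j ∈ Finset.Icc 1 (N p), ((z - p) ^ j)⁻¹ • a p j) :
    (∮ z in C(c, r), F z) = ∑ p ∈ S, ∑ j ∈ Finset.Icc 1 (N p),
      if p ∈ Metric.ball c r ∧ j = 1 then (2 * Real.pi * Complex.I : ℂ) • a p j else 0 := by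
  have hterm : ∀ p ∈ S, ∀ j, CircleIntegrable (fun z => ((z - p) ^ j)⁻¹ • a p j) c r := by
    intro p hp j
    refine ContinuousOn.circleIntegrable hr (ContinuousOn.smul (ContinuousOn.inv₀ (by fun_prop) ?_)
      continuousOn_const)
    exact fun z hz => pow_ne_zero _ (sub_ne_zero.2 fun h => hS p hp (h ▸ hz))
  have h1 : (∮ z in C(c, r), F z) = ∮ z in C(c, r), (A z +
      ∑ p ∈ S, ∑ j ∈ Finset.Icc 1 (N p), ((z - p) ^ j)⁻¹ • a p j) :=
    circleIntegral.integral_congr hr fun z hz =>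
      hF z (hsub (Metric.sphere_subset_closedBall hz)) fun h => hS z h hz
  rw [h1, circleIntegral.integral_add
    ((hA.continuousOn.mono (Metric.sphere_subset_closedBall.trans hsub)).circleIntegrable hr)
    (CircleIntegrable.fun_sum _ fun p hp => CircleIntegrable.fun_sum _ fun j _ => hterm p hp j),
    circleIntegral_eq_zero_of_differentiableOn hU hr hsub hA, zero_add,
    circleIntegral.integral_fun_sum fun p hp => CircleIntegrable.fun_sum _ fun j _ => hterm p hp j]
  refine Finset.sum_congr rfl fun p hp => ?_
  rw [circleIntegral.integral_fun_sum fun j _ => hterm p hp j]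
  refine Finset.sum_congr rfl fun j hj => ?_
  by_cases hpb : p ∈ Metric.ball c r
  · rw [circleIntegral_sub_pow_inv_smul_of_mem_ball hpb (Finset.mem_Icc.1 hj).1]
    simp only [hpb, true_and]
  · rw [circleIntegral_sub_pow_inv_smul_of_notMem hr, if_neg fun h => hpb h.1]
    intro h
    rw [← Metric.ball_union_sphere] at h
    exact h.elim hpb (hS p hp)

/-- A circle integral is the sum of the integrals over small circles around the poles. -/
lemma circleIntegral_eq_sum_circleIntegral {U : Set ℂ} (hU : IsOpen U) {c : ℂ} {r : ℝ}
    (hr : 0 ≤ r) (hsub : Metric.closedBall c r ⊆ U) {S : Finset ℂ}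
    (hS : ∀ p ∈ S, p ∈ Metric.ball c r) {F : ℂ → E} (hF : DifferentiableOn ℂ F (U \ S))
    (hFm : ∀ p ∈ S, MeromorphicAt F p) {ε : ℝ} (hε : 0 < ε)
    (hεsub : ∀ p ∈ S, Metric.closedBall p ε ⊆ Metric.ball c r)
    (hεdisj : ∀ p ∈ S, ∀ q ∈ S, p ≠ q → q ∉ Metric.closedBall p ε) :
    (∮ z in C(c, r), F z) = ∑ b ∈ S, ∮ z in C(b, ε), F z := by
  -- A single decomposition serves the large circle and all the small ones. Each small circle sees
  -- only the simple coefficient of its own pole.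
  obtain ⟨N, a, A, hA, hFA⟩ := exists_principalParts hU S hF hFm
  rw [circleIntegral_principalParts hU hr hsub (fun p hp h => by
    have := hS p hp; rw [Metric.mem_ball] at this; rw [Metric.mem_sphere] at h; linarith) hA hFA]
  refine Finset.sum_congr rfl fun b hb => ?_
  rw [circleIntegral_principalParts hU hε.le
    ((hεsub b hb).trans (Metric.ball_subset_closedBall.trans hsub)) ?_ hA hFA]
  · rw [Finset.sum_eq_single_of_mem b hb]
    · refine Finset.sum_congr rfl fun j _ => ?_
      simp [hS b hb, hε]
    · intro q hq hqb
      refine Finset.sum_eq_zero fun j _ => if_neg fun h => ?_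
      exact hεdisj b hb q hq hqb.symm (Metric.ball_subset_closedBall h.1)
  · intro p hp h
    by_cases hpb : p = b
    · subst hpb; simp [hε.ne] at h
    · exact hεdisj b hb p hp (Ne.symm hpb) (Metric.sphere_subset_closedBall h)

end Circle

/-! ### Taylor remainders -/

section Taylor

variable {E : Type*} [NormedAddCommGroup E] [NormedSpace ℂ E] [CompleteSpace E]

open Nat in
/-- Taylor's formula with a bound for the remainder depending only on the supremum. -/
lemma norm_sub_taylor_le {f : ℂ → E} {c : ℂ} {r B : ℝ} (hr : 0 < r)
    (hf : DifferentiableOn ℂ f (Metric.closedBall c r))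
    (hB : ∀ w ∈ Metric.closedBall c r, ‖f w‖ ≤ B) (m : ℕ) {w : ℂ} (hw : ‖w - c‖ ≤ r / 2) :
    ‖f w - ∑ k ∈ Finset.range m, (w - c) ^ k • ((k ! : ℂ)⁻¹ • iteratedDeriv k f c)‖
      ≤ 2 * B * (r⁻¹) ^ m * ‖w - c‖ ^ m := by
  have hB0 : 0 ≤ B := (norm_nonneg _).trans (hB c (Metric.mem_closedBall_self hr.le))
  have hwb : w ∈ Metric.ball c r := by rw [Metric.mem_ball, dist_eq_norm]; linarith
  have hsum := Complex.hasSum_taylorSeries_on_ball (hf.mono Metric.ball_subset_closedBall) hwb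
  have hsum' : HasSum (fun k : ℕ => (w - c) ^ k • ((k ! : ℂ)⁻¹ • iteratedDeriv k f c)) (f w) := by
    convert hsum using 2 with k
    rw [smul_comm]
  have hsum2 := (hasSum_nat_add_iff' m).2 hsum'
  set q : ℝ := ‖w - c‖ / r with hq
  have hq0 : 0 ≤ q := by positivity
  have hq2 : q ≤ 1 / 2 := by rw [hq, div_le_iff₀ hr]; linarith
  have hgeo : HasSum (fun k : ℕ => B * q ^ m * q ^ k) (B * q ^ m * (1 - q)⁻¹) :=
    (hasSum_geometric_of_lt_one hq0 (by linarith)).mul_left _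
  have hle := hsum2.norm_le_of_bounded hgeo fun k => by
    have hc := Complex.norm_iteratedDeriv_le_of_forall_mem_sphere_norm_le (k + m) hr
      (hf.diffContOnCl_ball subset_rfl)
      (fun z hz => hB z (Metric.sphere_subset_closedBall hz))
    rw [norm_smul, norm_smul, norm_pow, norm_inv, Complex.norm_natCast]
    calc ‖w - c‖ ^ (k + m) * (((k + m)! : ℝ)⁻¹ * ‖iteratedDeriv (k + m) f c‖)
        ≤ ‖w - c‖ ^ (k + m) * (((k + m)! : ℝ)⁻¹ * ((k + m)! * B / r ^ (k + m))) := by gcongr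
      _ = B * q ^ m * q ^ k := by
        have : ((k + m)! : ℝ) ≠ 0 := by positivity
        rw [hq, div_pow, div_pow, pow_add, pow_add]; field_simp
  refine hle.trans ?_
  -- Staying within half the radius gives geometric ratio at most `1 / 2`, which is the source of
  -- the factor `2`.
  have h1 : (1 - q)⁻¹ ≤ 2 := by
    rw [inv_le_comm₀ (by linarith) (by norm_num)]; linarith
  calc B * q ^ m * (1 - q)⁻¹ ≤ B * q ^ m * 2 := by gcongr
    _ = 2 * B * (r⁻¹) ^ m * ‖w - c‖ ^ m := by rw [hq, div_eq_mul_inv, mul_pow]; ring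

end Taylor

/-! ### Calculus of finite rank principal parts -/

section FiniteRank

variable {E : Type*} [NormedAddCommGroup E] [NormedSpace ℂ E]

lemma AnalyticAt.hasFiniteRankPrincipalPartAt {f : ℂ → E →L[ℂ] E} {z₀ : ℂ}
    (hf : AnalyticAt ℂ f z₀) : HasFiniteRankPrincipalPartAt f z₀ :=
  ⟨0, 0, f, hf, fun j => by
    have : LinearMap.range ((0 : ℕ → E →L[ℂ] E) j).toLinearMap = ⊥ := LinearMap.range_zero
    rw [this]; infer_instance, by simp⟩

lemma HasFiniteRankPrincipalPartAt.congr {f g : ℂ → E →L[ℂ] E} {z₀ : ℂ}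
    (hf : HasFiniteRankPrincipalPartAt f z₀) (h : g =ᶠ[𝓝[≠] z₀] f) :
    HasFiniteRankPrincipalPartAt g z₀ := by
  obtain ⟨N, A, F, hF, hA, hfF⟩ := hf
  exact ⟨N, A, F, hF, hA, by filter_upwards [h, hfF] with z h1 h2 using h1.trans h2⟩

lemma finiteDimensional_range_add {A B : E →L[ℂ] E}
    (hA : FiniteDimensional ℂ (LinearMap.range A.toLinearMap))
    (hB : FiniteDimensional ℂ (LinearMap.range B.toLinearMap)) :
    FiniteDimensional ℂ (LinearMap.range (A + B).toLinearMap) := by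
  refine Submodule.finiteDimensional_of_le
    (S₂ := LinearMap.range A.toLinearMap ⊔ LinearMap.range B.toLinearMap) ?_
  rintro _ ⟨x, rfl⟩
  exact Submodule.add_mem_sup ⟨x, rfl⟩ ⟨x, rfl⟩

lemma finiteDimensional_range_smul {A : E →L[ℂ] E} (c : ℂ)
    (hA : FiniteDimensional ℂ (LinearMap.range A.toLinearMap)) :
    FiniteDimensional ℂ (LinearMap.range (c • A).toLinearMap) := by
  refine Submodule.finiteDimensional_of_le (S₂ := LinearMap.range A.toLinearMap) ?_
  rintro _ ⟨x, rfl⟩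
  exact Submodule.smul_mem _ c ⟨x, rfl⟩

lemma finiteDimensional_range_zero :
    FiniteDimensional ℂ (LinearMap.range (0 : E →L[ℂ] E).toLinearMap) := by
  have : LinearMap.range (0 : E →L[ℂ] E).toLinearMap = ⊥ := LinearMap.range_zero
  rw [this]; infer_instance

/-- Zero padding, so that principal parts of different lengths can be added coefficientwise. -/
lemma sum_Icc_extend {V : Type*} [AddCommGroup V] [Module ℂ V] (N M : ℕ) (hNM : N ≤ M)
    (A : ℕ → V) (c : ℕ → ℂ) :
    ∑ j ∈ Finset.Icc 1 M, c j • (if j ≤ N then A j else 0) = ∑ j ∈ Finset.Icc 1 N, c j • A j := by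
  rw [← Finset.sum_subset (Finset.Icc_subset_Icc_right hNM)]
  · exact Finset.sum_congr rfl fun j hj => by rw [if_pos (Finset.mem_Icc.1 hj).2]
  · intro j hj hj'
    rw [if_neg, smul_zero]
    simp only [Finset.mem_Icc] at hj hj'
    omega

lemma HasFiniteRankPrincipalPartAt.add {f g : ℂ → E →L[ℂ] E} {z₀ : ℂ}
    (hf : HasFiniteRankPrincipalPartAt f z₀) (hg : HasFiniteRankPrincipalPartAt g z₀) :
    HasFiniteRankPrincipalPartAt (fun z => f z + g z) z₀ := by
  obtain ⟨N, A, F, hF, hA, hfF⟩ := hf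
  obtain ⟨M, B, G, hG, hB, hgG⟩ := hg
  refine ⟨max N M, fun j => (if j ≤ N then A j else 0) + (if j ≤ M then B j else 0),
    fun z => F z + G z, hF.add hG, fun j => ?_, ?_⟩
  · refine finiteDimensional_range_add ?_ ?_
    · by_cases h : j ≤ N
      · rw [if_pos h]; exact hA j
      · rw [if_neg h]; exact finiteDimensional_range_zero
    · by_cases h : j ≤ M
      · rw [if_pos h]; exact hB j
      · rw [if_neg h]; exact finiteDimensional_range_zero
  · filter_upwards [hfF, hgG] with z h1 h2
    simp only [smul_add, Finset.sum_add_distrib]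
    rw [sum_Icc_extend N _ (le_max_left _ _), sum_Icc_extend M _ (le_max_right _ _), h1, h2]
    abel

lemma HasFiniteRankPrincipalPartAt.sum {ι : Type*} (s : Finset ι) {f : ι → ℂ → E →L[ℂ] E} {z₀ : ℂ}
    (hf : ∀ i ∈ s, HasFiniteRankPrincipalPartAt (f i) z₀) :
    HasFiniteRankPrincipalPartAt (fun z => ∑ i ∈ s, f i z) z₀ := by
  classical
  induction s using Finset.induction_on with
  | empty => simpa using AnalyticAt.hasFiniteRankPrincipalPartAt analyticAt_const
  | insert i s hi ih =>
    simp only [Finset.sum_insert hi]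
    exact (hf i (Finset.mem_insert_self i s)).add
      (ih fun j hj => hf j (Finset.mem_insert_of_mem hj))

lemma MeromorphicAt.hasFiniteRankPrincipalPartAt_smul_const {φ : ℂ → ℂ} {z₀ : ℂ}
    (hφ : MeromorphicAt φ z₀) {A : E →L[ℂ] E}
    (hA : FiniteDimensional ℂ (LinearMap.range A.toLinearMap)) :
    HasFiniteRankPrincipalPartAt (fun z => φ z • A) z₀ := by
  obtain ⟨N, a, h, hh, hφh⟩ := MeromorphicAt.exists_principalPart hφ
  refine ⟨N, fun j => a j • A, fun z => h z • A, hh.smul analyticAt_const,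
    fun j => finiteDimensional_range_smul _ hA, ?_⟩
  filter_upwards [hφh] with z hz
  rw [hz, add_smul, Finset.sum_smul]
  simp only [smul_assoc]

lemma HasFiniteRankPrincipalPartAt.const_smul {f : ℂ → E →L[ℂ] E} {z₀ : ℂ} (c : ℂ)
    (hf : HasFiniteRankPrincipalPartAt f z₀) : HasFiniteRankPrincipalPartAt (fun z => c • f z) z₀
      := by
  obtain ⟨N, A, F, hF, hA, hfF⟩ := hf
  refine ⟨N, fun j => c • A j, fun z => c • F z, by have := hF.const_smul (c := c); exact this,
    fun j => finiteDimensional_range_smul _ (hA j), ?_⟩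
  filter_upwards [hfF] with z hz
  rw [hz, smul_add, Finset.smul_sum]
  simp only [smul_comm c]

lemma HasFiniteRankPrincipalPartAt.meromorphicAt {f : ℂ → E →L[ℂ] E} {z₀ : ℂ}
    (hf : HasFiniteRankPrincipalPartAt f z₀) : MeromorphicAt f z₀ := by
  obtain ⟨N, A, F, hF, hA, hfF⟩ := hf
  refine (hF.meromorphicAt.add ?_).congr (hfF.mono fun z hz => hz.symm)
  refine MeromorphicAt.fun_sum fun j _ => ?_
  have h : MeromorphicAt (fun z : ℂ => (z - z₀) ^ j) z₀ := by fun_prop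
  exact h.inv.smul (MeromorphicAt.const _ _)

/-- Removable singularities: a function that is holomorphic and bounded near a point, apart from
that point, agrees there with an analytic function. -/
lemma exists_analyticAt_of_bounded [CompleteSpace E] {f : ℂ → E} {z₀ : ℂ} {B : ℝ}
    (hd : ∀ᶠ z in 𝓝[≠] z₀, DifferentiableAt ℂ f z) (hb : ∀ᶠ z in 𝓝[≠] z₀, ‖f z‖ ≤ B) :
    ∃ h : ℂ → E, AnalyticAt ℂ h z₀ ∧ f =ᶠ[𝓝[≠] z₀] h := by
  obtain ⟨s, hs, hds⟩ := (eventually_nhdsWithin_iff.1 (hd.and hb)).exists_mem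
  refine ⟨Function.update f z₀ (limUnder (𝓝[≠] z₀) f), ?_, ?_⟩
  · have hd' : DifferentiableOn ℂ f (s \ {z₀}) := fun z hz =>
      (hds z hz.1 hz.2).1.differentiableWithinAt
    have hb' : BddAbove (norm ∘ f '' (s \ {z₀})) := by
      refine ⟨B, ?_⟩
      rintro _ ⟨z, hz, rfl⟩
      exact (hds z hz.1 hz.2).2
    exact (Complex.differentiableOn_update_limUnder_of_bddAbove hs hd' hb').analyticAt hs
  · filter_upwards [self_mem_nhdsWithin] with z hz
    rw [Function.update_of_ne hz]

end FiniteRank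

end SepMer


namespace SepMer

/-! ### Locally constant functions off a thin set -/

section LocallyConstant

lemma eq_of_isPreconnected_of_eventually_eq {f : ℂ → ℂ} {s : Set ℂ} (hs : IsPreconnected s)
    (hf : ∀ z ∈ s, ∀ᶠ z' in 𝓝[s] z, f z' = f z) {x y : ℂ} (hx : x ∈ s) (hy : y ∈ s) :
    f x = f y := by
  have : PreconnectedSpace s := isPreconnected_iff_preconnectedSpace.1 hs
  have hlc : IsLocallyConstant (s.domRestrict f) := by
    rw [IsLocallyConstant.iff_eventually_eq]
    rintro ⟨z, hz⟩
    have := hf z hz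
    rw [← map_nhds_subtype_val ⟨z, hz⟩] at this
    exact this
  exact hlc.apply_eq_of_preconnectedSpace ⟨x, hx⟩ ⟨y, hy⟩

/-- A function on a preconnected open set that is constant near every point, apart from a set
with dense complement, is constant apart from that set. -/
lemma eq_of_locally_const_off {f : ℂ → ℂ} {D I : Set ℂ} (hD : IsPreconnected D)
    (hI : Dense Iᶜ) (h : ∀ q ∈ D, ∃ δ > 0, ∃ κ, ∀ z ∈ Metric.ball q δ, z ∉ I → f z = κ) :
    ∃ κ, ∀ z ∈ D, z ∉ I → f z = κ := by
  choose! δ hδ κ hκ using h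
  -- The local constants agree because the complement of `I` is dense: two overlapping balls share a
  -- point off `I`.
  have hloc : ∀ q ∈ D, ∀ᶠ q' in 𝓝[D] q, κ q' = κ q := by
    intro q hq
    have h1 : ∀ᶠ q' in 𝓝[D] q, q' ∈ Metric.ball q (δ q) :=
      mem_nhdsWithin_of_mem_nhds (Metric.ball_mem_nhds q (hδ q hq))
    filter_upwards [h1, self_mem_nhdsWithin] with q' h2 h3
    obtain ⟨z, hz, hzI⟩ := hI.inter_open_nonempty _
      (Metric.isOpen_ball.inter Metric.isOpen_ball (s := Metric.ball q (δ q)) (t := Metric.ball q'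
        (δ q')))
      ⟨q', h2, Metric.mem_ball_self (hδ q' h3)⟩
    rw [← hκ q hq z hz.1 hzI, ← hκ q' h3 z hz.2 hzI]
  rcases D.eq_empty_or_nonempty with rfl | ⟨q₀, hq₀⟩
  · exact ⟨0, fun z hz => absurd hz (notMem_empty z)⟩
  · refine ⟨κ q₀, fun z hz hzI => ?_⟩
    rw [← eq_of_isPreconnected_of_eventually_eq hD hloc hz hq₀]
    exact hκ z hz z (Metric.mem_ball_self (hδ z hz)) hzI

end LocallyConstant

/-! ### The Cauchy kernel along a curve and its jump -/

section CurveKernel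

variable {c : ℝ → ℂ} {a b : ℝ}

lemma intervalIntegrable_kernel (hc : ContDiff ℝ 1 c) {z : ℂ}
    (hz : ∀ t ∈ uIcc a b, c t ≠ z) :
    IntervalIntegrable (fun t => deriv c t * (c t - z)⁻¹) volume a b := by
  apply ContinuousOn.intervalIntegrable
  refine ContinuousOn.mul (hc.continuous_deriv le_rfl).continuousOn
    (ContinuousOn.inv₀ (hc.continuous.continuousOn.sub continuousOn_const) ?_)
  exact fun t ht => sub_ne_zero.2 (hz t ht)

/-- The Cauchy integral of the constant function `1` along a curve, and its derivative. -/
lemma hasDerivAt_kernel (hc : ContDiff ℝ 1 c) {z : ℂ} (hz : ∀ t ∈ uIcc a b, c t ≠ z) :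
    HasDerivAt (fun z => ∫ t in a..b, deriv c t * (c t - z)⁻¹)
      ((c a - z)⁻¹ - (c b - z)⁻¹) z := by
  have hK : IsCompact (c '' uIcc a b) := isCompact_uIcc.image hc.continuous
  have hzK : z ∈ (c '' uIcc a b)ᶜ := by
    rintro ⟨t, ht, h⟩; exact hz t ht h
  obtain ⟨δ, hδ, hball⟩ := Metric.isOpen_iff.1 hK.isClosed.isOpen_compl z hzK
  have hdist : ∀ w ∈ Metric.ball z (δ / 2), ∀ t ∈ uIcc a b, δ / 2 ≤ ‖c t - w‖ := by
    intro w hw t ht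
    by_contra! hlt
    have : c t ∈ Metric.ball z δ := by
      rw [Metric.mem_ball, dist_eq_norm] at hw ⊢
      calc ‖c t - z‖ = ‖(c t - w) + (w - z)‖ := by ring_nf
        _ ≤ ‖c t - w‖ + ‖w - z‖ := norm_add_le _ _
        _ < δ := by linarith
    exact hball this ⟨t, ht, rfl⟩
  obtain ⟨M, hM⟩ := isCompact_uIcc.exists_bound_of_continuousOn (s := uIcc a b)
    (hc.continuous_deriv le_rfl).continuousOn
  have hne : ∀ w ∈ Metric.ball z (δ / 2), ∀ t ∈ uIcc a b, c t - w ≠ 0 := by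
    intro w hw t ht h0
    have := hdist w hw t ht
    rw [h0, norm_zero] at this
    linarith
  have hzmem : z ∈ Metric.ball z (δ / 2) := Metric.mem_ball_self (by positivity)
  have key := intervalIntegral.hasDerivAt_integral_of_dominated_loc_of_deriv_le
    (F := fun w t => deriv c t * (c t - w)⁻¹) (F' := fun w t => deriv c t * ((c t - w) ^ 2)⁻¹)
    (μ := volume) (a := a) (b := b) (x₀ := z) (s := Metric.ball z (δ / 2))
    (bound := fun _ => M * ((δ / 2) ^ 2)⁻¹)
    (Metric.ball_mem_nhds z (by positivity)) ?_ (intervalIntegrable_kernel hc hz) ?_ ?_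
    (by simp) ?_
  -- The differentiated integrand is the `t`-derivative of `-(c t - z)⁻¹`, so only the endpoints of
  -- the curve enter the derivative in `z`.
  · have hFTC : ∫ t in a..b, deriv c t * ((c t - z) ^ 2)⁻¹ = -(c b - z)⁻¹ - -(c a - z)⁻¹ := by
      apply intervalIntegral.integral_eq_sub_of_hasDerivAt (f := fun t => -(c t - z)⁻¹)
      · intro t ht
        have h1 : HasDerivAt (fun t => c t - z) (deriv c t) t :=
          ((hc.differentiable one_ne_zero t).hasDerivAt).sub_const z
        exact (h1.inv (hne z hzmem t ht)).neg.congr_deriv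
          (by rw [neg_div, neg_neg, div_eq_mul_inv])
      · apply ContinuousOn.intervalIntegrable
        refine ContinuousOn.mul (hc.continuous_deriv le_rfl).continuousOn
          (ContinuousOn.inv₀ ((hc.continuous.continuousOn.sub continuousOn_const).pow 2) ?_)
        exact fun t ht => pow_ne_zero _ (hne z hzmem t ht)
    have h2 := key.2
    rw [hFTC] at h2
    exact h2.congr_deriv (by ring)
  · filter_upwards [Metric.ball_mem_nhds z (half_pos hδ)] with w hw
    exact (intervalIntegrable_kernel hc fun t ht => sub_ne_zero.1 (hne w hw t
      ht)).aestronglyMeasurable_restrict_uIoc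
  · apply ContinuousOn.aestronglyMeasurable _ measurableSet_uIoc
    refine ContinuousOn.mul (hc.continuous_deriv le_rfl).continuousOn
      (ContinuousOn.inv₀ ((hc.continuous.continuousOn.sub continuousOn_const).pow 2) ?_)
    exact fun t ht => pow_ne_zero _ (hne z hzmem t (uIoc_subset_uIcc ht))
  · refine Eventually.of_forall fun t ht w hw => ?_
    have ht' := uIoc_subset_uIcc ht
    rw [norm_mul, norm_inv, norm_pow]
    have := hdist w hw t ht'
    have hM0 : 0 ≤ M := (norm_nonneg _).trans (hM t ht')
    have h3 : 0 < δ / 2 := by positivity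
    exact mul_le_mul (hM t ht') (by gcongr) (by positivity) hM0
  · refine Eventually.of_forall fun t ht w hw => ?_
    have h1 : HasDerivAt (fun w => c t - w) (-1) w := by
      simpa using (hasDerivAt_id w).const_sub (c t)
    exact ((h1.inv (hne w hw t (uIoc_subset_uIcc ht))).const_mul (deriv c t)).congr_deriv
      (by rw [neg_neg, one_div])

/-- The kernel decays uniformly on a compact arc. This normalisation at infinity later fixes the
additive constant in the comparison of two contours. -/
lemma tendsto_kernel_atTop (hc : ContDiff ℝ 1 c) :
    Tendsto (fun x : ℝ => ∫ t in a..b, deriv c t * (c t - x)⁻¹) atTop (𝓝 0) := by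
  obtain ⟨R, hR⟩ := isCompact_uIcc.exists_bound_of_continuousOn (s := uIcc a b)
    hc.continuous.continuousOn
  have hlim : ∀ w : ℂ, Tendsto (fun x : ℝ => (w - x)⁻¹) atTop (𝓝 0) := by
    intro w
    apply tendsto_inv₀_cobounded.comp
    rw [← tendsto_norm_atTop_iff_cobounded]
    refine tendsto_atTop_mono (f := fun x : ℝ => x - ‖w‖) (fun x => ?_)
      (tendsto_atTop_add_const_right _ _ tendsto_id)
    have := norm_sub_norm_le (x : ℂ) w
    rw [norm_sub_rev]
    rw [Complex.norm_real, Real.norm_eq_abs] at this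
    linarith [le_abs_self x]
  have key := intervalIntegral.tendsto_integral_filter_of_dominated_convergence
    (μ := volume) (a := a) (b := b) (l := (atTop : Filter ℝ))
    (F := fun (x : ℝ) t => deriv c t * (c t - x)⁻¹) (f := fun _ => 0)
    (fun t => ‖deriv c t‖) ?_ ?_ ?_ ?_
  · simpa using key
  · filter_upwards [eventually_ge_atTop (R + 1)] with x hx
    refine (intervalIntegrable_kernel hc fun t ht h => ?_).aestronglyMeasurable_restrict_uIoc
    have := hR t ht
    rw [h, Complex.norm_real, Real.norm_eq_abs] at this
    linarith [le_abs_self x]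
  · filter_upwards [eventually_ge_atTop (R + 1)] with x hx
    refine Eventually.of_forall fun t ht => ?_
    have h1 := hR t (uIoc_subset_uIcc ht)
    have h2 := norm_sub_norm_le (x : ℂ) (c t)
    rw [norm_sub_rev, Complex.norm_real, Real.norm_eq_abs] at h2
    have h3 : 1 ≤ ‖c t - x‖ := by linarith [le_abs_self x]
    rw [norm_mul, norm_inv]
    exact mul_le_of_le_one_right (norm_nonneg _) (inv_le_one_of_one_le₀ h3)
  · exact (hc.continuous_deriv le_rfl).norm.intervalIntegrable _ _
  · refine Eventually.of_forall fun t ht => ?_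
    simpa using (hlim (c t)).const_mul (deriv c t)

/-- The jump of the Cauchy integral across a curve. -/
lemma tendsto_kernel_jump (hc : ContDiff ℝ 1 c) {t₀ η : ℝ} (hη : 0 < η) (hd : deriv c t₀ ≠ 0)
    (hmono : StrictMonoOn (fun t => ((c t - c t₀) / deriv c t₀).re) (Icc (t₀ - η) (t₀ + η))) :
    Tendsto (fun ε : ℝ =>
      (∫ t in (t₀ - η)..(t₀ + η), deriv c t * (c t - (c t₀ + ε * Complex.I * deriv c t₀))⁻¹) -
      ∫ t in (t₀ - η)..(t₀ + η), deriv c t * (c t - (c t₀ - ε * Complex.I * deriv c t₀))⁻¹)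
      (𝓝[>] 0) (𝓝 (2 * Real.pi * Complex.I)) := by
  set d := deriv c t₀ with hdd
  set u : ℝ → ℂ := fun t => (c t - c t₀) / d with hu
  have ht₀ : t₀ ∈ Icc (t₀ - η) (t₀ + η) := ⟨by linarith, by linarith⟩
  have hu0 : u t₀ = 0 := by simp [hu]
  have hup : 0 < (u (t₀ + η)).re := by
    have := hmono ht₀ ⟨by linarith, le_rfl⟩ (by linarith : t₀ < t₀ + η)
    simpa [hu0] using this
  have hum : (u (t₀ - η)).re < 0 := by
    have := hmono ⟨le_rfl, by linarith⟩ ht₀ (by linarith : t₀ - η < t₀)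
    simpa [hu0] using this
  have hure : ∀ t ∈ Icc (t₀ - η) (t₀ + η), t ≠ t₀ → (u t).re ≠ 0 := by
    intro t ht hne h0
    apply hne
    apply hmono.injOn ht ht₀
    change (u t).re = (u t₀).re
    rw [h0, hu0, Complex.zero_re]
  have huder : ∀ t, HasDerivAt u (deriv c t / d) t := fun t =>
    (((hc.differentiable one_ne_zero t).hasDerivAt).sub_const _).div_const _
  -- In the tangent coordinate `u`, rotation by `s = ± i` turns `Re u` into `±` the imaginary part.
  -- Monotonicity of `Re u` makes that part nonzero except at `t₀`, where the value is the positive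
  -- number `ε`. So the whole rotated arc avoids the branch cut of the principal logarithm.
  have hslit : ∀ s : ℂ, (s = Complex.I ∨ s = -Complex.I) → ∀ ε : ℝ, 0 < ε →
      ∀ t ∈ Icc (t₀ - η) (t₀ + η), s * u t + ε ∈ Complex.slitPlane := by
    intro s hs ε hε t ht
    by_cases h : t = t₀
    · subst h; rw [hu0]; simp [Complex.mem_slitPlane_iff, hε]
    · right
      rcases hs with rfl | rfl <;> simpa using hure t ht h
  -- The point `c t₀ + ε s d` is chosen so that the logarithm of `s u + ε` is an exact primitive of
  -- the kernel. The jump can then be read off from the endpoint values alone.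
  have hint : ∀ s : ℂ, (s = Complex.I ∨ s = -Complex.I) → ∀ ε : ℝ, 0 < ε →
      ∫ t in (t₀ - η)..(t₀ + η), deriv c t * (c t - (c t₀ + ε * s * d))⁻¹ =
      Complex.log (s * u (t₀ + η) + ε) - Complex.log (s * u (t₀ - η) + ε) := by
    intro s hs ε hε
    have hs2 : s * s = -1 := by rcases hs with rfl | rfl <;> simp
    have hs0 : s ≠ 0 := by rintro rfl; simp at hs2
    have hIcc : uIcc (t₀ - η) (t₀ + η) = Icc (t₀ - η) (t₀ + η) := uIcc_of_le (by linarith)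
    have hcu : ∀ t, c t - (c t₀ + ε * s * d) = d * (-s) * (s * u t + ε) := by
      intro t
      have : c t = c t₀ + d * u t := by simp only [hu]; field_simp; ring
      rw [this]
      generalize u t = v
      linear_combination (d * v) * hs2
    have hne : ∀ t ∈ uIcc (t₀ - η) (t₀ + η), s * u t + ε ≠ 0 := fun t ht =>
      Complex.slitPlane_ne_zero (hslit s hs ε hε t (hIcc ▸ ht))
    apply intervalIntegral.integral_eq_sub_of_hasDerivAt (f := fun t => Complex.log (s * u t + ε))
    · intro t ht
      convert! (((huder t).const_mul s).add_const (ε : ℂ)).clog_real (hslit s hs ε hε t (hIcc ▸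
        ht)) using 1
      rw [hcu]
      have := hne t ht
      field_simp
      linear_combination (-deriv c t) * hs2
    · apply intervalIntegrable_kernel hc
      intro t ht h
      have h1 := hcu t
      rw [h, sub_self] at h1
      have h2 := hne t ht
      simp [hd, hs0, h2] at h1
  have hlim : Tendsto (fun ε : ℝ =>
      (Complex.log (Complex.I * u (t₀ + η) + ε) - Complex.log (Complex.I * u (t₀ - η) + ε)) -
      (Complex.log (-Complex.I * u (t₀ + η) + ε) - Complex.log (-Complex.I * u (t₀ - η) + ε)))
      (𝓝[>] 0) (𝓝 (2 * Real.pi * Complex.I)) := by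
    have h1 : ∀ w : ℂ, w.im ≠ 0 →
        Tendsto (fun ε : ℝ => Complex.log (w + ε)) (𝓝[>] 0) (𝓝 (Complex.log w)) := by
      intro w hw
      have h2 : Tendsto (fun ε : ℝ => w + ε) (𝓝[>] 0) (𝓝 w) := by
        have : Continuous fun ε : ℝ => w + ε := by fun_prop
        simpa using (this.tendsto 0).mono_left nhdsWithin_le_nhds
      exact h2.clog (Or.inr hw)
    -- Each of the two endpoints of the arc contributes `πi` to the jump.
    have h3 : ∀ w : ℂ, 0 < w.im → Complex.log w - Complex.log (-w) = Real.pi * Complex.I := by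
      intro w hw
      simp only [Complex.log, norm_neg, Complex.arg_neg_eq_arg_sub_pi_of_im_pos hw]
      push_cast; ring
    have e1 := h3 (Complex.I * u (t₀ + η)) (by simpa using hup)
    have e2 := h3 (-(Complex.I * u (t₀ - η))) (by simpa using hum)
    rw [neg_neg] at e2
    have := ((h1 (Complex.I * u (t₀ + η)) (by simpa using hup.ne')).sub
      (h1 (Complex.I * u (t₀ - η)) (by simpa using hum.ne))).sub
      ((h1 (-Complex.I * u (t₀ + η)) (by simpa using hup.ne')).sub
      (h1 (-Complex.I * u (t₀ - η)) (by simpa using hum.ne)))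
    convert this using 2
    simp only [neg_mul] at *
    linear_combination -e1 - e2
  refine hlim.congr' ?_
  filter_upwards [self_mem_nhdsWithin] with ε hε
  rw [← hint _ (Or.inl rfl) ε hε, ← hint _ (Or.inr rfl) ε hε]
  congr! 5
  ring_nf

end CurveKernel

end SepMer


namespace SepMer

/-! ### Crossing a regular arc -/

section Crossing

variable {c : ℝ → ℂ}

/-- The derivative of this function equals `1` at `t₀` and stays positive nearby. A short arc is
therefore a graph over its tangent line. -/
lemma exists_strictMonoOn_re (hc : ContDiff ℝ 1 c) {t₀ : ℝ} (hd : deriv c t₀ ≠ 0) {η₀ : ℝ}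
    (hη₀ : 0 < η₀) : ∃ η > 0, η < η₀ ∧
      StrictMonoOn (fun t => ((c t - c t₀) / deriv c t₀).re) (Icc (t₀ - η) (t₀ + η)) := by
  have hcont : ContinuousAt (fun t => (deriv c t / deriv c t₀).re) t₀ :=
    (Complex.continuous_re.comp ((hc.continuous_deriv le_rfl).div_const _)).continuousAt
  have hpos : 0 < (deriv c t₀ / deriv c t₀).re := by rw [div_self hd]; simp
  obtain ⟨δ, hδ, hball⟩ := Metric.eventually_nhds_iff.1 (hcont.eventually (lt_mem_nhds hpos))
  have hder : ∀ t, HasDerivAt (fun t => ((c t - c t₀) / deriv c t₀).re)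
      (deriv c t / deriv c t₀).re t := by
    intro t
    have h1 : HasDerivAt (fun t => (c t - c t₀) / deriv c t₀) (deriv c t / deriv c t₀) t :=
      (((hc.differentiable one_ne_zero t).hasDerivAt).sub_const _).div_const _
    exact Complex.reCLM.hasFDerivAt.comp_hasDerivAt t h1
  refine ⟨min (δ / 2) (η₀ / 2), by positivity, by
    have := min_le_right (δ / 2) (η₀ / 2); linarith, ?_⟩
  refine strictMonoOn_of_deriv_pos (convex_Icc _ _)
    (fun t _ => (hder t).continuousAt.continuousWithinAt) fun t ht => ?_
  rw [interior_Icc] at ht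
  rw [(hder t).deriv]
  apply hball
  rw [Real.dist_eq, abs_lt]
  have := min_le_left (δ / 2) (η₀ / 2)
  constructor <;> linarith [ht.1, ht.2]

/-- A function that is locally constant off a set which is, near `c t₀`, contained in an arc of a
regular curve, is constant near `c t₀` off this set as soon as its values on the two sides of the
curve agree in the limit. -/
lemma exists_const_of_crossing (hc : ContDiff ℝ 1 c) {t₀ η : ℝ} (hη : 0 < η)
    (hd : deriv c t₀ ≠ 0)
    (hmono : StrictMonoOn (fun t => ((c t - c t₀) / deriv c t₀).re) (Icc (t₀ - η) (t₀ + η)))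
    {I : Set ℂ} (hcI : ∀ t, c t ∈ I) {δ : ℝ} (hδ : 0 < δ)
    (hI : ∀ z ∈ Metric.ball (c t₀) δ, z ∈ I → ∃ t ∈ Icc (t₀ - η) (t₀ + η), z = c t)
    {f : ℂ → ℂ} (hf : ∀ z ∈ Metric.ball (c t₀) δ, z ∉ I → ∀ᶠ z' in 𝓝 z, f z' = f z)
    (hlim : Tendsto (fun ε : ℝ => f (c t₀ + ε * Complex.I * deriv c t₀) -
      f (c t₀ - ε * Complex.I * deriv c t₀)) (𝓝[>] 0) (𝓝 0)) :
    ∃ δ' > 0, ∃ κ, ∀ z ∈ Metric.ball (c t₀) δ', z ∉ I → f z = κ := by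
  set d := deriv c t₀ with hdd
  set u : ℝ → ℂ := fun t => (c t - c t₀) / d with hu
  have hcu : ∀ t, c t = c t₀ + d * u t := fun t => by simp only [hu]; field_simp; ring
  have hu0 : u t₀ = 0 := by simp [hu]
  have hucont : Continuous u := (hc.continuous.sub continuous_const).div_const _
  have hd0 : 0 < ‖d‖ := norm_pos_iff.2 hd
  set b : ℝ := δ / (2 * ‖d‖) with hb
  have hb0 : 0 < b := by positivity
  have hbox : ∀ w : ℂ, |w.re| ≤ b → |w.im| < b → c t₀ + d * w ∈ Metric.ball (c t₀) δ := by
    intro w h1 h2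
    rw [Metric.mem_ball, dist_eq_norm, add_sub_cancel_left, norm_mul]
    have h3 : ‖w‖ < 2 * b := (Complex.norm_le_abs_re_add_abs_im w).trans_lt (by linarith)
    calc ‖d‖ * ‖w‖ < ‖d‖ * (2 * b) := by gcongr
      _ = δ := by rw [hb]; field_simp
  have hdivcancel : ∀ w₁ w₂ : ℂ, c t₀ + d * w₁ = c t₀ + d * w₂ → w₁ = w₂ := by
    intro w₁ w₂ h
    exact mul_left_cancel₀ hd (add_left_cancel h)
  -- a smaller interval on which `Im u` is small
  obtain ⟨η', hη'0, hη'η, him⟩ : ∃ η' > 0, η' ≤ η ∧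
      ∀ t ∈ Icc (t₀ - η') (t₀ + η'), |(u t).im| < b / 2 := by
    have h1 : ContinuousAt (fun t => |(u t).im|) t₀ := by fun_prop
    have h2 : |(u t₀).im| < b / 2 := by rw [hu0]; simpa using hb0
    obtain ⟨e, he, hball⟩ := Metric.eventually_nhds_iff.1 (h1.eventually (gt_mem_nhds h2))
    refine ⟨min (e / 2) η, by positivity, min_le_right _ _, fun t ht => hball ?_⟩
    have := min_le_left (e / 2) η
    rw [Real.dist_eq, abs_lt]
    constructor <;> linarith [ht.1, ht.2]
  have hsub : Icc (t₀ - η') (t₀ + η') ⊆ Icc (t₀ - η) (t₀ + η) :=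
    Icc_subset_Icc (by linarith) (by linarith)
  have ht₀ : t₀ ∈ Icc (t₀ - η) (t₀ + η) := ⟨by linarith, by linarith⟩
  have hup : 0 < (u (t₀ + η')).re := by
    have := hmono ht₀ (hsub ⟨by linarith, le_rfl⟩) (by linarith : t₀ < t₀ + η')
    change (u t₀).re < (u (t₀ + η')).re at this
    rwa [hu0] at this
  have hum : (u (t₀ - η')).re < 0 := by
    have := hmono (hsub ⟨le_rfl, by linarith⟩) ht₀ (by linarith : t₀ - η' < t₀)
    change (u (t₀ - η')).re < (u t₀).re at this
    rwa [hu0] at this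
  -- In tangent coordinates the box has half-width `a` and half-height `b`. The choice of `a` makes
  -- the arc reach across the full width of the box.
  set a : ℝ := min b (min (u (t₀ + η')).re (-(u (t₀ - η')).re)) with ha
  have ha0 : 0 < a := lt_min hb0 (lt_min hup (by linarith))
  have hab : a ≤ b := min_le_left _ _
  have hap : a ≤ (u (t₀ + η')).re := (min_le_right _ _).trans (min_le_left _ _)
  have ham : a ≤ -(u (t₀ - η')).re := (min_le_right _ _).trans (min_le_right _ _)
  have hIVT : ∀ x : ℝ, |x| < a → ∃ t ∈ Icc (t₀ - η') (t₀ + η'), (u t).re = x := by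
    intro x hx
    rw [abs_lt] at hx
    have := intermediate_value_Icc (by linarith : t₀ - η' ≤ t₀ + η')
      (Complex.continuous_re.comp hucont).continuousOn
    obtain ⟨t, ht, h⟩ := this (⟨by simp; linarith, by simp; linarith⟩ :
      x ∈ Icc ((Complex.re ∘ u) (t₀ - η')) ((Complex.re ∘ u) (t₀ + η')))
    exact ⟨t, ht, h⟩
  -- Inside the box the exceptional set is the graph of one function of the real part: it is
  -- contained in the arc, and `Re u` is injective there.
  have huniq : ∀ w : ℂ, |w.re| < a → |w.im| < b → c t₀ + d * w ∈ I →
      ∀ t ∈ Icc (t₀ - η') (t₀ + η'), (u t).re = w.re → u t = w := by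
    intro w h1 h2 hw t ht htw
    obtain ⟨t', ht', h⟩ := hI _ (hbox w (h1.le.trans hab) h2) hw
    have hw' : w = u t' := by
      rw [hcu t'] at h; exact hdivcancel _ _ h
    have : t = t' := hmono.injOn (hsub ht) ht' (by change (u t).re = (u t').re; rw [htw, hw'])
    rw [this, hw']
  set h : ℂ → ℂ := fun w => f (c t₀ + d * w) with hh
  have hloc : ∀ w : ℂ, |w.re| < a → |w.im| < b → c t₀ + d * w ∉ I → ∀ᶠ w' in 𝓝 w, h w' = h w := by
    intro w h1 h2 h3
    have hcont : Continuous fun w : ℂ => c t₀ + d * w := by fun_prop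
    exact hcont.continuousAt.eventually (hf _ (hbox w (h1.le.trans hab) h2) h3)
  -- constancy along preconnected sets off the curve
  have hconst : ∀ s : Set ℂ, IsPreconnected s →
      (∀ w ∈ s, |w.re| < a ∧ |w.im| < b ∧ c t₀ + d * w ∉ I) → ∀ w₁ ∈ s, ∀ w₂ ∈ s, h w₁ = h w₂ := by
    intro s hs hs' w₁ h1 w₂ h2
    refine eq_of_isPreconnected_of_eventually_eq hs (fun z hz => ?_) h1 h2
    obtain ⟨h3, h4, h5⟩ := hs' z hz
    exact (hloc z h3 h4 h5).filter_mono nhdsWithin_le_nhds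
  have hvert : ∀ x y₁ y₂ : ℝ, |x| < a → (∀ y ∈ uIcc y₁ y₂, |y| < b ∧
      c t₀ + d * (x + y * Complex.I) ∉ I) → h (x + y₁ * Complex.I) = h (x + y₂ * Complex.I) := by
    intro x y₁ y₂ hx hy
    refine hconst ((fun y : ℝ => (x + y * Complex.I : ℂ)) '' uIcc y₁ y₂)
      (isPreconnected_uIcc.image _ (by fun_prop)) ?_ _ ⟨y₁, left_mem_uIcc, rfl⟩ _
      ⟨y₂, right_mem_uIcc, rfl⟩
    rintro _ ⟨y, hy', rfl⟩
    exact ⟨by simpa using hx, by simpa using (hy y hy').1, (hy y hy').2⟩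
  have hhoriz : ∀ x₁ x₂ y : ℝ, |y| < b → (∀ x ∈ uIcc x₁ x₂, |x| < a ∧
      c t₀ + d * (x + y * Complex.I) ∉ I) → h (x₁ + y * Complex.I) = h (x₂ + y * Complex.I) := by
    intro x₁ x₂ y hy hx
    refine hconst ((fun x : ℝ => (x + y * Complex.I : ℂ)) '' uIcc x₁ x₂)
      (isPreconnected_uIcc.image _ (by fun_prop)) ?_ _ ⟨x₁, left_mem_uIcc, rfl⟩ _
      ⟨x₂, right_mem_uIcc, rfl⟩
    rintro _ ⟨x, hx', rfl⟩
    exact ⟨by simpa using (hx x hx').1, by simpa using hy, (hx x hx').2⟩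
  have hnotI : ∀ x y : ℝ, |x| < a → |y| < b → ∀ t ∈ Icc (t₀ - η') (t₀ + η'), (u t).re = x →
      (u t).im ≠ y → c t₀ + d * (x + y * Complex.I) ∉ I := by
    intro x y hx hy t ht htx hty hmem
    have := huniq _ (by simpa using hx) (by simpa using hy) hmem t ht (by simpa using htx)
    apply hty; rw [this]; simp
  have ht₀' : t₀ ∈ Icc (t₀ - η') (t₀ + η') := ⟨by linarith, by linarith⟩
  -- every point off the curve has the same value as the points directly above or below `c t₀`
  have habove : ∀ s : ℝ, (s = 1 ∨ s = -1) → ∀ x y : ℝ, |x| < a → |y| < b →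
      ∀ t ∈ Icc (t₀ - η') (t₀ + η'), (u t).re = x → 0 < s * (y - (u t).im) →
      h (x + y * Complex.I) = h ((0 : ℝ) + (s * (3 * b / 4) : ℝ) * Complex.I) := by
    intro s hs x y hx hy t ht htx hpos
    have hyb : |s * (3 * b / 4)| < b := by
      rcases hs with rfl | rfl <;> (rw [abs_lt]; constructor <;> linarith)
    have hy' := abs_lt.1 hy
    have htim := abs_lt.1 (him t ht)
    -- The path moves vertically away from the graph to height `± 3b/4`, then horizontally to the
    -- axis. The horizontal part misses the graph because the arc stays within height `b / 2`.
    rw [hvert x y (s * (3 * b / 4)) hx fun y' hy'' => ?_]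
    · refine hhoriz x 0 _ hyb fun x' hx' => ?_
      have hx'a : |x'| < a := by
        have := abs_sub_right_of_mem_uIcc hx'
        simp only [zero_sub, abs_neg] at this
        exact this.trans_lt hx
      obtain ⟨t', ht', htx'⟩ := hIVT x' hx'a
      refine ⟨hx'a, hnotI _ _ hx'a hyb t' ht' htx' ?_⟩
      have := abs_lt.1 (him t' ht')
      rcases hs with rfl | rfl
      · linarith
      · linarith
    · have hy'b : |y'| < b := by
        rw [abs_lt]
        rcases mem_uIcc.1 hy'' with h1 | h1 <;> rcases hs with rfl | rfl <;>
          constructor <;> linarith [h1.1, h1.2]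
      refine ⟨hy'b, hnotI _ _ hx hy'b t ht htx ?_⟩
      rcases mem_uIcc.1 hy'' with h1 | h1 <;> rcases hs with rfl | rfl
      · linarith [h1.1, h1.2]
      · have := h1.1; have := h1.2; intro h; nlinarith
      · linarith [h1.1, h1.2]
      · have := h1.1; have := h1.2; intro h; nlinarith
  set κ₁ := h ((0 : ℝ) + ((1 : ℝ) * (3 * b / 4) : ℝ) * Complex.I) with hκ₁
  set κ₂ := h ((0 : ℝ) + ((-1 : ℝ) * (3 * b / 4) : ℝ) * Complex.I) with hκ₂
  -- Only two values can occur, one above and one below the arc. Along the normal their difference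
  -- is eventually constant, so the vanishing limit forces them to coincide.
  have hκ : κ₁ = κ₂ := by
    have hev : (fun ε : ℝ => f (c t₀ + ε * Complex.I * d) - f (c t₀ - ε * Complex.I * d))
        =ᶠ[𝓝[>] 0] fun _ => κ₁ - κ₂ := by
      filter_upwards [Ioo_mem_nhdsGT hb0] with ε hε
      have e1 := habove 1 (Or.inl rfl) 0 ε (by simpa using ha0)
        (by rw [abs_lt]; constructor <;> linarith [hε.1, hε.2]) t₀ ht₀' (by rw [hu0]; rfl)
        (by rw [hu0]; simpa using hε.1)
      have e2 := habove (-1) (Or.inr rfl) 0 (-ε) (by simpa using ha0)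
        (by rw [abs_lt]; constructor <;> linarith [hε.1, hε.2]) t₀ ht₀' (by rw [hu0]; rfl)
        (by rw [hu0]; simpa using hε.1)
      rw [hκ₁, hκ₂, ← e1, ← e2, hh]
      congr 2 <;> (push_cast; ring)
    have := tendsto_nhds_unique (tendsto_const_nhds.congr' hev.symm) hlim
    exact sub_eq_zero.1 this
  refine ⟨a * ‖d‖, by positivity, κ₁, fun z hz hzI => ?_⟩
  set w := (z - c t₀) / d with hw
  have hzw : z = c t₀ + d * (w.re + w.im * Complex.I) := by
    rw [Complex.re_add_im, hw]; field_simp; ring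
  have hwa : ‖w‖ < a := by
    rw [hw, norm_div, div_lt_iff₀ hd0]
    rwa [Metric.mem_ball, dist_eq_norm] at hz
  have h1 : |w.re| < a := (Complex.abs_re_le_norm w).trans_lt hwa
  have h2 : |w.im| < b := (Complex.abs_im_le_norm w).trans_lt (hwa.trans_le hab)
  obtain ⟨t, ht, htx⟩ := hIVT w.re h1
  have hfz : f z = h (w.re + w.im * Complex.I) := by rw [hh]; simp only; rw [← hzw]
  have h3 : (u t).re = w.re := htx
  rcases lt_trichotomy (u t).im w.im with hlt | heq | hgt
  · rw [hfz]
    exact habove 1 (Or.inl rfl) _ _ h1 h2 t ht htx (by linarith)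
  · refine absurd ?_ hzI
    rw [hzw, Complex.re_add_im, ← Complex.ext (z := u t) h3 heq, ← hcu]
    exact hcI t
  · rw [hfz, hκ]
    exact habove (-1) (Or.inr rfl) _ _ h1 h2 t ht htx (by linarith)

/-- Near a point of a regular arc, a function that is locally constant off the contour and is, up
to a continuous function, the difference of the Cauchy integral and of the normalised indicator
function of the region on the left, is constant. -/
lemma exists_const_of_kernel (hc : ContDiff ℝ 1 c) {t₀ a b : ℝ} (hat : a < t₀) (htb : t₀ < b)
    (hd : deriv c t₀ ≠ 0) (hinj : ∀ t ∈ Icc a b, t ≠ t₀ → c t ≠ c t₀)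
    {I Γ₁ Γ₂ : Set ℂ} (hcI : ∀ t, c t ∈ I) (hdisj : Disjoint Γ₁ Γ₂) (hunion : Γ₁ ∪ Γ₂ = Iᶜ)
    (hsides : ∀ᶠ ε : ℝ in 𝓝[>] 0, c t₀ + ε * Complex.I * deriv c t₀ ∈ Γ₁ ∧
      c t₀ - ε * Complex.I * deriv c t₀ ∈ Γ₂)
    {δ : ℝ} (hδ : 0 < δ) (hI : ∀ z ∈ Metric.ball (c t₀) δ, z ∈ I → ∃ t ∈ Icc a b, z = c t)
    {f V : ℂ → ℂ} (hV : ContinuousAt V (c t₀))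
    (hfV : ∀ z ∈ Metric.ball (c t₀) δ, z ∉ I → f z =
      (∫ t in a..b, deriv c t * (c t - z)⁻¹) - Γ₁.indicator (fun _ => 2 * Real.pi * Complex.I) z +
        V z)
    (hf : ∀ z ∈ Metric.ball (c t₀) δ, z ∉ I → ∀ᶠ z' in 𝓝 z, f z' = f z) :
    ∃ δ' > 0, ∃ κ, ∀ z ∈ Metric.ball (c t₀) δ', z ∉ I → f z = κ := by
  obtain ⟨η, hη, hηlt, hmono⟩ := exists_strictMonoOn_re hc hd
    (lt_min (sub_pos.2 hat) (sub_pos.2 htb))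
  have hη1 : η < t₀ - a := hηlt.trans_le (min_le_left _ _)
  have hη2 : η < b - t₀ := hηlt.trans_le (min_le_right _ _)
  have hl : uIcc a (t₀ - η) = Icc a (t₀ - η) := uIcc_of_le (by linarith)
  have hr : uIcc (t₀ + η) b = Icc (t₀ + η) b := uIcc_of_le (by linarith)
  have hl' : ∀ t ∈ uIcc a (t₀ - η), c t ≠ c t₀ := fun t ht => by
    rw [hl] at ht
    exact hinj t ⟨ht.1, by linarith [ht.2]⟩ (by rintro rfl; linarith [ht.2])
  have hr' : ∀ t ∈ uIcc (t₀ + η) b, c t ≠ c t₀ := fun t ht => by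
    rw [hr] at ht
    exact hinj t ⟨by linarith [ht.1], ht.2⟩ (by rintro rfl; linarith [ht.1])
  set K : Set ℂ := c '' uIcc a (t₀ - η) ∪ c '' uIcc (t₀ + η) b with hK
  have hKc : IsClosed K := ((isCompact_uIcc.image hc.continuous).union
    (isCompact_uIcc.image hc.continuous)).isClosed
  have hqK : c t₀ ∈ Kᶜ := by
    rintro (⟨t, ht, h⟩ | ⟨t, ht, h⟩)
    exacts [hl' t ht h, hr' t ht h]
  obtain ⟨δ₁, hδ₁, hball₁⟩ := Metric.isOpen_iff.1 hKc.isOpen_compl _ hqK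
  set δ₂ := min δ δ₁ with hδ₂
  have hδ₂0 : 0 < δ₂ := lt_min hδ hδ₁
  have hsub : Metric.ball (c t₀) δ₂ ⊆ Metric.ball (c t₀) δ := Metric.ball_subset_ball (min_le_left
      _ _)
  have hsub₁ : Metric.ball (c t₀) δ₂ ⊆ Metric.ball (c t₀) δ₁ :=
    Metric.ball_subset_ball (min_le_right _ _)
  have hd1 : Disjoint Γ₁ I := disjoint_left.2 fun z hz hzI =>
    (hunion ▸ (Or.inl hz : z ∈ Γ₁ ∪ Γ₂) : z ∈ Iᶜ) hzI
  have hd2 : Disjoint Γ₂ I := disjoint_left.2 fun z hz hzI =>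
    (hunion ▸ (Or.inr hz : z ∈ Γ₁ ∪ Γ₂) : z ∈ Iᶜ) hzI
  -- The parts of the curve away from `t₀` stay at positive distance from `c t₀`, so they join the
  -- continuous remainder. Only the short arc produces a jump.
  set V' : ℂ → ℂ := fun z => (∫ t in a..(t₀ - η), deriv c t * (c t - z)⁻¹) +
    (∫ t in (t₀ + η)..b, deriv c t * (c t - z)⁻¹) + V z with hV'
  have hV'c : ContinuousAt V' (c t₀) :=
    ((hasDerivAt_kernel hc hl').continuousAt.add (hasDerivAt_kernel hc hr').continuousAt).add hV
  have hsplit : ∀ z ∉ I, (∫ t in a..b, deriv c t * (c t - z)⁻¹) =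
      (∫ t in a..(t₀ - η), deriv c t * (c t - z)⁻¹) +
      (∫ t in (t₀ - η)..(t₀ + η), deriv c t * (c t - z)⁻¹) +
      (∫ t in (t₀ + η)..b, deriv c t * (c t - z)⁻¹) := by
    intro z hz
    have hi : ∀ x y, IntervalIntegrable (fun t => deriv c t * (c t - z)⁻¹) volume x y :=
      fun x y => intervalIntegrable_kernel hc fun t _ h => hz (h ▸ hcI t)
    rw [intervalIntegral.integral_add_adjacent_intervals (hi _ _) (hi _ _),
      intervalIntegral.integral_add_adjacent_intervals (hi _ _) (hi _ _)]
  have hleft : Tendsto (fun ε : ℝ => c t₀ + ε * Complex.I * deriv c t₀) (𝓝[>] 0) (𝓝 (c t₀)) := by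
    have : Continuous fun ε : ℝ => c t₀ + ε * Complex.I * deriv c t₀ := by fun_prop
    simpa using (this.tendsto 0).mono_left nhdsWithin_le_nhds
  have hright : Tendsto (fun ε : ℝ => c t₀ - ε * Complex.I * deriv c t₀) (𝓝[>] 0) (𝓝 (c t₀)) := by
    have : Continuous fun ε : ℝ => c t₀ - ε * Complex.I * deriv c t₀ := by fun_prop
    simpa using (this.tendsto 0).mono_left nhdsWithin_le_nhds
  refine exists_const_of_crossing hc hη hd hmono hcI hδ₂0 ?_
    (fun z hz hzI => hf z (hsub hz) hzI) ?_
  · intro z hz hzI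
    obtain ⟨t, ht, rfl⟩ := hI z (hsub hz) hzI
    refine ⟨t, ?_, rfl⟩
    have h1 : c t ∉ K := hball₁ (hsub₁ hz)
    constructor
    · by_contra! h
      exact h1 (Or.inl ⟨t, by rw [hl]; exact ⟨ht.1, h.le⟩, rfl⟩)
    · by_contra! h
      exact h1 (Or.inr ⟨t, by rw [hr]; exact ⟨h.le, ht.2⟩, rfl⟩)
  -- The kernel jumps by `2πi` from right to left, exactly as does the subtracted indicator
  -- function.
  · have h1 := (tendsto_kernel_jump hc hη hd hmono).add
      ((hV'c.tendsto.comp hleft).sub (hV'c.tendsto.comp hright))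
    have h2 := h1.sub_const (2 * Real.pi * Complex.I : ℂ)
    rw [sub_self, add_zero, sub_self] at h2
    refine h2.congr' ?_
    filter_upwards [hsides, hleft (Metric.ball_mem_nhds _ hδ), hright (Metric.ball_mem_nhds _ hδ)]
      with ε hε hεl hεr
    have hzl : c t₀ + ε * Complex.I * deriv c t₀ ∉ I := disjoint_left.1 hd1 hε.1
    have hzr : c t₀ - ε * Complex.I * deriv c t₀ ∉ I := disjoint_left.1 hd2 hε.2
    rw [hfV _ hεl hzl, hfV _ hεr hzr, indicator_of_mem hε.1,
      indicator_of_notMem (disjoint_right.1 hdisj hε.2), hsplit _ hzl, hsplit _ hzr]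
    simp only [hV', Function.comp_apply]
    ring

end Crossing

end SepMer


/-! ### Tails, sides and the truncated Cauchy integral of a contour -/

namespace SepMer

/-- Beyond parameter `τ`, the unbounded component of the contour is given by the rays
`arg = ± ψ`. -/
def HasTails (ψ τ : ℝ) (γ : Contour) : Prop :=
  0 < τ ∧ ∀ t : ℝ, τ ≤ t →
    γ.line t = t * Complex.exp (ψ * Complex.I) ∧
    γ.line (-t) = t * Complex.exp (-(ψ * Complex.I))

/-- The contour separates the plane into the regions `Γ₁` (on the left) and `Γ₂` (on the right, and
containing the large positive numbers). -/
structure Separates (γ : Contour) (Γ₁ Γ₂ : Set ℂ) : Prop where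
  isOpen_left : IsOpen Γ₁
  isOpen_right : IsOpen Γ₂
  disjoint : Disjoint Γ₁ Γ₂
  union : Γ₁ ∪ Γ₂ = γ.imageᶜ
  line_sides : HasSides γ.line Γ₁ Γ₂
  loop_sides : ∀ i, HasSides (γ.loop i) Γ₁ Γ₂
  eventually_right : ∀ᶠ x : ℝ in atTop, (x : ℂ) ∈ Γ₂

lemma isAdmissible_iff {ψ : ℝ} {P₁ P₂ : Set ℂ} {γ : Contour} :
    IsAdmissible ψ P₁ P₂ γ ↔
      ∃ τ Γ₁ Γ₂, HasTails ψ τ γ ∧ Separates γ Γ₁ Γ₂ ∧ P₁ ⊆ Γ₁ ∧ P₂ ⊆ Γ₂ := by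
  constructor
  · rintro ⟨⟨τ, hτ⟩, Γ₁, Γ₂, h1, h2, h3, h4, h5, h6, h7, h8, h9⟩
    exact ⟨τ, Γ₁, Γ₂, hτ, ⟨h1, h2, h3, h4, h5, h6, h7⟩, h8, h9⟩
  · rintro ⟨τ, Γ₁, Γ₂, hτ, ⟨h1, h2, h3, h4, h5, h6, h7⟩, h8, h9⟩
    exact ⟨⟨τ, hτ⟩, Γ₁, Γ₂, h1, h2, h3, h4, h5, h6, h7, h8, h9⟩

namespace Contour

variable (γ : Contour)

lemma line_contDiff : ContDiff ℝ 1 γ.line := γ.line_smooth.of_le (by exact_mod_cast le_top)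

lemma loop_contDiff (i : Fin γ.n) : ContDiff ℝ 1 (γ.loop i) :=
  (γ.loop_smooth i).of_le (by exact_mod_cast le_top)

lemma line_mem_image (t : ℝ) : γ.line t ∈ γ.image := Or.inl ⟨t, rfl⟩

lemma loop_mem_image (i : Fin γ.n) (t : ℝ) : γ.loop i t ∈ γ.image :=
  Or.inr (mem_iUnion.2 ⟨i, t, rfl⟩)

lemma range_loop (i : Fin γ.n) (a : ℝ) : range (γ.loop i) = γ.loop i '' Icc a (a + 1) := by
  ext z
  constructor
  · rintro ⟨t, rfl⟩
    obtain ⟨s, hs, h⟩ := (γ.loop_periodic i).exists_mem_Ico one_pos t a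
    exact ⟨s, Ico_subset_Icc_self hs, h.symm⟩
  · rintro ⟨t, -, rfl⟩; exact ⟨t, rfl⟩

lemma isCompact_range_loop (i : Fin γ.n) : IsCompact (range (γ.loop i)) := by
  rw [γ.range_loop i 0]; exact isCompact_Icc.image (γ.loop_contDiff i).continuous

lemma deriv_loop_periodic (i : Fin γ.n) : Function.Periodic (deriv (γ.loop i)) 1 := by
  intro t
  rw [← deriv_comp_add_const]
  congr 1
  funext s
  exact γ.loop_periodic i s

/-- Coincidence of values forces the parameters to differ by an integer, which here has absolute
value at most `1 / 2`. The full period centred at `t₀` thus places any point of a loop in the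
interior of an arc that passes through it only once. -/
lemma loop_ne (i : Fin γ.n) {t₀ t : ℝ} (ht : t ∈ Icc (t₀ - 1 / 2) (t₀ + 1 / 2)) (hne : t ≠ t₀) :
    γ.loop i t ≠ γ.loop i t₀ := by
  intro h
  have hfract : ∀ s, γ.loop i (Int.fract s) = γ.loop i s := by
    intro s
    have := (γ.loop_periodic i).sub_int_mul_eq (x := s) ⌊s⌋
    rwa [mul_one] at this
  have h1 : Int.fract t = Int.fract t₀ :=
    γ.loop_injOn i ⟨Int.fract_nonneg _, Int.fract_lt_one _⟩
      ⟨Int.fract_nonneg _, Int.fract_lt_one _⟩ (by rw [hfract, hfract, h])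
  obtain ⟨n, hn⟩ := Int.fract_eq_fract.1 h1
  have hn1 : (n : ℝ) < 1 := by linarith [ht.2]
  have hn2 : (-1 : ℝ) < n := by linarith [ht.1]
  have : n = 0 := by
    have h3 : n < 1 := by exact_mod_cast hn1
    have h4 : -1 < n := by exact_mod_cast hn2
    omega
  rw [this] at hn
  apply hne
  simpa [sub_eq_zero] using hn

/-- The truncated integral of the Cauchy kernel `1 / (λ - z)` along the contour. -/
noncomputable def cauchy (T : ℝ) (z : ℂ) : ℂ :=
  (∫ t in (-T)..T, deriv γ.line t * (γ.line t - z)⁻¹) +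
    ∑ i, ∫ t in (0 : ℝ)..1, deriv (γ.loop i) t * (γ.loop i t - z)⁻¹

lemma hasDerivAt_loop_kernel (i : Fin γ.n) {z : ℂ} (hz : z ∉ range (γ.loop i)) :
    HasDerivAt (fun z => ∫ t in (0 : ℝ)..1, deriv (γ.loop i) t * (γ.loop i t - z)⁻¹) 0 z := by
  have := hasDerivAt_kernel (a := 0) (b := 1) (γ.loop_contDiff i)
    (z := z) fun t _ h => hz ⟨t, h⟩
  have h01 : γ.loop i 0 = γ.loop i 1 := by simpa using (γ.loop_periodic i 0).symm
  rwa [h01, sub_self] at this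

/-- Closed loops have no endpoints and contribute nothing. The derivative depends on the contour
only through the two truncation points. -/
lemma hasDerivAt_cauchy (T : ℝ) {z : ℂ} (hz : z ∉ γ.image) :
    HasDerivAt (γ.cauchy T) ((γ.line (-T) - z)⁻¹ - (γ.line T - z)⁻¹) z := by
  have h1 := hasDerivAt_kernel (a := -T) (b := T) γ.line_contDiff
    (z := z) fun t _ h => hz (h ▸ γ.line_mem_image t)
  have h2 := HasDerivAt.fun_sum (u := Finset.univ) fun i _ => γ.hasDerivAt_loop_kernel i
    (z := z) fun h => hz (Or.inr (mem_iUnion.2 ⟨i, h⟩))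
  exact (h1.add h2).congr_deriv (by simp)

end Contour

/-! ### The winding number as an indicator function -/

section Winding

variable {ψ τ : ℝ} {γ : Contour} {Γ₁ Γ₂ : Set ℂ}

lemma HasTails.norm_line (h : HasTails ψ τ γ) {t : ℝ} (ht : τ ≤ |t|) : ‖γ.line t‖ = |t| := by
  rcases le_or_gt 0 t with h0 | h0
  · rw [abs_of_nonneg h0] at ht ⊢
    rw [(h.2 t ht).1, norm_mul, Complex.norm_exp_ofReal_mul_I, mul_one, Complex.norm_real,
      Real.norm_eq_abs, abs_of_nonneg h0]
  · rw [abs_of_neg h0] at ht ⊢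
    have := (h.2 (-t) ht).2
    rw [neg_neg] at this
    rw [this, norm_mul, ← neg_mul, ← Complex.ofReal_neg, Complex.norm_exp_ofReal_mul_I, mul_one,
      Complex.norm_real,
      Real.norm_eq_abs, abs_of_pos (by linarith)]

lemma HasTails.mono {τ' : ℝ} (h : HasTails ψ τ γ) (hτ : τ ≤ τ') : HasTails ψ τ' γ :=
  ⟨h.1.trans_le hτ, fun t ht => h.2 t (hτ.trans ht)⟩

lemma HasTails.abs_lt (h : HasTails ψ τ γ) {T t : ℝ} (hT : τ ≤ T) (ht : ‖γ.line t‖ < T) : |t| < T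
    := by
  by_contra! hle
  rw [h.norm_line (hT.trans hle)] at ht
  linarith

lemma Separates.isOpen_compl (h : Separates γ Γ₁ Γ₂) : IsOpen γ.imageᶜ :=
  h.union ▸ h.isOpen_left.union h.isOpen_right

lemma Separates.notMem_left (h : Separates γ Γ₁ Γ₂) {z : ℂ} (hz : z ∈ Γ₁) : z ∉ γ.image :=
  (h.union ▸ (Or.inl hz : z ∈ Γ₁ ∪ Γ₂) : z ∈ γ.imageᶜ)

lemma Separates.notMem_right (h : Separates γ Γ₁ Γ₂) {z : ℂ} (hz : z ∈ Γ₂) : z ∉ γ.image :=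
  (h.union ▸ (Or.inr hz : z ∈ Γ₁ ∪ Γ₂) : z ∈ γ.imageᶜ)

/-- Every point of the contour is a limit of points on its left normal, and these lie in `Γ₁`. -/
lemma Separates.dense_compl (h : Separates γ Γ₁ Γ₂) : Dense γ.imageᶜ := by
  have key : ∀ (c : ℝ → ℂ) (t : ℝ), HasSides c Γ₁ Γ₂ → c t ∈ closure γ.imageᶜ := by
    intro c t hs
    have hleft : Tendsto (fun ε : ℝ => c t + ε * Complex.I * deriv c t) (𝓝[>] 0) (𝓝 (c t)) := by
      have : Continuous fun ε : ℝ => c t + ε * Complex.I * deriv c t := by fun_prop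
      simpa using (this.tendsto 0).mono_left nhdsWithin_le_nhds
    exact mem_closure_of_tendsto hleft ((hs t).mono fun ε hε => h.notMem_left hε.1)
  intro z
  by_cases hz : z ∈ γ.image
  · rcases hz with ⟨t, rfl⟩ | hz
    · exact key _ t h.line_sides
    · obtain ⟨i, t, rfl⟩ := mem_iUnion.1 hz
      exact key _ t (h.loop_sides i)
  · exact subset_closure hz

lemma Separates.eventually_indicator (h : Separates γ Γ₁ Γ₂) {z : ℂ} (hz : z ∉ γ.image) (a : ℂ) :
    ∀ᶠ z' in 𝓝 z, Γ₁.indicator (fun _ => a) z' = Γ₁.indicator (fun _ => a) z := by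
  have : z ∈ Γ₁ ∪ Γ₂ := h.union ▸ hz
  rcases this with h1 | h1
  · filter_upwards [h.isOpen_left.mem_nhds h1] with z' hz'
    rw [indicator_of_mem h1, indicator_of_mem hz']
  · filter_upwards [h.isOpen_right.mem_nhds h1] with z' hz'
    rw [indicator_of_notMem (disjoint_right.1 h.disjoint h1),
      indicator_of_notMem (disjoint_right.1 h.disjoint hz')]

/-- A primitive of the derivative of the truncated Cauchy integral. -/
noncomputable def tailLog (w₁ w₂ z : ℂ) : ℂ := Complex.log (1 - z / w₂) - Complex.log (1 - z / w₁)

/-- For `‖z‖ < T` the quotients `z / w₁` and `z / w₂` have norm less than `1`, so both logarithms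
stay in the slit plane. This is a single-valued primitive on the whole disc. -/
lemma hasDerivAt_tailLog {T : ℝ} {w₁ w₂ z : ℂ} (h1 : ‖w₁‖ = T) (h2 : ‖w₂‖ = T) (hz : ‖z‖ < T) :
    HasDerivAt (tailLog w₁ w₂) ((w₁ - z)⁻¹ - (w₂ - z)⁻¹) z := by
  have hT : 0 < T := (norm_nonneg z).trans_lt hz
  have key : ∀ w : ℂ, ‖w‖ = T → HasDerivAt (fun z => Complex.log (1 - z / w)) (-(w - z)⁻¹) z := by
    intro w hw
    have hw0 : w ≠ 0 := by rintro rfl; rw [norm_zero] at hw; linarith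
    have hwz : w - z ≠ 0 := by
      intro h; rw [sub_eq_zero] at h; rw [← h, hw] at hz; exact lt_irrefl _ hz
    have hs : 1 - z / w ∈ Complex.slitPlane := by
      rw [sub_eq_add_neg]
      apply Complex.mem_slitPlane_of_norm_lt_one
      rw [norm_neg, norm_div, hw, div_lt_one hT]; exact hz
    have h3 : HasDerivAt (fun z : ℂ => 1 - z / w) (-(1 / w)) z :=
      ((hasDerivAt_id z).div_const w).const_sub 1
    refine (h3.clog hs).congr_deriv ?_
    have : 1 - z / w ≠ 0 := Complex.slitPlane_ne_zero hs
    field_simp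
  exact ((key w₂ h2).sub (key w₁ h1)).congr_deriv (by ring)

lemma eventually_eq_of_hasDerivAt_zero {f : ℂ → ℂ} {O : Set ℂ} (hO : IsOpen O)
    (hf : ∀ z ∈ O, HasDerivAt f 0 z) {z : ℂ} (hz : z ∈ O) : ∀ᶠ z' in 𝓝 z, f z' = f z := by
  obtain ⟨r, hr, hball⟩ := Metric.isOpen_iff.1 hO z hz
  filter_upwards [Metric.ball_mem_nhds z hr] with z' hz'
  exact Metric.isOpen_ball.is_const_of_deriv_eq_zero (convex_ball z r).isPreconnected
    (fun w hw => (hf w (hball hw)).differentiableAt.differentiableWithinAt)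
    (fun w hw => (hf w (hball hw)).deriv) hz' (Metric.mem_ball_self hr)

/-- The truncated Cauchy integral is given, up to a constant, by an explicit function and the
indicator function of the region on the left. -/
lemma Separates.exists_cauchy_eq (h : Separates γ Γ₁ Γ₂) (hτ : HasTails ψ τ γ) {T : ℝ}
    (hT : τ ≤ T) : ∃ κ, ∀ z ∈ Metric.ball (0 : ℂ) T, z ∉ γ.image →
      γ.cauchy T z - Γ₁.indicator (fun _ => 2 * Real.pi * Complex.I) z -
        tailLog (γ.line (-T)) (γ.line T) z = κ := by
  have hT0 : 0 < T := hτ.1.trans_le hT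
  have hn1 : ‖γ.line (-T)‖ = T := by
    rw [hτ.norm_line (by rwa [abs_neg, abs_of_pos hT0]), abs_neg, abs_of_pos hT0]
  have hn2 : ‖γ.line T‖ = T := by
    rw [hτ.norm_line (by rwa [abs_of_pos hT0]), abs_of_pos hT0]
  set f : ℂ → ℂ := fun z => γ.cauchy T z - Γ₁.indicator (fun _ => 2 * Real.pi * Complex.I) z -
        tailLog (γ.line (-T)) (γ.line T) z with hf
  have hO : IsOpen (Metric.ball (0 : ℂ) T ∩ γ.imageᶜ) := Metric.isOpen_ball.inter h.isOpen_compl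
  have htl : ∀ z ∈ Metric.ball (0 : ℂ) T, HasDerivAt (tailLog (γ.line (-T)) (γ.line T))
      ((γ.line (-T) - z)⁻¹ - (γ.line T - z)⁻¹) z := fun z hz =>
    hasDerivAt_tailLog hn1 hn2 (by rwa [mem_ball_zero_iff] at hz)
  have hloc : ∀ z ∈ Metric.ball (0 : ℂ) T, z ∉ γ.image → ∀ᶠ z' in 𝓝 z, f z' = f z := by
    intro z hz hzI
    have h1 := eventually_eq_of_hasDerivAt_zero
      (f := fun z => γ.cauchy T z - tailLog (γ.line (-T)) (γ.line T) z) hO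
      (fun w hw => ((γ.hasDerivAt_cauchy T hw.2).sub (htl w hw.1)).congr_deriv (sub_self _))
      (mem_inter hz hzI)
    filter_upwards [h1, h.eventually_indicator hzI (2 * Real.pi * Complex.I)] with z' h2 h3
    simp only [hf]
    linear_combination h2 - h3
  refine eq_of_locally_const_off (convex_ball 0 T).isPreconnected h.dense_compl fun q hq => ?_
  obtain ⟨δ₀, hδ₀, hball₀⟩ := Metric.isOpen_iff.1 Metric.isOpen_ball q hq
  by_cases hqI : q ∈ γ.image
  swap
  · obtain ⟨δ, hδ, hball⟩ := Metric.eventually_nhds_iff_ball.1 (hloc q hq hqI)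
    exact ⟨δ, hδ, f q, fun z hz _ => hball z hz⟩
  rcases hqI with ⟨t₀, rfl⟩ | hqI
  · -- a point on the line
    have ht₀ := abs_lt.1 (hτ.abs_lt hT (mem_ball_zero_iff.1 hq))
    have hK : IsClosed (⋃ i, range (γ.loop i)) :=
      isClosed_iUnion_of_finite fun i => (γ.isCompact_range_loop i).isClosed
    have hqK : γ.line t₀ ∈ (⋃ i, range (γ.loop i))ᶜ := by
      intro hmem
      obtain ⟨i, hi⟩ := mem_iUnion.1 hmem
      exact disjoint_left.1 (γ.line_loop_disjoint i) ⟨t₀, rfl⟩ hi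
    obtain ⟨δ₁, hδ₁, hball₁⟩ := Metric.isOpen_iff.1 hK.isOpen_compl _ hqK
    have hs0 : Metric.ball (γ.line t₀) (min δ₀ δ₁) ⊆ Metric.ball 0 T :=
      (Metric.ball_subset_ball (min_le_left _ _)).trans hball₀
    refine exists_const_of_kernel γ.line_contDiff ht₀.1 ht₀.2 (γ.line_deriv t₀)
      (fun t _ hne h => hne (γ.line_injective h)) γ.line_mem_image h.disjoint h.union
      (h.line_sides t₀) (lt_min hδ₀ hδ₁) ?_ (f := f)
      -- Near a point of the unbounded component all loops are at positive distance. Their Cauchy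
      -- integrals and the logarithm form the continuous remainder.
      (V := fun z => (∑ i, ∫ t in (0 : ℝ)..1, deriv (γ.loop i) t * (γ.loop i t - z)⁻¹) -
        tailLog (γ.line (-T)) (γ.line T) z) ?_ ?_ (fun z hz hzI => hloc z (hs0 hz) hzI)
    · intro z hz hzI
      rcases hzI with ⟨t, rfl⟩ | hzI
      · have := abs_lt.1 (hτ.abs_lt hT (mem_ball_zero_iff.1 (hs0 hz)))
        exact ⟨t, ⟨this.1.le, this.2.le⟩, rfl⟩
      · exact absurd hzI (hball₁ (Metric.ball_subset_ball (min_le_right _ _) hz))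
    · refine ContinuousAt.sub ?_ (htl _ hq).continuousAt
      refine tendsto_finsetSum _ fun i _ => ?_
      exact (γ.hasDerivAt_loop_kernel i fun hi => hqK (mem_iUnion.2 ⟨i, hi⟩)).continuousAt
    · intro z hz hzI
      simp only [hf, Contour.cauchy]
      ring
  · -- a point on a loop
    obtain ⟨i, t₀, rfl⟩ := mem_iUnion.1 hqI
    set K : Set ℂ := γ.line '' Icc (-T) T ∪ ⋃ j ∈ ({i}ᶜ : Set (Fin γ.n)), range (γ.loop j) with
      hKdef
    have hK : IsClosed K := by
      refine IsClosed.union (isCompact_Icc.image γ.line_contDiff.continuous).isClosed ?_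
      exact (toFinite _).isClosed_biUnion fun j _ => (γ.isCompact_range_loop j).isClosed
    have hqline : γ.loop i t₀ ∉ range γ.line := fun hmem =>
      disjoint_left.1 (γ.line_loop_disjoint i) hmem ⟨t₀, rfl⟩
    have hqloop : ∀ j ≠ i, γ.loop i t₀ ∉ range (γ.loop j) := fun j hj hmem =>
      disjoint_left.1 (γ.loop_disjoint j i hj) hmem ⟨t₀, rfl⟩
    have hqK : γ.loop i t₀ ∈ Kᶜ := by
      rintro (⟨t, -, h⟩ | hmem)
      · exact hqline ⟨t, h⟩
      · obtain ⟨j, hj, hmem⟩ := mem_iUnion₂.1 hmem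
        exact hqloop j hj hmem
    obtain ⟨δ₁, hδ₁, hball₁⟩ := Metric.isOpen_iff.1 hK.isOpen_compl _ hqK
    have hs0 : Metric.ball (γ.loop i t₀) (min δ₀ δ₁) ⊆ Metric.ball 0 T :=
      (Metric.ball_subset_ball (min_le_left _ _)).trans hball₀
    refine exists_const_of_kernel (γ.loop_contDiff i) (a := t₀ - 1 / 2) (b := t₀ + 1 / 2)
      (by linarith) (by linarith) (γ.loop_deriv i t₀)
      (fun t ht hne => γ.loop_ne i ht hne) (γ.loop_mem_image i) h.disjoint h.union
      (h.loop_sides i t₀) (lt_min hδ₀ hδ₁) ?_ (f := f)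
      (V := fun z => (∫ t in (-T)..T, deriv γ.line t * (γ.line t - z)⁻¹) +
        (∑ j ∈ Finset.univ.erase i, ∫ t in (0 : ℝ)..1, deriv (γ.loop j) t * (γ.loop j t - z)⁻¹) -
        tailLog (γ.line (-T)) (γ.line T) z) ?_ ?_ (fun z hz hzI => hloc z (hs0 hz) hzI)
    · intro z hz hzI
      have hzK : z ∉ K := hball₁ (Metric.ball_subset_ball (min_le_right _ _) hz)
      rcases hzI with ⟨t, rfl⟩ | hzI
      · have := abs_lt.1 (hτ.abs_lt hT (mem_ball_zero_iff.1 (hs0 hz)))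
        exact absurd (Or.inl ⟨t, ⟨this.1.le, this.2.le⟩, rfl⟩) hzK
      · obtain ⟨j, hj⟩ := mem_iUnion.1 hzI
        by_cases hji : j = i
        · subst hji
          rw [γ.range_loop j (t₀ - 1 / 2)] at hj
          obtain ⟨t, ht, rfl⟩ := hj
          exact ⟨t, ⟨ht.1, by linarith [ht.2]⟩, rfl⟩
        · exact absurd (Or.inr (mem_iUnion₂.2 ⟨j, hji, hj⟩)) hzK
    · refine ContinuousAt.sub (ContinuousAt.add ?_ ?_) (htl _ hq).continuousAt
      · exact (hasDerivAt_kernel γ.line_contDiff fun t _ h => hqline ⟨t, h⟩).continuousAt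
      · refine tendsto_finsetSum _ fun j hj => ?_
        exact (γ.hasDerivAt_loop_kernel j (hqloop j (Finset.ne_of_mem_erase hj))).continuousAt
    · intro z hz hzI
      -- By periodicity the loop integral may be taken over the period centred at `t₀`, so that the
      -- crossing does not occur at an endpoint.
      have hper : Function.Periodic (fun t => deriv (γ.loop i) t * (γ.loop i t - z)⁻¹) 1 := by
        intro t
        simp only [γ.deriv_loop_periodic i t, γ.loop_periodic i t]
      have h2 := hper.intervalIntegral_add_eq 0 (t₀ - 1 / 2)
      rw [zero_add, show t₀ - 1 / 2 + 1 = t₀ + 1 / 2 by ring] at h2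
      simp only [hf, Contour.cauchy]
      rw [← Finset.add_sum_erase _ _ (Finset.mem_univ i), h2]
      ring

end Winding

end SepMer


/-! ### Truncated contour integrals -/

namespace SepMer

namespace Contour

variable {E : Type*} [NormedAddCommGroup E] [NormedSpace ℂ E]

/-- The contour integral over the truncated contour. -/
noncomputable def truncIntegral (γ : Contour) (T : ℝ) (F : ℂ → E) : E :=
  (∫ t in (-T)..T, deriv γ.line t • F (γ.line t)) +
    ∑ i, ∫ t in (0 : ℝ)..1, deriv (γ.loop i) t • F (γ.loop i t)

/-- The point set of the truncated contour. -/
def truncImage (γ : Contour) (T : ℝ) : Set ℂ :=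
  γ.line '' uIcc (-T) T ∪ ⋃ i, range (γ.loop i)

variable {γ : Contour} {T : ℝ}

lemma line_mem_truncImage {t : ℝ} (ht : t ∈ uIcc (-T) T) : γ.line t ∈ γ.truncImage T :=
  Or.inl ⟨t, ht, rfl⟩

lemma loop_mem_truncImage (i : Fin γ.n) (t : ℝ) : γ.loop i t ∈ γ.truncImage T :=
  Or.inr (mem_iUnion.2 ⟨i, t, rfl⟩)

lemma truncImage_subset_image : γ.truncImage T ⊆ γ.image := by
  rintro z (⟨t, -, rfl⟩ | hz)
  exacts [γ.line_mem_image t, Or.inr hz]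

lemma isCompact_truncImage : IsCompact (γ.truncImage T) :=
  (isCompact_uIcc.image γ.line_contDiff.continuous).union
    (isCompact_iUnion fun i => γ.isCompact_range_loop i)

lemma intervalIntegrable_line {F : ℂ → E} (hF : ContinuousOn F (γ.truncImage T)) :
    IntervalIntegrable (fun t => deriv γ.line t • F (γ.line t)) volume (-T) T := by
  refine ContinuousOn.intervalIntegrable (ContinuousOn.smul
    (γ.line_contDiff.continuous_deriv le_rfl).continuousOn ?_)
  exact hF.comp γ.line_contDiff.continuous.continuousOn fun t ht => line_mem_truncImage ht

lemma intervalIntegrable_loop {F : ℂ → E} (hF : ContinuousOn F (γ.truncImage T)) (i : Fin γ.n) :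
    IntervalIntegrable (fun t => deriv (γ.loop i) t • F (γ.loop i t)) volume 0 1 := by
  refine ContinuousOn.intervalIntegrable (ContinuousOn.smul
    ((γ.loop_contDiff i).continuous_deriv le_rfl).continuousOn ?_)
  exact hF.comp (γ.loop_contDiff i).continuous.continuousOn fun t _ => loop_mem_truncImage i t

lemma truncIntegral_congr {F G : ℂ → E} (h : EqOn F G (γ.truncImage T)) :
    γ.truncIntegral T F = γ.truncIntegral T G := by
  unfold truncIntegral
  congr 1
  · refine intervalIntegral.integral_congr fun t ht => ?_
    simp only [h (line_mem_truncImage ht)]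
  · refine Finset.sum_congr rfl fun i _ => intervalIntegral.integral_congr fun t ht => ?_
    simp only [h (loop_mem_truncImage i t)]

lemma truncIntegral_add {F G : ℂ → E} (hF : ContinuousOn F (γ.truncImage T))
    (hG : ContinuousOn G (γ.truncImage T)) :
    γ.truncIntegral T (fun z => F z + G z) = γ.truncIntegral T F + γ.truncIntegral T G := by
  unfold truncIntegral
  simp only [smul_add]
  rw [intervalIntegral.integral_add (intervalIntegrable_line hF) (intervalIntegrable_line hG)]
  have : ∀ i, ∫ t in (0 : ℝ)..1, (deriv (γ.loop i) t • F (γ.loop i t) +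
      deriv (γ.loop i) t • G (γ.loop i t)) = (∫ t in (0 : ℝ)..1, deriv (γ.loop i) t • F (γ.loop i
        t)) +
      ∫ t in (0 : ℝ)..1, deriv (γ.loop i) t • G (γ.loop i t) := fun i =>
    intervalIntegral.integral_add (intervalIntegrable_loop hF i) (intervalIntegrable_loop hG i)
  simp only [this, Finset.sum_add_distrib]
  abel

lemma truncIntegral_sum {ι : Type*} (s : Finset ι) {F : ι → ℂ → E}
    (hF : ∀ i ∈ s, ContinuousOn (F i) (γ.truncImage T)) :
    γ.truncIntegral T (fun z => ∑ i ∈ s, F i z) = ∑ i ∈ s, γ.truncIntegral T (F i) := by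
  classical
  induction s using Finset.induction_on with
  | empty => simp [truncIntegral]
  | insert i s hi ih =>
    have h1 : ∀ j ∈ s, ContinuousOn (F j) (γ.truncImage T) := fun j hj =>
      hF j (Finset.mem_insert_of_mem hj)
    simp only [Finset.sum_insert hi]
    rw [truncIntegral_add (hF i (Finset.mem_insert_self i s)) (continuousOn_finsetSum s h1), ih h1]

lemma truncIntegral_of_hasDerivAt [CompleteSpace E] {F G : ℂ → E}
    (hF : ContinuousOn F (γ.truncImage T))
    (hG : ∀ z ∈ γ.truncImage T, HasDerivAt G (F z) z) :
    γ.truncIntegral T F = G (γ.line T) - G (γ.line (-T)) := by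
  unfold truncIntegral
  rw [intervalIntegral.integral_eq_sub_of_hasDerivAt (f := fun t => G (γ.line t)) (fun t ht => ?_)
    (intervalIntegrable_line hF)]
  · rw [Finset.sum_eq_zero, add_zero]
    intro i _
    rw [intervalIntegral.integral_eq_sub_of_hasDerivAt (f := fun t => G (γ.loop i t))
      (fun t _ => ?_) (intervalIntegrable_loop hF i)]
    · have h01 : γ.loop i 1 = γ.loop i 0 := by simpa using γ.loop_periodic i 0
      rw [h01, sub_self]
    · exact (hG _ (loop_mem_truncImage i t)).scomp t
        ((γ.loop_contDiff i).differentiable one_ne_zero t).hasDerivAt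
  · exact (hG _ (line_mem_truncImage ht)).scomp t
      (γ.line_contDiff.differentiable one_ne_zero t).hasDerivAt

lemma truncIntegral_sub_inv_smul [CompleteSpace E] (p : ℂ) (a : E) :
    γ.truncIntegral T (fun z => (z - p)⁻¹ • a) = γ.cauchy T p • a := by
  unfold truncIntegral cauchy
  simp only [smul_smul, intervalIntegral.integral_smul_const, add_smul, Finset.sum_smul]

end Contour

/-! ### Independence of the contour -/

section Independence

variable {ψ τ : ℝ} {γ γ' : Contour} {Γ₁ Γ₂ Γ₁' Γ₂' : Set ℂ}

lemma HasTails.line_eq (h : HasTails ψ τ γ) (h' : HasTails ψ τ γ') {t : ℝ} (ht : τ ≤ |t|) :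
    γ.line t = γ'.line t := by
  rcases le_or_gt 0 t with h0 | h0
  · rw [abs_of_nonneg h0] at ht
    rw [(h.2 t ht).1, (h'.2 t ht).1]
  · rw [abs_of_neg h0] at ht
    have h1 := (h.2 (-t) ht).2
    have h2 := (h'.2 (-t) ht).2
    rw [neg_neg] at h1 h2
    rw [h1, h2]

lemma HasTails.deriv_line_eq (h : HasTails ψ τ γ) (h' : HasTails ψ τ γ') {t : ℝ} (ht : τ < |t|) :
    deriv γ.line t = deriv γ'.line t := by
  apply Filter.EventuallyEq.deriv_eq
  have : ∀ᶠ s : ℝ in 𝓝 t, τ < |s| := continuous_abs.continuousAt.eventually (lt_mem_nhds ht)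
  filter_upwards [this] with s hs using h.line_eq h' hs.le

/-- Beyond `τ` the two integrands coincide. The truncation may therefore grow with the point `z`,
while limits are taken at the fixed truncation `T₀`. -/
lemma HasTails.cauchy_sub_cauchy (h : HasTails ψ τ γ) (h' : HasTails ψ τ γ') {T₀ T : ℝ}
    (hT₀ : τ < T₀) (hT : T₀ ≤ T) {z : ℂ} (hz : z ∉ γ.image) (hz' : z ∉ γ'.image) :
    γ.cauchy T z - γ'.cauchy T z = γ.cauchy T₀ z - γ'.cauchy T₀ z := by
  have hi : ∀ x y, IntervalIntegrable (fun t => deriv γ.line t * (γ.line t - z)⁻¹) volume x y :=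
    fun x y => intervalIntegrable_kernel γ.line_contDiff fun t _ h => hz (h ▸ γ.line_mem_image t)
  have hi' : ∀ x y, IntervalIntegrable (fun t => deriv γ'.line t * (γ'.line t - z)⁻¹) volume x y :=
    fun x y => intervalIntegrable_kernel γ'.line_contDiff fun t _ h => hz' (h ▸ γ'.line_mem_image t)
  have hτ := h.1
  have key : ∫ t in (-T)..T, (deriv γ.line t * (γ.line t - z)⁻¹ - deriv γ'.line t * (γ'.line t -
      z)⁻¹)
      = ∫ t in (-T₀)..T₀, (deriv γ.line t * (γ.line t - z)⁻¹ -
        deriv γ'.line t * (γ'.line t - z)⁻¹) := by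
    rw [intervalIntegral.integral_of_le (by
      linarith), intervalIntegral.integral_of_le (by linarith)]
    apply setIntegral_eq_of_subset_of_forall_sdiff_eq_zero measurableSet_Ioc
      (Ioc_subset_Ioc (by linarith) hT)
    intro t ht
    have : T₀ ≤ |t| := by
      by_contra! hlt
      exact ht.2 ⟨(_root_.abs_lt.1 hlt).1, (_root_.abs_lt.1 hlt).2.le⟩
    rw [h.deriv_line_eq h' (hT₀.trans_le this), h.line_eq h' (hT₀.le.trans this), sub_self]
  rw [intervalIntegral.integral_sub (hi _ _) (hi' _ _),
    intervalIntegral.integral_sub (hi _ _) (hi' _ _)] at key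
  simp only [Contour.cauchy]
  linear_combination key

lemma tendsto_cauchy_atTop (γ : Contour) (T : ℝ) :
    Tendsto (fun x : ℝ => γ.cauchy T x) atTop (𝓝 0) := by
  have h1 := tendsto_kernel_atTop (a := -T) (b := T) γ.line_contDiff
  have h2 := tendsto_finsetSum (Finset.univ : Finset (Fin γ.n)) fun i _ =>
    tendsto_kernel_atTop (a := 0) (b := 1) (γ.loop_contDiff i)
  have h3 := h1.add h2
  simp only [Finset.sum_const_zero, add_zero] at h3
  exact h3

/-- Two contours with the same tails wind equally around points that are on corresponding sides. -/
lemma Separates.cauchy_eq (h : Separates γ Γ₁ Γ₂) (h' : Separates γ' Γ₁' Γ₂')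
    (hτ : HasTails ψ τ γ) (hτ' : HasTails ψ τ γ') {T₀ : ℝ} (hT₀ : τ < T₀) {z : ℂ}
    (hz : (z ∈ Γ₁ ∧ z ∈ Γ₁') ∨ (z ∈ Γ₂ ∧ z ∈ Γ₂')) : γ.cauchy T₀ z = γ'.cauchy T₀ z := by
  have hzI : z ∉ γ.image := hz.elim (fun h1 => h.notMem_left h1.1) (fun h1 => h.notMem_right h1.1)
  have hzI' : z ∉ γ'.image := hz.elim (fun h1 => h'.notMem_left h1.2) (fun h1 => h'.notMem_right
      h1.2)
  have hind : Γ₁.indicator (fun _ => (2 * Real.pi * Complex.I : ℂ)) z =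
      Γ₁'.indicator (fun _ => (2 * Real.pi * Complex.I : ℂ)) z := by
    rcases hz with h1 | h1
    · rw [indicator_of_mem h1.1, indicator_of_mem h1.2]
    · rw [indicator_of_notMem (disjoint_right.1 h.disjoint h1.1),
        indicator_of_notMem (disjoint_right.1 h'.disjoint h1.2)]
  -- In a disc containing both `z` and `x`, the difference of the Cauchy integrals differs from a
  -- constant only by the indicator terms: the tail logarithms agree. These terms cancel at `z`,
  -- since it lies on corresponding sides, and vanish at large positive `x`.
  have hev : (fun x : ℝ => γ.cauchy T₀ x - γ'.cauchy T₀ x) =ᶠ[atTop]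
      fun _ => γ.cauchy T₀ z - γ'.cauchy T₀ z := by
    filter_upwards [h.eventually_right, h'.eventually_right] with x hx hx'
    set T : ℝ := max T₀ (max (|x| + 1) (‖z‖ + 1)) with hT
    have hTT : T₀ ≤ T := le_max_left _ _
    have hxT : (x : ℂ) ∈ Metric.ball (0 : ℂ) T := by
      rw [mem_ball_zero_iff, Complex.norm_real, Real.norm_eq_abs]
      exact (lt_add_one _).trans_le ((le_max_left _ _).trans (le_max_right _ _))
    have hzT : z ∈ Metric.ball (0 : ℂ) T := by
      rw [mem_ball_zero_iff]
      exact (lt_add_one _).trans_le ((le_max_right _ _).trans (le_max_right _ _))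
    have hτT : τ ≤ T := hT₀.le.trans hTT
    obtain ⟨κ, hκ⟩ := h.exists_cauchy_eq hτ hτT
    obtain ⟨κ', hκ'⟩ := h'.exists_cauchy_eq hτ' hτT
    have hxI := h.notMem_right hx
    have hxI' := h'.notMem_right hx'
    have e1 := hκ x hxT hxI
    have e2 := hκ' x hxT hxI'
    have e3 := hκ z hzT hzI
    have e4 := hκ' z hzT hzI'
    have hT0 : τ ≤ |T| := hτT.trans (le_abs_self T)
    rw [indicator_of_notMem (disjoint_right.1 h.disjoint hx)] at e1
    rw [indicator_of_notMem (disjoint_right.1 h'.disjoint hx')] at e2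
    rw [← hτ.line_eq hτ' hT0, ← hτ.line_eq hτ' (by rwa [abs_neg])] at e2 e4
    rw [← hτ.cauchy_sub_cauchy hτ' hT₀ hTT hxI hxI', ← hτ.cauchy_sub_cauchy hτ' hT₀ hTT hzI hzI']
    linear_combination e1 - e2 - e3 + e4 - hind
  have hlim := (tendsto_cauchy_atTop γ T₀).sub (tendsto_cauchy_atTop γ' T₀)
  have := tendsto_nhds_unique (tendsto_const_nhds.congr' hev.symm) hlim
  rw [sub_zero] at this
  exact sub_eq_zero.1 this

variable {E : Type*} [NormedAddCommGroup E] [NormedSpace ℂ E] [CompleteSpace E]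

/-- The common tails cancel before any integral over them has to be evaluated. -/
lemma HasTails.integral_sub_integral {X : Type*} [NormedAddCommGroup X] [NormedSpace ℂ X]
    (h : HasTails ψ τ γ) (h' : HasTails ψ τ γ') {T : ℝ} (hT : τ < T) {F : ℂ → X} (hF :
      γ.IntegrableAlong F) (hF' : γ'.IntegrableAlong F) :
    γ.integral F - γ'.integral F = γ.truncIntegral T F - γ'.truncIntegral T F := by
  have hτ := h.1
  have key : ∫ t, (deriv γ.line t • F (γ.line t) - deriv γ'.line t • F (γ'.line t)) =
      ∫ t in (-T)..T, (deriv γ.line t • F (γ.line t) - deriv γ'.line t • F (γ'.line t)) := by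
    rw [intervalIntegral.integral_of_le (by
      linarith), setIntegral_eq_integral_of_forall_compl_eq_zero]
    intro t ht
    have : T ≤ |t| := by
      by_contra! hlt
      exact ht ⟨(_root_.abs_lt.1 hlt).1, (_root_.abs_lt.1 hlt).2.le⟩
    rw [h.deriv_line_eq h' (hT.trans_le this), h.line_eq h' (hT.le.trans this), sub_self]
  rw [integral_sub hF.1 hF'.1,
    intervalIntegral.integral_sub hF.1.intervalIntegrable hF'.1.intervalIntegrable] at key
  simp only [Contour.integral, Contour.truncIntegral]
  rw [add_sub_add_comm, key, add_sub_add_comm]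

/-- The integral of a function with isolated poles depends only on the position of the poles with
respect to the contour. -/
theorem Separates.integral_eq (h : Separates γ Γ₁ Γ₂) (h' : Separates γ' Γ₁' Γ₂')
    (hτ : HasTails ψ τ γ) (hτ' : HasTails ψ τ γ') {P : Set ℂ}
    (hP : ∀ z ∈ P, (z ∈ Γ₁ ∧ z ∈ Γ₁') ∨ (z ∈ Γ₂ ∧ z ∈ Γ₂'))
    (hPfin : ∀ R : ℝ, (P ∩ Metric.closedBall 0 R).Finite) {F : ℂ → E}
    (hF : DifferentiableOn ℂ F Pᶜ) (hFm : ∀ p ∈ P, MeromorphicAt F p)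
    (hi : γ.IntegrableAlong F) (hi' : γ'.IntegrableAlong F) :
    γ.integral F = γ'.integral F := by
  rw [← sub_eq_zero, hτ.integral_sub_integral hτ' (lt_add_one τ) hi hi', sub_eq_zero]
  set T := τ + 1 with hT
  have hτT : τ < T := lt_add_one τ
  -- One disc containing both truncated contours allows the same decomposition into principal parts
  -- to be used for both.
  obtain ⟨R, hR⟩ := ((γ.isCompact_truncImage (T := T)).union
    (γ'.isCompact_truncImage (T := T))).isBounded.subset_ball (0 : ℂ)
  set S : Finset ℂ := (hPfin R).toFinset with hS
  have hSP : ∀ p ∈ S, p ∈ P := fun p hp => ((hPfin R).mem_toFinset.1 hp).1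
  have hFd : DifferentiableOn ℂ F (Metric.ball 0 R \ S) := by
    refine hF.mono fun z hz hzP => hz.2 ?_
    simp only [hS, Finite.coe_toFinset]
    exact ⟨hzP, Metric.ball_subset_closedBall hz.1⟩
  obtain ⟨N, a, A, hA, hFA⟩ := exists_principalParts Metric.isOpen_ball S hFd
    fun p hp => hFm p (hSP p hp)
  -- The holomorphic remainder has a primitive on the disc, so its integral depends only on the
  -- truncation points, which the two contours share.
  obtain ⟨B, hB⟩ := hA.isExactOn_ball
  -- both contours avoid the poles
  have hPI : ∀ p ∈ P, p ∉ γ.image ∧ p ∉ γ'.image := fun p hp =>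
    (hP p hp).elim (fun h1 => ⟨h.notMem_left h1.1, h'.notMem_left h1.2⟩)
      (fun h1 => ⟨h.notMem_right h1.1, h'.notMem_right h1.2⟩)
  have hterm : ∀ δ : Contour, δ.truncImage T ⊆ Metric.ball 0 R → (∀ p ∈ P, p ∉ δ.image) →
      δ.truncIntegral T F = (B (δ.line T) - B (δ.line (-T))) +
        ∑ p ∈ S, ∑ j ∈ Finset.Icc 1 (N p), δ.truncIntegral T (fun z => ((z - p) ^ j)⁻¹ • a p j) :=
          by
    intro δ hδ hδP
    have hδS : ∀ p ∈ S, ∀ z ∈ δ.truncImage T, z ≠ p := fun p hp z hz hzp =>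
      hδP p (hSP p hp) (hzp ▸ Contour.truncImage_subset_image hz)
    have hc : ∀ p ∈ S, ∀ j, ContinuousOn (fun z => ((z - p) ^ j)⁻¹ • a p j) (δ.truncImage T) := by
      intro p hp j
      refine ContinuousOn.smul (ContinuousOn.inv₀ (by fun_prop) ?_) continuousOn_const
      exact fun z hz => pow_ne_zero _ (sub_ne_zero.2 (hδS p hp z hz))
    have hAc : ContinuousOn A (δ.truncImage T) := hA.continuousOn.mono hδ
    rw [Contour.truncIntegral_congr (G := fun z => A z +
        ∑ p ∈ S, ∑ j ∈ Finset.Icc 1 (N p), ((z - p) ^ j)⁻¹ • a p j)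
        fun z hz => hFA z (hδ hz) fun hzS => hδS z hzS z hz rfl,
      Contour.truncIntegral_add hAc
        (continuousOn_finsetSum _ fun p hp => continuousOn_finsetSum _ fun j _ => hc p hp j),
      Contour.truncIntegral_of_hasDerivAt hAc fun z hz => hB z (hδ hz),
      Contour.truncIntegral_sum S fun p hp => continuousOn_finsetSum _ fun j _ => hc p hp j]
    congr 1
    exact Finset.sum_congr rfl fun p hp => Contour.truncIntegral_sum _ fun j _ => hc p hp j
  -- Poles of order `j + 2` have single-valued primitives off the pole. Only order one is left to
  -- the winding number.
  have hpow : ∀ δ : Contour, ∀ p ∉ δ.image, ∀ (j : ℕ) (v : E),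
      δ.truncIntegral T (fun z => ((z - p) ^ (j + 2))⁻¹ • v) =
      (-((j + 1 : ℂ)⁻¹ * ((δ.line T - p) ^ (j + 1))⁻¹)) • v -
        (-((j + 1 : ℂ)⁻¹ * ((δ.line (-T) - p) ^ (j + 1))⁻¹)) • v := by
    intro δ p hp j v
    have hne : ∀ z ∈ δ.truncImage T, z - p ≠ 0 := fun z hz =>
      sub_ne_zero.2 fun h => hp (h ▸ Contour.truncImage_subset_image hz)
    refine Contour.truncIntegral_of_hasDerivAt
      (G := fun z => (-((j + 1 : ℂ)⁻¹ * ((z - p) ^ (j + 1))⁻¹)) • v) ?_ fun z hz => ?_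
    · refine ContinuousOn.smul (ContinuousOn.inv₀ (by fun_prop) ?_) continuousOn_const
      exact fun z hz => pow_ne_zero _ (hne z hz)
    · have hz0 := hne z hz
      have h1 : HasDerivAt (fun z : ℂ => (z - p) ^ (j + 1)) (((j + 1 : ℕ) : ℂ) * (z - p) ^ j * 1) z
        := by
        exact ((hasDerivAt_id z).sub_const p).pow (j + 1)
      have h2 := (((h1.inv (pow_ne_zero _ hz0)).const_mul ((j + 1 : ℂ)⁻¹)).neg).smul_const v
      refine h2.congr_deriv ?_
      congr 1
      have hj : (j + 1 : ℂ) ≠ 0 := Nat.cast_add_one_ne_zero j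
      push_cast
      field_simp
      ring
  have hlT : γ.line T = γ'.line T := hτ.line_eq hτ' (hτT.le.trans (le_abs_self T))
  have hlT' : γ.line (-T) = γ'.line (-T) :=
    hτ.line_eq hτ' (by rw [abs_neg]; exact hτT.le.trans (le_abs_self T))
  rw [hterm γ (subset_union_left.trans hR) fun p hp => (hPI p hp).1,
    hterm γ' (subset_union_right.trans hR) fun p hp => (hPI p hp).2, hlT, hlT']
  congr 1
  refine Finset.sum_congr rfl fun p hp => Finset.sum_congr rfl fun j hj => ?_
  have hpP := hPI p (hSP p hp)
  obtain ⟨k, rfl⟩ : ∃ k, j = k + 1 := ⟨j - 1, by have := (Finset.mem_Icc.1 hj).1; omega⟩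
  rcases k with _ | k
  · simp only [zero_add, pow_one]
    rw [Contour.truncIntegral_sub_inv_smul, Contour.truncIntegral_sub_inv_smul,
      h.cauchy_eq h' hτ hτ' hτT (hP p (hSP p hp))]
  · rw [hpow γ p hpP.1, hpow γ' p hpP.2, hlT, hlT']

end Independence

end SepMer


/-! ### Adjoining circles to a contour -/

namespace SepMer

variable {ψ τ : ℝ} {γ : Contour} {Γ₁ Γ₂ : Set ℂ}

lemma HasSides.mono {c : ℝ → ℂ} {A B A' B' : Set ℂ} (h : HasSides c A B) (hA : A ⊆ A')
    (hB : B ⊆ B') : HasSides c A' B' :=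
  fun t => (h t).mono fun _ hε => ⟨hA hε.1, hB hε.2⟩

lemma HasSides.inter {c : ℝ → ℂ} {A B V : Set ℂ} (h : HasSides c A B) (hV : IsOpen V)
    (hc : ∀ t, c t ∈ V) : HasSides c (A ∩ V) (B ∩ V) := by
  intro t
  have h1 : Tendsto (fun ε : ℝ => c t + ε * Complex.I * deriv c t) (𝓝[>] 0) (𝓝 (c t)) := by
    refine tendsto_nhdsWithin_of_tendsto_nhds (Continuous.tendsto' (by fun_prop) _ _ (by simp))
  have h2 : Tendsto (fun ε : ℝ => c t - ε * Complex.I * deriv c t) (𝓝[>] 0) (𝓝 (c t)) := by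
    refine tendsto_nhdsWithin_of_tendsto_nhds (Continuous.tendsto' (by fun_prop) _ _ (by simp))
  filter_upwards [h t, h1 (hV.mem_nhds (hc t)), h2 (hV.mem_nhds (hc t))] with ε h3 h4 h5
  exact ⟨⟨h3.1, h4⟩, ⟨h3.2, h5⟩⟩

/-- The circle `|z - b| = r`, traversed counterclockwise with period `1`. -/
noncomputable def circleLoop (b : ℂ) (r : ℝ) (t : ℝ) : ℂ := circleMap b r (2 * Real.pi * t)

section circleLoop

variable {b : ℂ} {r : ℝ}

lemma hasDerivAt_circleLoop (t : ℝ) :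
    HasDerivAt (circleLoop b r)
      (2 * Real.pi * (circleMap 0 r (2 * Real.pi * t) * Complex.I)) t := by
  have h := (hasDerivAt_circleMap b r (2 * Real.pi * t)).scomp t
    ((hasDerivAt_id t).const_mul (2 * Real.pi))
  refine h.congr_deriv ?_
  simp [Complex.real_smul]

lemma range_circleLoop (hr : 0 ≤ r) : range (circleLoop b r) = Metric.sphere b r := by
  have : circleLoop b r = circleMap b r ∘ (fun t => 2 * Real.pi * t) := rfl
  rw [this, range_comp, (mul_left_surjective₀ Real.two_pi_pos.ne').range_eq, image_univ,
    range_circleMap, abs_of_nonneg hr]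

/-- The velocity is `2πi` times the radius vector, so a displacement by `± ε i` times the velocity
rescales the radius vector by `1 ∓ 2πε`. -/
lemma hasSides_circleLoop (hr : 0 < r) :
    HasSides (circleLoop b r) (Metric.ball b r) (Metric.closedBall b r)ᶜ := by
  intro t
  rw [(hasDerivAt_circleLoop t).deriv]
  set e := circleMap 0 r (2 * Real.pi * t) with he
  have hn : ‖e‖ = r := by simp [he, abs_of_pos hr]
  have h0 : circleLoop b r t = b + e := by simp [circleLoop, he, circleMap]
  have h1 : ∀ᶠ ε : ℝ in 𝓝[>] 0, 2 * Real.pi * ε < 1 := by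
    have : Tendsto (fun ε : ℝ => 2 * Real.pi * ε) (𝓝[>] 0) (𝓝 0) :=
      tendsto_nhdsWithin_of_tendsto_nhds (Continuous.tendsto' (by fun_prop) _ _ (by simp))
    exact this (gt_mem_nhds one_pos)
  filter_upwards [h1, self_mem_nhdsWithin] with ε h2 (h3 : 0 < ε)
  have h4 : 0 < 2 * Real.pi * ε := by positivity
  have e1 : circleLoop b r t + ε * Complex.I * (2 * Real.pi * (e * Complex.I)) - b =
      ((1 - 2 * Real.pi * ε : ℝ) : ℂ) * e := by
    rw [h0]; push_cast; linear_combination (2 * Real.pi * ε * e) * Complex.I_sq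
  have e2 : circleLoop b r t - ε * Complex.I * (2 * Real.pi * (e * Complex.I)) - b =
      ((1 + 2 * Real.pi * ε : ℝ) : ℂ) * e := by
    rw [h0]; push_cast; linear_combination (-(2 * Real.pi * ε * e)) * Complex.I_sq
  constructor
  · rw [Metric.mem_ball, dist_eq_norm, e1, norm_mul, Complex.norm_real, hn, Real.norm_eq_abs,
      abs_of_pos (by linarith)]
    nlinarith
  · rw [mem_compl_iff, Metric.mem_closedBall, dist_eq_norm, e2, norm_mul, Complex.norm_real, hn,
      Real.norm_eq_abs, abs_of_pos (by linarith)]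
    nlinarith

lemma integral_circleLoop {E : Type*} [NormedAddCommGroup E] [NormedSpace ℂ E] (F : ℂ → E) :
    ∫ t in (0 : ℝ)..1, deriv (circleLoop b r) t • F (circleLoop b r t) = ∮ z in C(b, r), F z := by
  have h := intervalIntegral.smul_integral_comp_mul_left (a := 0) (b := 1)
    (fun θ => deriv (circleMap b r) θ • F (circleMap b r θ)) (2 * Real.pi)
  rw [mul_zero, mul_one] at h
  rw [circleIntegral, ← h, ← intervalIntegral.integral_smul]
  refine intervalIntegral.integral_congr fun t _ => ?_
  simp only [(hasDerivAt_circleLoop t).deriv, deriv_circleMap, circleLoop]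
  rw [← smul_assoc, Complex.real_smul]
  push_cast
  rfl

end circleLoop

namespace Contour

/-- Adjoin to a contour a circle that does not meet it. -/
noncomputable def addCircle (γ : Contour) (b : ℂ) (r : ℝ) (hr : 0 < r)
    (h : Disjoint (Metric.sphere b r) γ.image) : Contour where
  line := γ.line
  n := γ.n + 1
  loop := Fin.cons (circleLoop b r) γ.loop
  line_smooth := γ.line_smooth
  line_deriv := γ.line_deriv
  line_injective := γ.line_injective
  loop_smooth i := by
    refine Fin.cases ?_ (fun i => ?_) i
    · exact (contDiff_circleMap b r).comp (contDiff_const.mul contDiff_id)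
    · exact γ.loop_smooth i
  loop_deriv i t := by
    refine Fin.cases ?_ (fun i => ?_) i
    · rw [Fin.cons_zero, (hasDerivAt_circleLoop t).deriv]
      simp [Real.pi_ne_zero, hr.ne']
    · exact γ.loop_deriv i t
  loop_periodic i := by
    refine Fin.cases ?_ (fun i => ?_) i
    · intro t
      simp only [Fin.cons_zero, circleLoop]
      rw [mul_add, mul_one, periodic_circleMap]
    · exact γ.loop_periodic i
  loop_injOn i := by
    refine Fin.cases ?_ (fun i => ?_) i
    · intro s hs t ht hst
      have hp := Real.two_pi_pos
      have := eq_of_circleMap_eq hr.ne' (a := 2 * Real.pi * s) (b := 2 * Real.pi * t) ?_ hst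
      · exact mul_left_cancel₀ hp.ne' this
      · rw [← mul_sub, abs_mul, abs_of_pos hp]
        have : |s - t| < 1 := abs_sub_lt_iff.2 ⟨by linarith [hs.2, ht.1], by linarith [hs.1, ht.2]⟩
        nlinarith
    · exact γ.loop_injOn i
  line_loop_disjoint i := by
    refine Fin.cases ?_ (fun i => ?_) i
    · rw [Fin.cons_zero, range_circleLoop hr.le]
      exact (h.mono_right subset_union_left).symm
    · exact γ.line_loop_disjoint i
  loop_disjoint i j := by
    have h0 : ∀ i, Disjoint (range (circleLoop b r)) (range (γ.loop i)) := fun i => by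
      rw [range_circleLoop hr.le]
      exact h.mono_right ((subset_iUnion (fun i => range (γ.loop i)) i).trans subset_union_right)
    refine Fin.cases ?_ (fun i => ?_) i <;> refine Fin.cases ?_ (fun j => ?_) j
    · exact fun h => absurd rfl h
    · exact fun _ => h0 j
    · exact fun _ => (h0 i).symm
    · exact fun hij => γ.loop_disjoint i j fun hij' => hij (hij' ▸ rfl)

variable {b : ℂ} {r : ℝ} {hr : 0 < r} {h : Disjoint (Metric.sphere b r) γ.image}

lemma image_addCircle : (γ.addCircle b r hr h).image = γ.image ∪ Metric.sphere b r := by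
  have : (⋃ i, range ((γ.addCircle b r hr h).loop i)) =
      Metric.sphere b r ∪ ⋃ i, range (γ.loop i) := by
    ext z
    simp only [mem_iUnion, mem_union]
    refine (Fin.exists_fin_succ (n := γ.n)).trans ?_
    rw [← range_circleLoop hr.le]
    rfl
  simp only [image, this]
  ext z
  simp only [mem_union]
  change (z ∈ range γ.line ∨ _) ↔ _
  tauto

lemma integral_addCircle {E : Type*} [NormedAddCommGroup E] [NormedSpace ℂ E] (F : ℂ → E) :
    (γ.addCircle b r hr h).integral F = γ.integral F + ∮ z in C(b, r), F z := by
  have : (∑ i, ∫ t in (0 : ℝ)..1, deriv ((γ.addCircle b r hr h).loop i) t •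
      F ((γ.addCircle b r hr h).loop i t)) = (∮ z in C(b, r), F z) +
      ∑ i, ∫ t in (0 : ℝ)..1, deriv (γ.loop i) t • F (γ.loop i t) := by
    rw [← integral_circleLoop]
    exact Fin.sum_univ_succ _
  rw [integral, this, integral]
  change (∫ t, deriv γ.line t • F (γ.line t)) + _ = _
  abel

end Contour

/-- A counterclockwise circle has its interior on the left. Inserted into the right region, it
transfers its open disc to the left region and leaves the sides along the old contour unchanged. -/
lemma Separates.addCircle (hs : Separates γ Γ₁ Γ₂) {b : ℂ} {r : ℝ} (hr : 0 < r)
    (h : Disjoint (Metric.sphere b r) γ.image) (hb : Metric.closedBall b r ⊆ Γ₂) :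
    Separates (γ.addCircle b r hr h) (Γ₁ ∪ Metric.ball b r) (Γ₂ \ Metric.closedBall b r) where
  isOpen_left := hs.isOpen_left.union Metric.isOpen_ball
  isOpen_right := hs.isOpen_right.sdiff Metric.isClosed_closedBall
  disjoint := by
    refine Disjoint.union_left (hs.disjoint.mono_right sdiff_subset) ?_
    exact disjoint_sdiff_right.mono_left Metric.ball_subset_closedBall
  union := by
    rw [Contour.image_addCircle, compl_union, ← hs.union]
    have h1 := Metric.ball_union_sphere (x := b) (ε := r)
    have h2 := Metric.sphere_disjoint_ball (x := b) (ε := r)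
    ext z
    have h3 : z ∈ Metric.closedBall b r ↔ z ∈ Metric.ball b r ∨ z ∈ Metric.sphere b r := by
      rw [← h1]; rfl
    have h4 : z ∈ Metric.sphere b r → z ∉ Metric.ball b r := fun hz => disjoint_left.1 h2 hz
    have h5 : z ∈ Metric.closedBall b r → z ∈ Γ₂ := fun hz => hb hz
    have h6 : z ∈ Γ₁ → z ∉ Γ₂ := fun hz => disjoint_left.1 hs.disjoint hz
    simp only [mem_union, Set.mem_sdiff, mem_inter_iff, mem_compl_iff]
    tauto
  line_sides := by
    refine HasSides.mono (hs.line_sides.inter (V := (Metric.closedBall b r)ᶜ)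
      Metric.isClosed_closedBall.isOpen_compl fun t ht => ?_) (fun z hz => Or.inl hz.1) (fun z hz
        => hz)
    exact hs.notMem_right (hb ht) (γ.line_mem_image t)
  loop_sides i := by
    refine Fin.cases ?_ (fun i => ?_) i
    · refine ((hasSides_circleLoop (b := b) hr).inter hs.isOpen_right fun t => hb ?_).mono
        (fun z hz => Or.inr hz.1) (fun z hz => ⟨hz.2, hz.1⟩)
      exact Metric.sphere_subset_closedBall (range_circleLoop (b := b) hr.le ▸ mem_range_self t)
    · refine HasSides.mono ((hs.loop_sides i).inter (V := (Metric.closedBall b r)ᶜ)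
        Metric.isClosed_closedBall.isOpen_compl fun t ht => ?_) (fun z hz => Or.inl hz.1)
        (fun z hz => hz)
      exact hs.notMem_right (hb ht) (γ.loop_mem_image i t)
  eventually_right := by
    filter_upwards [hs.eventually_right, eventually_gt_atTop (‖b‖ + r)] with x h1 h2
    refine ⟨h1, fun h3 => ?_⟩
    have h4 : ‖(x : ℂ)‖ ≤ ‖b‖ + r := by
      calc ‖(x : ℂ)‖ = ‖b + (x - b)‖ := by ring_nf
        _ ≤ ‖b‖ + ‖(x : ℂ) - b‖ := norm_add_le _ _
        _ ≤ ‖b‖ + r := by gcongr; exact mem_closedBall_iff_norm.1 h3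
    rw [Complex.norm_real] at h4
    linarith [Real.le_norm_self x]

/-- Adjoin finitely many disjoint circles inside the right-hand region of a contour. -/
lemma Separates.exists_addCircles (hs : Separates γ Γ₁ Γ₂) (hτ : HasTails ψ τ γ) {r : ℝ}
    (hr : 0 < r) (S : Finset ℂ) (hS : ∀ b ∈ S, Metric.closedBall b r ⊆ Γ₂)
    (hd : ∀ b ∈ S, ∀ b' ∈ S, b ≠ b' → Disjoint (Metric.closedBall b r) (Metric.closedBall b' r)) :
    ∃ γ' : Contour, HasTails ψ τ γ' ∧
      Separates γ' (Γ₁ ∪ ⋃ b ∈ S, Metric.ball b r) (Γ₂ \ ⋃ b ∈ S, Metric.closedBall b r) ∧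
      ∀ {E : Type*} [NormedAddCommGroup E] [NormedSpace ℂ E] (F : ℂ → E),
        γ'.integral F = γ.integral F + ∑ b ∈ S, ∮ z in C(b, r), F z := by
  classical
  induction S using Finset.induction_on with
  | empty => exact ⟨γ, hτ, by simpa using hs, by simp⟩
  | insert b S hbS ih =>
    obtain ⟨γ', h1, h2, h3⟩ := ih (fun b hb => hS b (Finset.mem_insert_of_mem hb))
      fun b hb b' hb' => hd b (Finset.mem_insert_of_mem hb) b' (Finset.mem_insert_of_mem hb')
    have hb : Metric.closedBall b r ⊆ Γ₂ \ ⋃ b ∈ S, Metric.closedBall b r := by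
      refine fun z hz => ⟨hS b (Finset.mem_insert_self b S) hz, fun hz' => ?_⟩
      obtain ⟨b', hb', hz'⟩ := mem_iUnion₂.1 hz'
      exact disjoint_left.1 (hd b (Finset.mem_insert_self b S) b' (Finset.mem_insert_of_mem hb')
        fun h => hbS (h ▸ hb')) hz hz'
    have h4 : Disjoint (Metric.sphere b r) γ'.image :=
      disjoint_left.2 fun z hz => h2.notMem_right (hb (Metric.sphere_subset_closedBall hz))
    refine ⟨γ'.addCircle b r hr h4, h1, ?_, ?_⟩
    · convert h2.addCircle hr h4 hb using 1
      · rw [Finset.set_biUnion_insert, union_assoc, union_comm (Metric.ball b r)]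
      · rw [Finset.set_biUnion_insert, sdiff_sdiff, union_comm (Metric.closedBall b r)]
    · intro E _ _ F
      rw [Contour.integral_addCircle, h3, Finset.sum_insert hbS]
      abel

lemma eventually_closedBall_subset {X : Type*} [PseudoMetricSpace X] {b : X} {U : Set X}
    (hU : U ∈ 𝓝 b) : ∀ᶠ ε : ℝ in 𝓝[>] 0, Metric.closedBall b ε ⊆ U := by
  obtain ⟨δ, hδ, h⟩ := Metric.nhds_basis_closedBall.mem_iff.1 hU
  filter_upwards [Ioo_mem_nhdsGT hδ] with ε hε
  exact (Metric.closedBall_subset_closedBall hε.2.le).trans h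

lemma eventually_disjoint_closedBall (S : Finset ℂ) : ∀ᶠ ε : ℝ in 𝓝[>] 0,
    ∀ b ∈ S, ∀ b' ∈ S, b ≠ b' → Disjoint (Metric.closedBall b ε) (Metric.closedBall b' ε) := by
  rw [eventually_all_finset]
  intro b _
  rw [eventually_all_finset]
  intro b' _
  by_cases h : b = b'
  · simp [h]
  · filter_upwards [Ioo_mem_nhdsGT (half_pos (dist_pos.2 h))] with ε hε _
    exact Metric.closedBall_disjoint_closedBall (by linarith [hε.2])

end SepMer


/-! ### Contours that are graphs over the imaginary direction -/

namespace SepMer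

lemma eventually_pos_of_hasDerivAt {f : ℝ → ℝ} {f' x : ℝ} (hf : HasDerivAt f f' x) (h0 : f x = 0)
    (hf' : 0 < f') : ∀ᶠ t in 𝓝[>] x, 0 < f t := by
  have h1 := (hasDerivAt_iff_tendsto_slope.1 hf).mono_left
    (nhdsWithin_mono x (fun t (ht : x < t) => ht.ne'))
  filter_upwards [h1.eventually (lt_mem_nhds hf'), self_mem_nhdsWithin] with t h2 (h3 : x < t)
  rw [slope_def_field, h0, sub_zero] at h2
  exact (div_pos_iff_of_pos_right (sub_pos.2 h3)).1 h2

/-- The graph `Re z = A (Im z / σ)`, traversed upwards. -/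
noncomputable def graphLine (A : ℝ → ℝ) (σ t : ℝ) : ℂ := ⟨A t, t * σ⟩

lemma graphLine_eq (A : ℝ → ℝ) (σ t : ℝ) :
    graphLine A σ t = (A t : ℂ) + ((t * σ : ℝ) : ℂ) * Complex.I := by
  apply Complex.ext <;> simp [graphLine]

lemma hasDerivAt_graphLine {A : ℝ → ℝ} {σ t a : ℝ} (hA : HasDerivAt A a t) :
    HasDerivAt (graphLine A σ) (a + σ * Complex.I) t := by
  have h := hA.ofReal_comp.add ((((hasDerivAt_id t).mul_const σ).ofReal_comp).mul_const Complex.I)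
  rw [one_mul] at h
  refine h.congr_of_eventuallyEq (Eventually.of_forall fun t => graphLine_eq A σ t)

/-- The graph of a smooth function as a contour without bounded components. -/
noncomputable def graphContour (A : ℝ → ℝ) (σ : ℝ) (hA : ContDiff ℝ ∞ A) (hσ : 0 < σ) :
    Contour where
  line := graphLine A σ
  n := 0
  loop i := i.elim0
  line_smooth := by
    have : graphLine A σ = fun t => (A t : ℂ) + ((t * σ : ℝ) : ℂ) * Complex.I :=
      funext fun t => graphLine_eq A σ t
    rw [this]
    have h1 : ContDiff ℝ ∞ (fun t => (A t : ℂ)) := Complex.ofRealCLM.contDiff.comp hA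
    have h2 : ContDiff ℝ ∞ (fun t : ℝ => ((t * σ : ℝ) : ℂ)) :=
      Complex.ofRealCLM.contDiff.comp (contDiff_id.mul contDiff_const)
    exact h1.add (h2.mul contDiff_const)
  line_deriv t := by
    have hd := (hA.differentiable (by simp) t).hasDerivAt
    rw [(hasDerivAt_graphLine hd).deriv]
    intro h
    have := congrArg Complex.im h
    simp at this
    exact hσ.ne' this
  line_injective s t h := mul_right_cancel₀ hσ.ne' (congrArg Complex.im h)
  loop_smooth i := i.elim0
  loop_deriv i := i.elim0
  loop_periodic i := i.elim0
  loop_injOn i := i.elim0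
  line_loop_disjoint i := i.elim0
  loop_disjoint i := i.elim0

/-- For a graph traversed upwards the two regions are explicit: the points with smaller real part
lie on the left, those with larger real part on the right. -/
lemma separates_graphContour {A : ℝ → ℝ} {σ : ℝ} (hA : ContDiff ℝ ∞ A) (hσ : 0 < σ) :
    Separates (graphContour A σ hA hσ) {z | z.re < A (z.im / σ)} {z | A (z.im / σ) < z.re} where
  isOpen_left := isOpen_lt Complex.continuous_re
    (hA.continuous.comp (Complex.continuous_im.div_const σ))
  isOpen_right := isOpen_lt (hA.continuous.comp (Complex.continuous_im.div_const σ))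
    Complex.continuous_re
  disjoint := by
    rw [disjoint_left]
    intro z h1 h2
    simp only [mem_ofPred_eq] at h1 h2
    exact lt_asymm h1 h2
  union := by
    have : (graphContour A σ hA hσ).image = {z | z.re = A (z.im / σ)} := by
      ext z
      simp only [Contour.image, mem_union, mem_iUnion, mem_ofPred_eq]
      constructor
      · rintro (⟨t, rfl⟩ | ⟨i, -⟩)
        · simp [graphContour, graphLine, hσ.ne']
        · exact i.elim0
      · intro h
        refine Or.inl ⟨z.im / σ, Complex.ext h.symm ?_⟩
        simp [graphContour, graphLine, hσ.ne']
    rw [this]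
    ext z
    simp [lt_or_lt_iff_ne]
  line_sides t := by
    have hd := (hA.differentiable (by simp) t).hasDerivAt
    have hl : deriv (graphContour A σ hA hσ).line t = deriv A t + σ * Complex.I :=
      (hasDerivAt_graphLine hd).deriv
    set a := deriv A t with ha
    -- Here `s = 1` treats the left side and `s = -1` the right side. The expression vanishes at `ε
    -- = 0` with derivative `a ^ 2 / σ + σ > 0`.
    have key : ∀ s : ℝ, (s = 1 ∨ s = -1) →
        ∀ᶠ ε in 𝓝[>] (0 : ℝ), 0 < s * (A (t + ε * (s * a / σ)) - A t) + ε * σ := by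
      intro s hs
      have h1 : HasDerivAt (fun ε : ℝ => t + ε * (s * a / σ)) (s * a / σ) 0 := by
        simpa using ((hasDerivAt_id (0 : ℝ)).mul_const (s * a / σ)).const_add t
      have h2 : HasDerivAt (fun ε => A (t + ε * (s * a / σ))) (a * (s * a / σ)) 0 :=
        HasDerivAt.comp (0 : ℝ) (h₂ := A) (by simpa using hd) h1
      have h3 := ((h2.sub_const (A t)).const_mul s).add ((hasDerivAt_id (0 : ℝ)).mul_const σ)
      refine eventually_pos_of_hasDerivAt h3 (by simp) ?_
      have hs2 : s * s = 1 := by rcases hs with rfl | rfl <;> norm_num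
      have : s * (a * (s * a / σ)) = a ^ 2 / σ := by
        calc s * (a * (s * a / σ)) = (s * s) * (a ^ 2 / σ) := by ring
          _ = _ := by rw [hs2, one_mul]
      rw [this, one_mul]
      positivity
    filter_upwards [key 1 (Or.inl rfl), key (-1) (Or.inr rfl)] with ε h1 h2
    have h0 : (graphContour A σ hA hσ).line t = ⟨A t, t * σ⟩ := rfl
    rw [hl, h0]
    constructor
    · have e1 : (t * σ + ε * a) / σ = t + ε * (1 * a / σ) := by field_simp
      simp only [Complex.add_re, Complex.add_im, Complex.mul_re, Complex.mul_im,
        Complex.ofReal_re, Complex.ofReal_im, Complex.I_re, Complex.I_im]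
      ring_nf at h1 e1 ⊢
      rw [e1]
      linarith
    · have e1 : (t * σ - ε * a) / σ = t + ε * (-1 * a / σ) := by field_simp; ring
      simp only [Complex.sub_re, Complex.sub_im, Complex.add_re, Complex.add_im,
        Complex.mul_re, Complex.mul_im,
        Complex.ofReal_re, Complex.ofReal_im, Complex.I_re, Complex.I_im]
      ring_nf at h2 e1 ⊢
      rw [e1]
      linarith
  loop_sides i := i.elim0
  eventually_right := by
    filter_upwards [eventually_gt_atTop (A 0)] with x hx
    simpa using hx

/-- A smooth function equal to `s` near `0` and to `|t| k` for `|t| ≥ τ`. -/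
noncomputable def profile (k τ s t : ℝ) : ℝ :=
  Real.smoothTransition (2 * (t / τ) ^ 2 - 1) * (|t| * k) +
    (1 - Real.smoothTransition (2 * (t / τ) ^ 2 - 1)) * s

/-! ### The bent profile between the rays -/

section profile

variable {k τ s t : ℝ}

lemma profile_of_le (hτ : 0 < τ) (ht : τ ≤ |t|) : profile k τ s t = |t| * k := by
  have : 1 ≤ (t / τ) ^ 2 := by
    rw [div_pow, one_le_div (by positivity), sq_le_sq, abs_of_pos hτ]
    exact ht
  rw [profile, Real.smoothTransition.one_of_one_le (by linarith)]
  ring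

lemma profile_of_abs_le_half (hτ : 0 < τ) (ht : |t| ≤ τ / 2) : profile k τ s t = s := by
  have : (t / τ) ^ 2 ≤ 1 / 4 := by
    rw [div_pow, div_le_iff₀ (by positivity), ← sq_abs]
    nlinarith [abs_nonneg t]
  rw [profile, Real.smoothTransition.zero_of_nonpos (by linarith)]
  ring

lemma contDiff_profile (hτ : 0 < τ) : ContDiff ℝ ∞ (profile k τ s) := by
  rw [contDiff_iff_contDiffAt]
  intro t
  by_cases ht : t = 0
  · subst ht
    refine contDiffAt_const (c := s) |>.congr_of_eventuallyEq ?_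
    filter_upwards [Metric.closedBall_mem_nhds (0 : ℝ) (half_pos hτ)] with t ht
    exact profile_of_abs_le_half hτ (by simpa using ht)
  · have h1 : ContDiffAt ℝ ∞ (fun t : ℝ => 2 * (t / τ) ^ 2 - 1) t := by fun_prop
    have h2 : ContDiffAt ℝ ∞ (fun t : ℝ => Real.smoothTransition (2 * (t / τ) ^ 2 - 1)) t :=
      ContDiffAt.comp t Real.smoothTransition.contDiffAt h1
    exact (h2.mul ((contDiffAt_abs ht).mul contDiffAt_const)).add
      ((contDiffAt_const.sub h2).mul contDiffAt_const)

/-- The profile is a convex combination of `|t| * k` and `s`. For `|t| ≤ τ` one has `s ≤ -τ ≤ |t| *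
k`, so bending moves the curve to the left only. -/
lemma profile_le (hk : |k| ≤ 1) (hτ : 0 < τ) (hs : s ≤ -τ) : profile k τ s t ≤ |t| * k := by
  rcases le_total τ |t| with ht | ht
  · exact (profile_of_le hτ ht).le
  · have h1 := Real.smoothTransition.le_one (2 * (t / τ) ^ 2 - 1)
    have h2 : s ≤ |t| * k := by
      have := neg_abs_le k
      nlinarith [abs_nonneg t]
    rw [profile]
    nlinarith

lemma abs_profile_le (hk : |k| ≤ 1) (ht : |t| ≤ τ) : |profile k τ s t| ≤ τ + |s| := by
  have h0 := Real.smoothTransition.nonneg (2 * (t / τ) ^ 2 - 1)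
  have h1 := Real.smoothTransition.le_one (2 * (t / τ) ^ 2 - 1)
  have h2 : |(|t| * k)| ≤ τ := by
    rw [abs_mul, abs_abs]
    nlinarith [abs_nonneg t, abs_nonneg k]
  rw [profile]
  refine (abs_add_le _ _).trans ?_
  rw [abs_mul, abs_mul _ s, abs_of_nonneg h0, abs_of_nonneg (sub_nonneg.2 h1)]
  nlinarith [abs_nonneg s, abs_nonneg (|t| * k)]

/-- In the bent part a given point lies on the curve for only one value of `s`, because the
coefficient of `s` is positive there. Countably many points exclude countably many values, and
arbitrarily negative ones remain. -/
lemma exists_profile_ne (hτ : 0 < τ) {σ K : ℝ} {P : Set ℂ} (hP : P.Countable)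
    (hray : ∀ z ∈ P, τ ≤ |z.im / σ| → z.re ≠ |z.im / σ| * k) :
    ∃ s < K, ∀ z ∈ P, z.re ≠ profile k τ s (z.im / σ) := by
  set χ : ℝ → ℝ := fun t => Real.smoothTransition (2 * (t / τ) ^ 2 - 1) with hχ
  set f : ℂ → ℝ := fun z => (z.re - χ (z.im / σ) * (|z.im / σ| * k)) / (1 - χ (z.im / σ)) with hf
  obtain ⟨s, hs, hsK⟩ := ((hP.image f).dense_compl ℝ).exists_mem_open isOpen_Iio (nonempty_Iio (a
      := K))
  refine ⟨s, hsK, fun z hz h => ?_⟩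
  rcases le_or_gt τ |z.im / σ| with ht | ht
  · exact hray z hz ht (h.trans (profile_of_le hτ ht))
  · refine hs ⟨z, hz, ?_⟩
    have h1 : χ (z.im / σ) < 1 := by
      refine Real.smoothTransition.lt_one_of_lt_one ?_
      have : (z.im / σ / τ) ^ 2 < 1 := by
        rw [div_pow _ τ, div_lt_one (by positivity), sq_lt_sq, abs_of_pos hτ]
        exact ht
      linarith
    rw [hf]
    dsimp only
    rw [h, profile, div_eq_iff (sub_pos.2 h1).ne']
    ring

end profile

/-- The difference of the two sides equals `‖z‖ * sin (ψ - |arg z|)`, whose sign is that of `ψ -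
|arg z|`. This makes the sectors comparable with graphs. -/
lemma abs_arg_le_iff {ψ : ℝ} (hψ₀ : 0 < ψ) (hψ₁ : ψ < Real.pi) {z : ℂ} (hz : z ≠ 0) :
    (|z.arg| ≤ ψ ↔ |z.im| * Real.cos ψ ≤ z.re * Real.sin ψ) ∧
      (ψ ≤ |z.arg| ↔ z.re * Real.sin ψ ≤ |z.im| * Real.cos ψ) := by
  have hn : 0 < ‖z‖ := norm_pos_iff.2 hz
  have hα := abs_nonneg z.arg
  have hα' := Complex.abs_arg_le_pi z
  have hre : z.re = ‖z‖ * Real.cos |z.arg| := by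
    rw [Real.cos_abs]; exact (Complex.norm_mul_cos_arg z).symm
  have him : |z.im| = ‖z‖ * Real.sin |z.arg| := by
    have h1 : |Real.sin z.arg| = Real.sin |z.arg| := by
      rcases abs_cases z.arg with ⟨h, h'⟩ | ⟨h, h'⟩
      · rw [h, abs_of_nonneg]; exact Real.sin_nonneg_of_nonneg_of_le_pi h' (h ▸ hα')
      · rw [h, Real.sin_neg, abs_of_nonpos]
        exact Real.sin_nonpos_of_nonpos_of_neg_pi_le h'.le (by linarith)
    rw [← h1, ← Complex.norm_mul_sin_arg z, abs_mul, abs_of_pos hn]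
  have key : z.re * Real.sin ψ - |z.im| * Real.cos ψ = ‖z‖ * Real.sin (ψ - |z.arg|) := by
    rw [hre, him, Real.sin_sub]; ring
  have h1 : |z.arg| < ψ → 0 < Real.sin (ψ - |z.arg|) := fun h =>
    Real.sin_pos_of_pos_of_lt_pi (by linarith) (by linarith)
  have h2 : ψ < |z.arg| → Real.sin (ψ - |z.arg|) < 0 := fun h =>
    Real.sin_neg_of_neg_of_neg_pi_lt (by linarith) (by linarith)
  have h3 : |z.arg| = ψ → Real.sin (ψ - |z.arg|) = 0 := fun h => by rw [h]; simp
  rcases lt_trichotomy |z.arg| ψ with h | h | h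
  · have := mul_pos hn (h1 h)
    exact ⟨iff_of_true h.le (by linarith), iff_of_false (by linarith) (by linarith)⟩
  · have := h3 h
    rw [this, mul_zero] at key
    exact ⟨iff_of_true h.le (by linarith), iff_of_true h.ge (by linarith)⟩
  · have := mul_neg_of_pos_of_neg hn (h2 h)
    exact ⟨iff_of_false (by linarith) (by linarith), iff_of_true h.le (by linarith)⟩

end SepMer


/-! ### Existence of separating contours -/

namespace SepMer

/-- Far away, everything outside `Γ₁` lies in the sector `|arg z| ≤ ψ`, and everything outside `Γ₂`
lies in the sector `|arg z| ≥ ψ`. -/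
def IsSectorial (ψ : ℝ) (Γ₁ Γ₂ : Set ℂ) : Prop :=
  ∃ M : ℝ, ∀ z : ℂ, M ≤ ‖z‖ → (z ∉ Γ₁ → |z.arg| ≤ ψ) ∧ (z ∉ Γ₂ → ψ ≤ |z.arg|)

lemma isClosed_of_finite_inter_closedBall {P : Set ℂ}
    (hP : ∀ R : ℝ, (P ∩ Metric.closedBall 0 R).Finite) : IsClosed P := by
  rw [← isOpen_compl_iff, isOpen_iff_mem_nhds]
  intro b hb
  have h1 := (hP (‖b‖ + 1)).isClosed.isOpen_compl.mem_nhds (x := b) fun h => hb h.1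
  filter_upwards [h1, Metric.ball_mem_nhds b one_pos] with z h2 h3 h4
  refine h2 ⟨h4, ?_⟩
  rw [mem_closedBall_zero_iff]
  have := mem_ball_iff_norm.1 h3
  linarith [norm_le_norm_add_norm_sub' z b]

lemma countable_of_finite_inter_closedBall {P : Set ℂ}
    (hP : ∀ R : ℝ, (P ∩ Metric.closedBall 0 R).Finite) : P.Countable := by
  refine (countable_iUnion fun n : ℕ => (hP n).countable).mono fun z hz => ?_
  obtain ⟨n, hn⟩ := exists_nat_ge ‖z‖
  exact mem_iUnion.2 ⟨n, hz, mem_closedBall_zero_iff.2 hn⟩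

lemma IsSectorial.sdiff {ψ : ℝ} {Γ₁ Γ₂ K Γ₁' : Set ℂ} (h : IsSectorial ψ Γ₁ Γ₂)
    (hK : Bornology.IsBounded K) (h1 : Γ₁ ⊆ Γ₁') : IsSectorial ψ Γ₁' (Γ₂ \ K) := by
  obtain ⟨M, hM⟩ := h
  obtain ⟨B, hB⟩ := hK.subset_closedBall (0 : ℂ)
  refine ⟨max M (B + 1), fun z hz => ⟨fun h2 => ?_, fun h2 => ?_⟩⟩
  · exact (hM z ((le_max_left _ _).trans hz)).1 fun h3 => h2 (h1 h3)
  · refine (hM z ((le_max_left _ _).trans hz)).2 fun h3 => h2 ⟨h3, fun h4 => ?_⟩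
    have := mem_closedBall_zero_iff.1 (hB h4)
    linarith [(le_max_right M (B + 1)).trans hz]

variable {ψ : ℝ}

/-- Where `|t| ≥ τ` the curve is the pair of rays. In the remaining strip the imaginary part is
bounded, so far out the sign of the real part decides both the side of the curve and the sector. -/
lemma isSectorial_profile (hψ₀ : 0 < ψ) (hψ₁ : ψ < Real.pi) {τ s : ℝ} (hτ : 0 < τ) :
    IsSectorial ψ {z | z.re < profile (Real.cos ψ) τ s (z.im / Real.sin ψ)}
      {z | profile (Real.cos ψ) τ s (z.im / Real.sin ψ) < z.re} := by
  have hσ : 0 < Real.sin ψ := Real.sin_pos_of_pos_of_lt_pi hψ₀ hψ₁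
  have hσ1 := Real.sin_le_one ψ
  set σ := Real.sin ψ
  set k := Real.cos ψ with hk
  have hk1 : |k| ≤ 1 := Real.abs_cos_le_one ψ
  refine ⟨τ + |s| + τ + τ / σ + 1, fun z hz => ?_⟩
  have hτσ : 0 < τ / σ := by positivity
  have hz0 : z ≠ 0 := by
    rintro rfl
    rw [norm_zero] at hz
    linarith [abs_nonneg s]
  rw [(abs_arg_le_iff hψ₀ hψ₁ hz0).1, (abs_arg_le_iff hψ₀ hψ₁ hz0).2]
  set t := z.im / σ with ht
  have him : |z.im| = |t| * σ := by
    rw [ht, abs_div, abs_of_pos hσ]; field_simp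
  simp only [mem_ofPred_eq, not_lt]
  rcases le_or_gt τ |t| with h | h
  · rw [profile_of_le hτ h, him]
    constructor <;> intro h1 <;> nlinarith
  · have hA := abs_le.1 (abs_profile_le (s := s) hk1 h.le)
    have h1 : |z.im| ≤ τ := by rw [him]; nlinarith [abs_nonneg t]
    have h2 := Complex.norm_le_abs_re_add_abs_im z
    have h3 : τ / σ ≤ |z.re| := by linarith [abs_nonneg s]
    have h4 : τ ≤ |z.re| * σ := (div_le_iff₀ hσ).1 h3
    have h5 := abs_le.1 hk1
    have h6 : |(|z.im| * k)| ≤ τ := by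
      rw [abs_mul, abs_abs]
      nlinarith [abs_nonneg z.im, abs_nonneg k]
    have h7 := abs_le.1 h6
    constructor <;> intro h8 <;> rcases abs_cases z.re with ⟨h9, h10⟩ | ⟨h9, h10⟩ <;>
      rw [h9] at h4 h2 <;> nlinarith [abs_nonneg s]

/-- Two disjoint locally finite sets, asymptotically separated by the rays `arg z = ± ψ`, are
separated by a contour. -/
theorem exists_separates (hψ₀ : 0 < ψ) (hψ₁ : ψ < Real.pi) {P₁ P₂ : Set ℂ}
    (hP₁ : ∀ R : ℝ, (P₁ ∩ Metric.closedBall 0 R).Finite)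
    (hP₂ : ∀ R : ℝ, (P₂ ∩ Metric.closedBall 0 R).Finite) (hd : Disjoint P₁ P₂) {ρ : ℝ} (hρ : 0 < ρ)
    (h₁ : ∀ z ∈ P₁, ρ ≤ ‖z‖ → ψ < |z.arg|) (h₂ : ∀ z ∈ P₂, ρ ≤ ‖z‖ → |z.arg| < ψ) :
    ∃ τ γ Γ₁ Γ₂, HasTails ψ τ γ ∧ Separates γ Γ₁ Γ₂ ∧ IsSectorial ψ Γ₁ Γ₂ ∧
      P₁ ⊆ Γ₁ ∧ P₂ ⊆ Γ₂ := by
  have hσ : 0 < Real.sin ψ := Real.sin_pos_of_pos_of_lt_pi hψ₀ hψ₁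
  have hσ1 := Real.sin_le_one ψ
  set σ := Real.sin ψ with hσdef
  set k := Real.cos ψ with hk
  have hk1 : |k| ≤ 1 := Real.abs_cos_le_one ψ
  -- With this choice `‖z‖ < ρ` puts the parameter of `z` in the flat part `|t| ≤ τ / 2`, and `τ ≤
  -- |t|` forces `‖z‖ ≥ ρ`.
  set τ := 2 * (ρ / σ) with hτdef
  have hτ : 0 < τ := by positivity
  have him : ∀ z : ℂ, |z.im| = |z.im / σ| * σ := fun z => by
    rw [abs_div, abs_of_pos hσ]; field_simp
  have hlarge : ∀ z : ℂ, τ ≤ |z.im / σ| → ρ ≤ ‖z‖ := fun z hz => by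
    have h1 : τ * σ = 2 * ρ := by rw [hτdef]; field_simp
    have h2 := Complex.abs_im_le_norm z
    rw [him] at h2
    nlinarith
  -- The bound `-ρ` places the curve to the left of every point of `P₂` in the disc of radius `ρ`.
  -- The bound `-τ` keeps the curve to the left of the rays, hence of the remaining points of `P₂`.
  -- Genericity of `s` keeps `P₁` off the curve.
  obtain ⟨s, hs, hne⟩ := exists_profile_ne (k := k) (σ := σ) (K := min (-τ) (-ρ)) hτ
    ((countable_of_finite_inter_closedBall hP₁)) (by
      intro z hz ht hre
      have h1 := hlarge z ht
      have hz0 : z ≠ 0 := norm_pos_iff.1 (hρ.trans_le h1)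
      refine (h₁ z hz h1).not_ge ((abs_arg_le_iff hψ₀ hψ₁ hz0).1.2 (le_of_eq ?_))
      rw [hre, him]; ring)
  have hsτ : s ≤ -τ := (hs.trans_le (min_le_left _ _)).le
  have hsρ : s < -ρ := hs.trans_le (min_le_right _ _)
  set γ := graphContour (profile k τ s) σ (contDiff_profile hτ) hσ with hγ
  have hsep := separates_graphContour (contDiff_profile (k := k) (s := s) hτ) hσ
  have hsec := isSectorial_profile hψ₀ hψ₁ (s := s) hτ
  set Γ₁ : Set ℂ := {z | z.re < profile k τ s (z.im / σ)} with hΓ₁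
  set Γ₂ : Set ℂ := {z | profile k τ s (z.im / σ) < z.re} with hΓ₂
  have htails : HasTails ψ τ γ := by
    refine ⟨hτ, fun t ht => ?_⟩
    have ht0 : |t| = t := abs_of_pos (hτ.trans_le ht)
    constructor
    · change (⟨profile k τ s t, t * σ⟩ : ℂ) = _
      rw [profile_of_le hτ (by rwa [ht0]), ht0]
      apply Complex.ext <;>
        simp [Complex.exp_ofReal_mul_I_re, Complex.exp_ofReal_mul_I_im, hk, hσdef]
    · change (⟨profile k τ s (-t), -t * σ⟩ : ℂ) = _
      rw [profile_of_le hτ (by rwa [abs_neg, ht0]), abs_neg, ht0, ← neg_mul, ← Complex.ofReal_neg]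
      apply Complex.ext <;>
        simp [Complex.exp_ofReal_mul_I_re, Complex.exp_ofReal_mul_I_im, hk, hσdef,
          -Complex.ofReal_neg]
  have hP₂Γ : P₂ ⊆ Γ₂ := by
    intro z hz
    rcases lt_or_ge ‖z‖ ρ with h | h
    · have h1 : |z.im / σ| ≤ τ / 2 := by
        rw [abs_div, abs_of_pos hσ, hτdef, mul_div_cancel_left₀ _ two_ne_zero]
        gcongr
        exact (Complex.abs_im_le_norm z).trans h.le
      change profile k τ s (z.im / σ) < z.re
      rw [profile_of_abs_le_half hτ h1]
      linarith [(abs_le.1 (Complex.abs_re_le_norm z)).1]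
    · have hz0 : z ≠ 0 := norm_pos_iff.1 (hρ.trans_le h)
      have h1 := mt (abs_arg_le_iff hψ₀ hψ₁ hz0).2.2 (h₂ z hz h).not_ge
      rw [not_le, him] at h1
      refine (profile_le hk1 hτ hsτ).trans_lt ?_
      refine lt_of_mul_lt_mul_right ?_ hσ.le
      linarith
  -- Far out, points of `Γ₂` satisfy `|arg z| ≤ ψ`, while points of `P₁` satisfy the opposite strict
  -- inequality. Misplaced points of `P₁` are thus confined to a bounded set; they are encircled
  -- below by small circles that avoid `P₂`.
  have hSfin : (P₁ ∩ Γ₂).Finite := by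
    obtain ⟨M, hM⟩ := hsec
    refine (hP₁ (max M ρ)).subset fun z hz => ⟨hz.1, ?_⟩
    rw [mem_closedBall_zero_iff]
    by_contra h
    have h := (not_le.1 h).le
    refine (h₁ z hz.1 ((le_max_right _ _).trans h)).not_ge
      ((hM z ((le_max_left _ _).trans h)).1 fun h' => disjoint_left.1 hsep.disjoint h' hz.2)
  set S := hSfin.toFinset with hS
  have hSmem : ∀ b, b ∈ S ↔ b ∈ P₁ ∧ b ∈ Γ₂ := fun b => hSfin.mem_toFinset
  have hU : ∀ᶠ ε : ℝ in 𝓝[>] 0, ∀ b ∈ S, Metric.closedBall b ε ⊆ Γ₂ ∩ P₂ᶜ := by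
    rw [eventually_all_finset]
    intro b hb
    refine eventually_closedBall_subset ((hsep.isOpen_right.inter
      (isClosed_of_finite_inter_closedBall hP₂).isOpen_compl).mem_nhds ?_)
    exact ⟨((hSmem b).1 hb).2, disjoint_left.1 hd ((hSmem b).1 hb).1⟩
  obtain ⟨ε, hε1, hε2, hε : 0 < ε⟩ := (hU.and ((eventually_disjoint_closedBall S).and
    self_mem_nhdsWithin)).exists
  obtain ⟨γ', ht', hs', -⟩ := Separates.exists_addCircles.{0} hsep htails hε S
    (fun b hb => (hε1 b hb).trans inter_subset_left) hε2
  refine ⟨τ, γ', _, _, ht', hs', hsec.sdiff ?_ subset_union_left, fun z hz => ?_,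
    fun z hz => ⟨hP₂Γ hz, fun h => ?_⟩⟩
  · exact (Bornology.isBounded_biUnion_finset S).2 fun b _ => Metric.isBounded_closedBall
  · rcases lt_or_gt_of_ne (hne z hz) with h | h
    · exact Or.inl h
    · exact Or.inr (mem_biUnion (x := z) (by exact (hSmem z).2 ⟨hz, h⟩) (Metric.mem_ball_self hε))
  · obtain ⟨b, hb, h⟩ := mem_iUnion₂.1 h
    exact (hε1 b hb h).2 hz

end SepMer


/-! ### Zeros in a disc and their symmetric functions -/

namespace SepMer

lemma IsCompact.finite_inter_of_eventually_notMem {K P : Set ℂ} (hK : IsCompact K)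
    (h : ∀ z ∈ K, ∀ᶠ y in 𝓝[≠] z, y ∉ P) : (P ∩ K).Finite := by
  by_contra hinf
  obtain ⟨z, hz, hacc⟩ := Set.Infinite.exists_accPt_of_subset_isCompact hinf hK inter_subset_right
  rw [accPt_iff_frequently_nhdsNE] at hacc
  obtain ⟨y, h1, h2⟩ := (hacc.and_eventually (h z hz)).exists
  exact h2 h1.1

/-- The zeros are divided out one point at a time, and the multiset records multiplicities. Points
of `S` that are not zeros enter with multiplicity zero. -/
lemma exists_factor_of_finset {V : Set ℂ} (hV : IsOpen V) (S : Finset ℂ) :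
    ∀ g : ℂ → ℂ, DifferentiableOn ℂ g V → (∀ b ∈ S, b ∈ V) →
      (∀ b ∈ S, ¬ ∀ᶠ z in 𝓝 b, g z = 0) →
      ∃ (m : Multiset ℂ) (w : ℂ → ℂ), (∀ b ∈ m, b ∈ S) ∧ DifferentiableOn ℂ w V ∧
        (∀ z ∈ V, g z = (m.map (z - ·)).prod * w z) ∧ ∀ b ∈ S, w b ≠ 0 := by
  classical
  induction S using Finset.induction_on with
  | empty => intro g hg _ _; exact ⟨0, g, by simp, hg, by simp, by simp⟩
  | insert b S hbS ih =>
    intro g hg hSV hS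
    have hbV := hSV b (Finset.mem_insert_self b S)
    have han : AnalyticAt ℂ g b := hg.analyticAt (hV.mem_nhds hbV)
    obtain ⟨n, g₁, hg₁, hg₁0, hgg⟩ :=
      han.exists_eventuallyEq_pow_smul_nonzero_iff.2 (hS b (Finset.mem_insert_self b S))
    set G : ℂ → ℂ := fun z => if z = b then g₁ b else g z / (z - b) ^ n with hG
    have hGb : G =ᶠ[𝓝 b] g₁ := by
      filter_upwards [hgg] with z hz
      by_cases h : z = b
      · simp [hG, h]
      · have : (z - b) ^ n ≠ 0 := pow_ne_zero _ (sub_ne_zero.2 h)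
        simp only [hG, h, if_false, hz, smul_eq_mul]
        field_simp
    have hGV : DifferentiableOn ℂ G V := by
      intro z hz
      by_cases h : z = b
      · subst h
        exact (hg₁.differentiableAt.congr_of_eventuallyEq hGb).differentiableWithinAt
      · have h1 : DifferentiableAt ℂ (fun z => g z / (z - b) ^ n) z :=
          (hg.differentiableAt (hV.mem_nhds hz)).div (by fun_prop)
            (pow_ne_zero _ (sub_ne_zero.2 h))
        refine (h1.congr_of_eventuallyEq ?_).differentiableWithinAt
        filter_upwards [isOpen_ne.mem_nhds h] with y (hy : y ≠ b)
        simp [hG, hy]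
    have hfac : ∀ z ∈ V, g z = (z - b) ^ n * G z := by
      intro z hz
      by_cases h : z = b
      · rw [h, hgg.self_of_nhds, hGb.self_of_nhds, smul_eq_mul]
      · have : (z - b) ^ n ≠ 0 := pow_ne_zero _ (sub_ne_zero.2 h)
        simp only [hG, h, if_false]
        field_simp
    obtain ⟨m, w, h1, h2, h3, h4⟩ := ih G hGV (fun b hb => hSV b (Finset.mem_insert_of_mem hb))
      fun b' hb' h => hS b' (Finset.mem_insert_of_mem hb') (by
        filter_upwards [h, hV.mem_nhds (hSV b' (Finset.mem_insert_of_mem hb'))] with z hz hzV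
        rw [hfac z hzV, hz, mul_zero])
    refine ⟨Multiset.replicate n b + m, w, ?_, h2, ?_, ?_⟩
    · intro b' hb'
      rcases Multiset.mem_add.1 hb' with h | h
      · rw [Multiset.eq_of_mem_replicate h]; exact Finset.mem_insert_self b S
      · exact Finset.mem_insert_of_mem (h1 b' h)
    · intro z hz
      rw [hfac z hz, h3 z hz, Multiset.map_add, Multiset.prod_add, Multiset.map_replicate,
        Multiset.prod_replicate, mul_assoc]
    · intro b' hb'
      rcases Finset.mem_insert.1 hb' with rfl | h
      · intro h0
        have := h3 b' hbV
        rw [h0, mul_zero, hGb.self_of_nhds] at this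
        exact hg₁0 this
      · exact h4 b' h

/-- Nonvanishing on the circle rules out that `g` vanishes identically on the connected set `V`. So
the closed disc contains finitely many zeros, all of them in its interior. -/
lemma exists_factor {V : Set ℂ} (hV : IsOpen V) (hVc : IsPreconnected V) {c : ℂ} {r : ℝ}
    (hr : 0 < r) (hsub : Metric.closedBall c r ⊆ V) {g : ℂ → ℂ} (hg : DifferentiableOn ℂ g V)
    (hg0 : ∀ z ∈ Metric.sphere c r, g z ≠ 0) :
    ∃ (m : Multiset ℂ) (w : ℂ → ℂ), (∀ b ∈ m, b ∈ Metric.ball c r) ∧ DifferentiableOn ℂ w V ∧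
      (∀ z ∈ V, g z = (m.map (z - ·)).prod * w z) ∧ ∀ z ∈ Metric.closedBall c r, w z ≠ 0 := by
  have hnz : ∀ b ∈ V, ¬ ∃ᶠ z in 𝓝[≠] b, g z = 0 := by
    intro b hb h
    have h1 := (hg.analyticOnNhd hV).eqOn_zero_of_preconnected_of_frequently_eq_zero hVc hb h
    obtain ⟨z, hz⟩ := (NormedSpace.sphere_nonempty (x := c) (r := r)).2 hr.le
    exact hg0 z hz (h1 (hsub (Metric.sphere_subset_closedBall hz)))
  have hfin : ({z | g z = 0} ∩ Metric.closedBall c r).Finite :=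
    IsCompact.finite_inter_of_eventually_notMem (isCompact_closedBall c r)
      fun z hz => not_frequently.1 (hnz z (hsub hz))
  have hmem : ∀ b, b ∈ hfin.toFinset ↔ g b = 0 ∧ b ∈ Metric.closedBall c r :=
    fun b => hfin.mem_toFinset
  obtain ⟨m, w, h1, h2, h3, h4⟩ := exists_factor_of_finset hV hfin.toFinset g hg
    (fun b hb => hsub ((hmem b).1 hb).2) fun b hb h =>
      hnz b (hsub ((hmem b).1 hb).2) (h.filter_mono nhdsWithin_le_nhds).frequently
  refine ⟨m, w, fun b hb => ?_, h2, h3, fun z hz h0 => ?_⟩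
  · have h5 := (hmem b).1 (h1 b hb)
    rcases (Metric.mem_closedBall.1 h5.2).lt_or_eq with h | h
    · exact h
    · exact absurd h5.1 (hg0 b h)
  · by_cases hz0 : g z = 0
    · exact h4 z ((hmem z).2 ⟨hz0, hz⟩) h0
    · exact hz0 (by rw [h3 z (hsub hz), h0, mul_zero])

/-- The sum of the values of `h` over the zeros, as a contour integral. -/
lemma circleIntegral_mul_logDeriv {V : Set ℂ} (hV : IsOpen V) {c : ℂ} {r : ℝ} (hr : 0 < r)
    (hsub : Metric.closedBall c r ⊆ V) {w h : ℂ → ℂ} (hw : DifferentiableOn ℂ w V)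
    (hw0 : ∀ z ∈ Metric.closedBall c r, w z ≠ 0) (hh : DifferentiableOn ℂ h V) (m : Multiset ℂ)
    (hm : ∀ b ∈ m, b ∈ Metric.ball c r) :
    ∮ z in C(c, r), h z * logDeriv (fun z => (m.map (z - ·)).prod * w z) z =
      2 * Real.pi * Complex.I * (m.map h).sum := by
  have hprod : ∀ m : Multiset ℂ, DifferentiableOn ℂ (fun z => (m.map (z - ·)).prod * w z) V := by
    intro m
    refine DifferentiableOn.mul ?_ hw
    induction m using Multiset.induction_on with
    | empty => simp
    | cons b m ih =>
      simp only [Multiset.map_cons, Multiset.prod_cons]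
      exact (differentiableOn_id.sub_const b).fun_mul ih
  have hne : ∀ m : Multiset ℂ, (∀ b ∈ m, b ∈ Metric.ball c r) → ∀ z ∈ Metric.sphere c r,
      (m.map (z - ·)).prod * w z ≠ 0 := by
    intro m hm z hz
    refine mul_ne_zero (Multiset.prod_ne_zero fun h => ?_) (hw0 z (Metric.sphere_subset_closedBall
      hz))
    obtain ⟨b, hb, h⟩ := Multiset.mem_map.1 h
    rw [sub_eq_zero] at h
    have h1 := hm b hb
    rw [← h] at h1
    exact (Metric.mem_ball.1 h1).ne hz
  have hcont : ∀ g : ℂ → ℂ, DifferentiableOn ℂ g V → (∀ z ∈ Metric.sphere c r, g z ≠ 0) →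
      ContinuousOn (fun z => h z * logDeriv g z) (Metric.sphere c r) := by
    intro g hg hg0
    have hs : Metric.sphere c r ⊆ V := Metric.sphere_subset_closedBall.trans hsub
    exact (hh.continuousOn.mono hs).mul
      (((hg.deriv hV).continuousOn.mono hs).div (hg.continuousOn.mono hs) hg0)
  induction m using Multiset.induction_on with
  | empty =>
    simp only [Multiset.map_zero, Multiset.prod_zero, one_mul, Multiset.sum_zero, mul_zero]
    have hV' : IsOpen (V ∩ {z | w z ≠ 0}) :=
      hw.continuousOn.isOpen_inter_preimage hV isOpen_ne
    refine circleIntegral_eq_zero_of_differentiableOn hV' hr.le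
      (fun z hz => ⟨hsub hz, hw0 z hz⟩) ?_
    exact (hh.mono inter_subset_left).mul (((hw.deriv hV).mono inter_subset_left).div
      (hw.mono inter_subset_left) fun z hz => hz.2)
  | cons b m ih =>
    have hm' : ∀ b ∈ m, b ∈ Metric.ball c r := fun b hb => hm b (Multiset.mem_cons_of_mem hb)
    have hb := hm b (Multiset.mem_cons_self b m)
    have hsplit : ∀ z ∈ Metric.sphere c r,
        h z * logDeriv (fun z => ((b ::ₘ m).map (z - ·)).prod * w z) z =
        (z - b)⁻¹ • h z + h z * logDeriv (fun z => (m.map (z - ·)).prod * w z) z := by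
      intro z hz
      have hzV := hsub (Metric.sphere_subset_closedBall hz)
      have hzb : z - b ≠ 0 := sub_ne_zero.2 fun h' => (Metric.mem_ball.1 (h' ▸ hb)).ne hz
      have e1 : (fun z => ((b ::ₘ m).map (z - ·)).prod * w z) =
          fun z => (z - b) * ((m.map (z - ·)).prod * w z) := by
        funext z; simp [mul_assoc]
      rw [e1, logDeriv_mul z hzb (hne m hm' z hz) (by fun_prop)
        ((hprod m).differentiableAt (hV.mem_nhds hzV)), mul_add]
      congr 1
      rw [logDeriv_apply, deriv_sub_const_fun, deriv_id'', smul_eq_mul, one_div, mul_comm]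
    rw [circleIntegral.integral_congr hr.le hsplit, circleIntegral.integral_add, ih hm',
      (hh.mono hsub).circleIntegral_sub_inv_smul hb]
    · simp only [smul_eq_mul, Multiset.map_cons, Multiset.sum_cons]; ring
    · refine ContinuousOn.circleIntegrable hr.le (ContinuousOn.smul (ContinuousOn.inv₀
        (continuousOn_id.sub continuousOn_const) fun z hz => ?_) (hh.continuousOn.mono
          (Metric.sphere_subset_closedBall.trans hsub)))
      exact sub_ne_zero.2 (show z ≠ b from fun h' => (Metric.mem_ball.1 (h' ▸ hb)).ne hz)
    · exact (hcont _ (hprod m) (hne m hm')).circleIntegrable hr.le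

/-- Newton's identities for polynomials in finitely many variables, evaluated at an enumeration of
the multiset. -/
lemma multiset_mul_esymm_eq_sum (s : Multiset ℂ) (k : ℕ) :
    k * s.esymm k = (-1) ^ (k + 1) * ∑ a ∈ Finset.HasAntidiagonal.antidiagonal k with a.1 < k,
      (-1) ^ a.1 * s.esymm a.1 * (s.map (· ^ a.2)).sum := by
  set l := s.toList with hl
  have hs : s = Finset.univ.val.map (fun i : Fin l.length => l.get i) := by
    rw [Fin.univ_val_map, List.ofFn_get, hl, Multiset.coe_toList]
  have h := congrArg (MvPolynomial.aeval (R := ℂ) (fun i : Fin l.length => l.get i))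
    (MvPolynomial.mul_esymm_eq_sum (Fin l.length) ℂ k)
  simp only [map_mul, map_natCast, map_pow, map_neg, map_one, map_sum,
    MvPolynomial.aeval_esymm_eq_multiset_esymm, ← hs, MvPolynomial.psum, MvPolynomial.aeval_X] at h
  rw [h]
  congr 1
  refine Finset.sum_congr rfl fun a _ => ?_
  congr 1
  conv_rhs => rw [hs, Multiset.map_map]
  rfl

/-- Elementary symmetric functions are differentiable if the power sums are. -/
lemma differentiableOn_esymm {U : Set ℂ} (s : ℂ → Multiset ℂ)
    (h : ∀ j : ℕ, DifferentiableOn ℂ (fun w => ((s w).map (· ^ j)).sum) U) (k : ℕ) :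
    DifferentiableOn ℂ (fun w => (s w).esymm k) U := by
  induction k using Nat.strong_induction_on with
  | _ k ih =>
    rcases Nat.eq_zero_or_pos k with rfl | hk
    · simp [Multiset.esymm]
    · have hk' : (k : ℂ) ≠ 0 := Nat.cast_ne_zero.2 hk.ne'
      -- Newton's identity is solved for the `k`-th elementary symmetric function. In characteristic
      -- zero, division by `k` is allowed, and only earlier functions and power sums remain.
      have : (fun w => (s w).esymm k) = fun w => (k : ℂ)⁻¹ * ((-1) ^ (k + 1) *
          ∑ a ∈ Finset.HasAntidiagonal.antidiagonal k with a.1 < k,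
            (-1) ^ a.1 * (s w).esymm a.1 * ((s w).map (· ^ a.2)).sum) := by
        funext w
        rw [← multiset_mul_esymm_eq_sum, inv_mul_cancel_left₀ hk']
      rw [this]
      refine (DifferentiableOn.fun_sum fun a ha => ?_).const_mul _ |>.const_mul _
      exact ((ih a.1 (Finset.mem_filter.1 ha).2).const_mul _).mul (h a.2)

end SepMer


/-! ### Elimination of one variable -/

namespace SepMer

lemma continuousOn_circleIntegral {X E : Type*} [TopologicalSpace X] [NormedAddCommGroup E]
    [NormedSpace ℂ E] {A : Set X} {c : ℂ} {r : ℝ} (hr : 0 ≤ r) {φ : X × ℂ → E}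
    (hφ : ContinuousOn φ (A ×ˢ Metric.sphere c r)) :
    ContinuousOn (fun x => ∮ z in C(c, r), φ (x, z)) A := by
  rw [continuousOn_iff_continuous_domRestrict]
  refine intervalIntegral.continuous_parametric_intervalIntegral_of_continuous'
    (f := fun (x : A) θ => deriv (circleMap c r) θ • φ (x, circleMap c r θ)) ?_ 0 (2 * Real.pi)
  refine Continuous.smul ?_ ?_
  · simp only [deriv_circleMap]
    fun_prop
  · refine hφ.comp_continuous (f := fun q : A × ℝ => ((q.1 : X), circleMap c r q.2)) (by
      fun_prop) ?_
    exact fun q => ⟨q.1.2, circleMap_mem_sphere c hr q.2⟩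

lemma DifferentiableOn.differentiableOn_slice_right {X : Type*} [NormedAddCommGroup X] [NormedSpace
    ℂ X]
    {D : ℂ × ℂ → X} {U V : Set ℂ}
    (hD : DifferentiableOn ℂ D (U ×ˢ V)) {w : ℂ} (hw : w ∈ U) :
    DifferentiableOn ℂ (fun z => D (w, z)) V :=
  hD.comp ((differentiableOn_const w).prodMk differentiableOn_id) fun _ hz => ⟨hw, hz⟩

lemma DifferentiableOn.differentiableOn_slice_left {X : Type*} [NormedAddCommGroup X] [NormedSpace
    ℂ X]
    {D : ℂ × ℂ → X} {U V : Set ℂ}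
    (hD : DifferentiableOn ℂ D (U ×ˢ V)) {z : ℂ} (hz : z ∈ V) :
    DifferentiableOn ℂ (fun w => D (w, z)) U :=
  hD.comp (differentiableOn_id.prodMk (differentiableOn_const z)) fun _ hw => ⟨hw, hz⟩

section
variable {U : Set ℂ} {p : ℂ} {r ρ : ℝ} {D : ℂ × ℂ → ℂ}

/-- Cauchy's formula on a fixed circle reduces regularity of the `z`-derivative in both variables to
regularity of an integral with parameters. -/
lemma eqOn_deriv_slice (hrρ : r < ρ) (hD : DifferentiableOn ℂ D (U ×ˢ Metric.ball p ρ)) {w z : ℂ}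
    (hw : w ∈ U)
    (hz : z ∈ Metric.ball p r) :
    deriv (fun z => D (w, z)) z =
      (2 * Real.pi * Complex.I : ℂ)⁻¹ • ∮ ζ in C(p, r), ((ζ - z) ^ 2)⁻¹ • D (w, ζ) :=
  (Complex.two_pi_I_inv_smul_circleIntegral_sub_sq_inv_smul_of_differentiable Metric.isOpen_ball
    (Metric.closedBall_subset_ball hrρ)
    (DifferentiableOn.differentiableOn_slice_right hD hw) hz).symm

lemma continuousOn_deriv_slice (hD : DifferentiableOn ℂ D (U ×ˢ Metric.ball p ρ))
    (hr : 0 < r) (hrρ : r < ρ) :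
    ContinuousOn (fun q : ℂ × ℂ => deriv (fun z => D (q.1, z)) q.2) (U ×ˢ Metric.ball p r) := by
  refine ContinuousOn.congr (f := fun q : ℂ × ℂ => (2 * Real.pi * Complex.I : ℂ)⁻¹ •
    ∮ ζ in C(p, r), ((ζ - q.2) ^ 2)⁻¹ • D (q.1, ζ)) (ContinuousOn.fun_const_smul ?_ _)
    fun q hq => eqOn_deriv_slice hrρ hD hq.1 hq.2
  refine continuousOn_circleIntegral hr.le
    (φ := fun q : (ℂ × ℂ) × ℂ => ((q.2 - q.1.2) ^ 2)⁻¹ • D (q.1.1, q.2)) ?_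
  refine ContinuousOn.smul (ContinuousOn.inv₀
    (f := fun q : (ℂ × ℂ) × ℂ => (q.2 - q.1.2) ^ 2) (by fun_prop) ?_) ?_
  · rintro ⟨⟨w, z⟩, ζ⟩ ⟨hq, hζ⟩
    refine pow_ne_zero _ (sub_ne_zero.2 fun h => ?_)
    have := hq.2
    simp only at h this
    rw [← h] at this
    exact (Metric.mem_ball.1 this).ne hζ
  · refine hD.continuousOn.comp (by fun_prop) ?_
    rintro ⟨⟨w, z⟩, ζ⟩ ⟨hq, hζ⟩
    exact ⟨hq.1, Metric.sphere_subset_closedBall.trans (Metric.closedBall_subset_ball hrρ) hζ⟩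

lemma differentiableOn_deriv_slice (hU : IsOpen U) (hD : DifferentiableOn ℂ D (U ×ˢ Metric.ball p
    ρ))
    (hr : 0 < r) (hrρ : r < ρ) {z : ℂ} (hz : z ∈ Metric.ball p r) :
    DifferentiableOn ℂ (fun w => deriv (fun z => D (w, z)) z) U := by
  refine DifferentiableOn.congr (f := fun w => (2 * Real.pi * Complex.I : ℂ)⁻¹ •
    ∮ ζ in C(p, r), ((ζ - z) ^ 2)⁻¹ • D (w, ζ)) (DifferentiableOn.fun_const_smul ?_ _)
    fun w hw => eqOn_deriv_slice hrρ hD hw hz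
  have hs : Metric.sphere p r ⊆ Metric.ball p ρ :=
    Metric.sphere_subset_closedBall.trans (Metric.closedBall_subset_ball hrρ)
  refine differentiableOn_circleIntegral hU hr.le
    (φ := fun q : ℂ × ℂ => ((q.2 - z) ^ 2)⁻¹ • D (q.1, q.2)) ?_ fun ζ hζ => ?_
  · refine ContinuousOn.smul (ContinuousOn.inv₀ (f := fun q : ℂ × ℂ => (q.2 - z) ^ 2)
      (by fun_prop) fun q hq => ?_) (hD.continuousOn.mono (prod_mono_right hs))
    exact pow_ne_zero _ (sub_ne_zero.2 fun h => (Metric.mem_ball.1 (h ▸ hz)).ne hq.2)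
  · exact DifferentiableOn.fun_const_smul (DifferentiableOn.differentiableOn_slice_left hD (hs hζ))
      (((ζ - z) ^ 2)⁻¹)

end

lemma eventually_forall_sphere_ne_zero {W : Set (ℂ × ℂ)} (hW : IsOpen W) {K : Set ℂ} (hK :
    IsCompact K)
    {w₀ : ℂ} {X : ℂ × ℂ → ℂ} (hX : ContinuousOn X W) (hKW : ∀ z ∈ K, (w₀, z) ∈ W)
    (h0 : ∀ z ∈ K, X (w₀, z) ≠ 0) : ∀ᶠ w in 𝓝 w₀, ∀ z ∈ K, X (w, z) ≠ 0 := by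
  refine hK.eventually_forall_of_forall_eventually (P := fun w z => X (w, z) ≠ 0) fun z hz => ?_
  exact (hX.continuousAt (hW.mem_nhds (hKW z hz))).eventually (isOpen_ne.mem_nhds (h0 z hz))

/-- Elimination of `z` from the equations `X₁ (w, z) = X₂ (w, z) = 0`: a holomorphic combination
`f` of `X₁` and `X₂` which only depends on `w` and vanishes precisely when they have a common zero
in the disc. -/
theorem exists_elimination {w₀ p : ℂ} {r ρ : ℝ} (hr : 0 < r) (hrρ : r < ρ) {X₁ X₂ : ℂ × ℂ → ℂ}
    (h₁ : DifferentiableOn ℂ X₁ (Metric.ball w₀ ρ ×ˢ Metric.ball p ρ))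
    (h₂ : DifferentiableOn ℂ X₂ (Metric.ball w₀ ρ ×ˢ Metric.ball p ρ))
    (h0 : ∀ z ∈ Metric.sphere p r, X₁ (w₀, z) ≠ 0) :
    ∃ δ > 0, δ ≤ ρ ∧ ∃ (f : ℂ → ℂ) (χ : ℂ × ℂ → ℂ), DifferentiableOn ℂ f (Metric.ball w₀ δ) ∧
      DifferentiableOn ℂ χ (Metric.ball w₀ δ ×ˢ Metric.ball p ρ) ∧
      ∀ w ∈ Metric.ball w₀ δ,
        (f w = 0 ↔ ∃ z ∈ Metric.closedBall p r, X₁ (w, z) = 0 ∧ X₂ (w, z) = 0) ∧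
        (∃ (V : Set ℂ) (v : ℂ → ℂ), IsOpen V ∧ Metric.closedBall p r ⊆ V ∧ V ⊆ Metric.ball p ρ ∧
          DifferentiableOn ℂ v V ∧ ∀ z ∈ V, χ (w, z) = X₁ (w, z) * v z) ∧
        ∃ u : ℂ → ℂ, DifferentiableOn ℂ u (Metric.ball p ρ) ∧
          ∀ z ∈ Metric.ball p ρ, f w - χ (w, z) = X₂ (w, z) * u z := by
  have hρ : 0 < ρ := hr.trans hrρ
  have hsub : Metric.closedBall p r ⊆ Metric.ball p ρ := Metric.closedBall_subset_ball hrρ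
  have hs : Metric.sphere p r ⊆ Metric.ball p ρ := Metric.sphere_subset_closedBall.trans hsub
  have hev := eventually_forall_sphere_ne_zero (Metric.isOpen_ball.prod Metric.isOpen_ball)
    (isCompact_sphere p r) h₁.continuousOn
    (fun z hz => ⟨Metric.mem_ball_self hρ, hs hz⟩) h0
  obtain ⟨δ₁, hδ₁, hδ₁'⟩ := Metric.nhds_basis_ball.mem_iff.1
    (hev.and (Metric.ball_mem_nhds w₀ hρ))
  have hU0 : ∀ w ∈ Metric.ball w₀ δ₁, ∀ z ∈ Metric.sphere p r, X₁ (w, z) ≠ 0 :=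
    fun w hw => (hδ₁' hw).1
  have hUρ : Metric.ball w₀ δ₁ ⊆ Metric.ball w₀ ρ := fun w hw => (hδ₁' hw).2
  have hX₁ : ∀ w ∈ Metric.ball w₀ δ₁, DifferentiableOn ℂ (fun z => X₁ (w, z)) (Metric.ball p ρ) :=
    fun w hw => DifferentiableOn.differentiableOn_slice_right h₁ (hUρ hw)
  have hX₂ : ∀ w ∈ Metric.ball w₀ δ₁, DifferentiableOn ℂ (fun z => X₂ (w, z)) (Metric.ball p ρ) :=
    fun w hw => DifferentiableOn.differentiableOn_slice_right h₂ (hUρ hw)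
  have hfac : ∀ w ∈ Metric.ball w₀ δ₁, ∃ (m : Multiset ℂ) (W : ℂ → ℂ),
      (∀ b ∈ m, b ∈ Metric.ball p r) ∧ DifferentiableOn ℂ W (Metric.ball p ρ) ∧
      (∀ z ∈ Metric.ball p ρ, X₁ (w, z) = (m.map (z - ·)).prod * W z) ∧
      ∀ z ∈ Metric.closedBall p r, W z ≠ 0 := fun w hw =>
    exists_factor Metric.isOpen_ball (convex_ball p ρ).isPreconnected hr hsub (hX₁ w hw) (hU0 w hw)
  choose! m W hm hW hmW hW0 using hfac
  -- The values of `X₂ (w, ·)` at the zeros of `X₁ (w, ·)` in the disc. The zeros need not depend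
  -- holomorphically on `w`, but the symmetric functions of these values do.
  set s : ℂ → Multiset ℂ := fun w => (m w).map fun b => X₂ (w, b) with hsdef
  have hpsum : ∀ j : ℕ, DifferentiableOn ℂ (fun w => ((s w).map (· ^ j)).sum) (Metric.ball w₀ δ₁)
      := by
    intro j
    set φ : ℂ × ℂ → ℂ := fun q => X₂ q ^ j * (deriv (fun z => X₁ (q.1, z)) q.2 / X₁ q) with hφ
    obtain ⟨r', hr', hr'ρ⟩ := exists_between hrρ
    have hsr' : Metric.sphere p r ⊆ Metric.ball p r' :=
      Metric.sphere_subset_closedBall.trans (Metric.closedBall_subset_ball hr')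
    -- The power sums are integrals of `X₂ ^ j` against the logarithmic derivative of `X₁` over a
    -- circle on which `X₁` does not vanish.
    have hint : ∀ w ∈ Metric.ball w₀ δ₁, ((s w).map (· ^ j)).sum =
        (2 * Real.pi * Complex.I : ℂ)⁻¹ * ∮ z in C(p, r), φ (w, z) := by
      intro w hw
      have h3 := circleIntegral_mul_logDeriv Metric.isOpen_ball hr hsub (hW w hw) (hW0 w hw)
        ((hX₂ w hw).fun_pow j) (m w) (hm w hw)
      have h4 : ∮ z in C(p, r), φ (w, z) = ∮ z in C(p, r), X₂ (w, z) ^ j *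
          logDeriv (fun z => ((m w).map (z - ·)).prod * W w z) z := by
        refine circleIntegral.integral_congr hr.le fun z hz => ?_
        have h5 : (fun z => X₁ (w, z)) =ᶠ[𝓝 z] fun z => ((m w).map (z - ·)).prod * W w z := by
          filter_upwards [Metric.isOpen_ball.mem_nhds (hs hz)] with y hy
          exact hmW w hw y hy
        simp only [hφ, logDeriv_apply]
        rw [h5.deriv_eq, ← hmW w hw z (hs hz)]
      have hpi : (2 * Real.pi * Complex.I : ℂ) ≠ 0 := Complex.two_pi_I_ne_zero
      rw [h4, h3, inv_mul_cancel_left₀ hpi, hsdef, Multiset.map_map]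
      rfl
    refine DifferentiableOn.congr (DifferentiableOn.const_mul ?_ _) hint
    have hprod : Metric.ball w₀ δ₁ ×ˢ Metric.sphere p r ⊆ Metric.ball w₀ ρ ×ˢ Metric.ball p ρ :=
      prod_mono hUρ hs
    refine differentiableOn_circleIntegral Metric.isOpen_ball hr.le ?_ fun z hz => ?_
    · refine ((h₂.continuousOn.mono hprod).pow j).mul (ContinuousOn.div ?_
        (h₁.continuousOn.mono hprod) fun q hq => hU0 q.1 hq.1 q.2 hq.2)
      exact (continuousOn_deriv_slice h₁ (hr.trans hr') hr'ρ).mono (prod_mono hUρ hsr')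
    · refine DifferentiableOn.mul (((DifferentiableOn.differentiableOn_slice_left h₂
        (hs hz)).mono hUρ).fun_pow j) (DifferentiableOn.div ?_
        ((DifferentiableOn.differentiableOn_slice_left h₁ (hs hz)).mono hUρ)
        fun w hw => hU0 w hw z hz)
      exact (differentiableOn_deriv_slice Metric.isOpen_ball h₁ (hr.trans hr') hr'ρ
        (hsr' hz)).mono hUρ
  have hesymm := differentiableOn_esymm s hpsum
  set n := (s w₀).card with hn
  -- The zeroth power sum is the number of zeros, which is continuous and integer-valued, hence
  -- locally constant. This gives the polynomials `P w` a common degree.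
  have hcard : ∀ᶠ w in 𝓝 w₀, (s w).card = n := by
    have h3 : ContinuousAt (fun w => ((s w).map (· ^ 0)).sum) w₀ :=
      ((hpsum 0).differentiableAt (Metric.ball_mem_nhds w₀ hδ₁)).continuousAt
    simp only [pow_zero, Multiset.map_const', Multiset.sum_replicate, nsmul_eq_mul, mul_one] at h3
    filter_upwards [h3 (Metric.ball_mem_nhds _ one_pos)] with w hw
    have h4 : dist ((s w).card : ℂ) (s w₀).card < 1 := hw
    rw [dist_eq_norm] at h4
    have h5 : ‖(((s w).card - (s w₀).card : ℤ) : ℂ)‖ < 1 := by push_cast; exact h4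
    rw [Complex.norm_intCast] at h5
    have h6 : |((s w).card : ℤ) - (s w₀).card| < 1 := by exact_mod_cast h5
    have := Int.abs_lt_one_iff.1 h6
    omega
  obtain ⟨δ, hδ, hδ'⟩ := Metric.nhds_basis_ball.mem_iff.1
    (hcard.and (Metric.ball_mem_nhds w₀ hδ₁))
  have hδδ₁ : Metric.ball w₀ δ ⊆ Metric.ball w₀ δ₁ := fun w hw => (hδ' hw).2
  set P : ℂ → Polynomial ℂ := fun w => ((s w).map fun y => Polynomial.X + Polynomial.C y).prod
    with hP
  have hPeval : ∀ w y, (P w).eval y = ((s w).map fun a => y + a).prod := by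
    intro w y
    rw [hP, Polynomial.eval_multiset_prod, Multiset.map_map]
    simp
  have hPsum : ∀ w ∈ Metric.ball w₀ δ, ∀ y, (P w).eval y =
      ∑ j ∈ Finset.range (n + 1), (s w).esymm j * y ^ (n - j) := by
    intro w hw y
    have : (s w).card = n := (hδ' hw).1
    simp only [hP]
    rw [Multiset.prod_X_add_C_eq_sum_esymm, this, Polynomial.eval_finsetSum]
    simp
  -- With `b` running over the zeros of `X₁ (w, ·)`, these are `f w = ∏ X₂ (w, b)` and `χ (w, z) = ∏
  -- (X₂ (w, b) - X₂ (w, z))`. Each factor of `χ` is divisible by `z - b`, so `χ` is divisible by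
  -- `X₁`. The difference `f - χ` is a polynomial in `X₂` without constant term, so it is divisible
  -- by `X₂`.
  refine ⟨min δ ρ, lt_min hδ hρ, min_le_right _ _, fun w => (P w).eval 0,
    fun q => (P q.1).eval (-X₂ q), ?_, ?_, fun w hw => ?_⟩
  · refine DifferentiableOn.congr (f := fun w => ∑ j ∈ Finset.range (n + 1),
      (s w).esymm j * 0 ^ (n - j)) (DifferentiableOn.fun_sum fun j _ =>
        ((hesymm j).mono ((Metric.ball_subset_ball (min_le_left _ _)).trans hδδ₁)).mul_const _)
      fun w hw => hPsum w (Metric.ball_subset_ball (min_le_left _ _) hw) 0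
  · refine DifferentiableOn.congr (f := fun q : ℂ × ℂ => ∑ j ∈ Finset.range (n + 1),
      (s q.1).esymm j * (-X₂ q) ^ (n - j)) (DifferentiableOn.fun_sum fun j _ => ?_)
      fun q hq => hPsum q.1 (Metric.ball_subset_ball (min_le_left _ _) hq.1) _
    refine DifferentiableOn.mul (((hesymm j).mono ((Metric.ball_subset_ball
      (min_le_left _ _)).trans hδδ₁)).comp differentiableOn_fst fun q hq => hq.1) ?_
    exact ((h₂.mono (prod_mono_left (Metric.ball_subset_ball (min_le_right _ _)))).fun_neg).fun_pow
      _
  · replace hw : w ∈ Metric.ball w₀ δ₁ := hδδ₁ (Metric.ball_subset_ball (min_le_left _ _) hw)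
    -- Divisibility by `X₁` is obtained only where the zero-free factor `W` is invertible: an open
    -- set depending on `w`, but containing the closed disc.
    refine ⟨?_, ⟨Metric.ball p ρ ∩ {z | W w z ≠ 0},
      fun z => ((m w).map fun b => -dslope (fun z => X₂ (w, z)) b z).prod / W w z,
      (hW w hw).continuousOn.isOpen_inter_preimage Metric.isOpen_ball isOpen_ne,
      fun z hz => ⟨hsub hz, hW0 w hw z hz⟩, inter_subset_left, ?_, ?_⟩, ?_⟩
    · dsimp only
      rw [hPeval, Multiset.prod_eq_zero_iff, hsdef]
      simp only [Multiset.mem_map, zero_add, exists_exists_and_eq_and]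
      constructor
      · rintro ⟨b, hb, hb0⟩
        have hbr := hm w hw b hb
        refine ⟨b, Metric.ball_subset_closedBall hbr, ?_, hb0⟩
        rw [hmW w hw b (hsub (Metric.ball_subset_closedBall hbr)), mul_eq_zero]
        exact Or.inl (Multiset.prod_eq_zero (Multiset.mem_map.2 ⟨b, hb, sub_self b⟩))
      · rintro ⟨z, hz, hz1, hz2⟩
        rw [hmW w hw z (hsub hz), mul_eq_zero, or_iff_left (hW0 w hw z hz),
          Multiset.prod_eq_zero_iff] at hz1
        obtain ⟨b, hb, hb0⟩ := Multiset.mem_map.1 hz1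
        exact ⟨b, hb, sub_eq_zero.1 hb0 ▸ hz2⟩
    · refine DifferentiableOn.div ?_ ((hW w hw).mono inter_subset_left) fun z hz => hz.2
      refine DifferentiableOn.mono ?_ (inter_subset_left (s := Metric.ball p ρ))
      have hbV : ∀ b ∈ m w, b ∈ Metric.ball p ρ := fun b hb =>
        hsub (Metric.ball_subset_closedBall (hm w hw b hb))
      generalize m w = M at hbV
      induction M using Multiset.induction_on with
      | empty => simp
      | cons b M ih =>
        simp only [Multiset.map_cons, Multiset.prod_cons]
        refine DifferentiableOn.fun_mul (DifferentiableOn.fun_neg ?_)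
          (ih fun b hb => hbV b (Multiset.mem_cons_of_mem hb))
        exact (Complex.differentiableOn_dslope (Metric.isOpen_ball.mem_nhds
          (hbV b (Multiset.mem_cons_self b M)))).2 (hX₂ w hw)
    · intro z hz
      have hz0 : W w z ≠ 0 := hz.2
      dsimp only
      rw [hPeval, hmW w hw z hz.1, mul_assoc, mul_div_cancel₀ _ hz0, ← Multiset.prod_map_mul,
        hsdef, Multiset.map_map]
      congr 1
      refine Multiset.map_congr rfl fun b _ => ?_
      have := sub_smul_dslope (fun z => X₂ (w, z)) b z
      rw [smul_eq_mul] at this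
      simp only [Function.comp_apply]
      rw [mul_neg, this]
      ring
    · refine ⟨fun z => (P w).divX.eval (-X₂ (w, z)),
        (Polynomial.differentiable (P w).divX).comp_differentiableOn (hX₂ w hw).fun_neg, fun z _ =>
          ?_⟩
      dsimp only
      have h3 := Polynomial.divX_mul_X_add (P w)
      have h4 : ∀ y, (P w).eval y = (P w).divX.eval y * y + (P w).coeff 0 := fun y => by
        conv_lhs => rw [← h3]
        simp
      rw [h4 0, h4 (-X₂ (w, z))]
      ring

end SepMer


/-! ### Replacing the factors by truncated principal parts -/

namespace SepMer

section
variable {E₁ E₂ E : Type*} [NormedAddCommGroup E₁] [NormedSpace ℂ E₁] [NormedAddCommGroup E₂]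
  [NormedSpace ℂ E₂] [NormedAddCommGroup E] [NormedSpace ℂ E]

/-- Replacing the two factors `R₁`, `R₂` of a product by approximations `Q₁`, `Q₂` of their
principal parts. -/
lemma norm_circleIntegral_sub_le (T : E₁ →L[ℂ] E₂ →L[ℂ] E) {c : ℂ} {r B ε : ℝ} (hr : 0 ≤ r)
    {f : ℂ} {χ : ℂ → ℂ} {R₁ H₁ Q₁ : ℂ → E₁} {R₂ H₂ Q₂ : ℂ → E₂}
    (cχ : ContinuousOn χ (Metric.sphere c r))
    (cR₁ : ContinuousOn R₁ (Metric.sphere c r)) (cR₂ : ContinuousOn R₂ (Metric.sphere c r))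
    (cH₁ : ContinuousOn H₁ (Metric.sphere c r)) (cH₂ : ContinuousOn H₂ (Metric.sphere c r))
    (cQ₁ : ContinuousOn Q₁ (Metric.sphere c r)) (cQ₂ : ContinuousOn Q₂ (Metric.sphere c r))
    (i₁ : ∮ z in C(c, r), (f - χ z) • T (H₁ z) (R₂ z) = 0)
    (i₂ : ∮ z in C(c, r), χ z • T (R₁ z) (H₂ z) = 0)
    (i₃ : ∮ z in C(c, r), χ z • T (H₁ z) (H₂ z) = 0)
    (bf : ‖f‖ ≤ B) (bχ : ∀ z ∈ Metric.sphere c r, ‖χ z‖ ≤ B)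
    (bR₂ : ∀ z ∈ Metric.sphere c r, ‖R₂ z‖ ≤ B) (bH₂ : ∀ z ∈ Metric.sphere c r, ‖H₂ z‖ ≤ B)
    (bQ₁ : ∀ z ∈ Metric.sphere c r, ‖Q₁ z‖ ≤ B)
    (e₁ : ∀ z ∈ Metric.sphere c r, ‖R₁ z - H₁ z - Q₁ z‖ ≤ ε)
    (e₂ : ∀ z ∈ Metric.sphere c r, ‖R₂ z - H₂ z - Q₂ z‖ ≤ ε) :
    ‖(∮ z in C(c, r), (f - χ z) • T (R₁ z) (R₂ z)) - ∮ z in C(c, r), (f - χ z) • T (Q₁ z) (Q₂ z)‖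
      ≤ 2 * Real.pi * r * (‖T‖ * (5 * B ^ 2 * ε + ‖f‖ * B ^ 2)) := by
  have cT : ∀ {F : ℂ → E₁} {G : ℂ → E₂}, ContinuousOn F (Metric.sphere c r) →
      ContinuousOn G (Metric.sphere c r) →
      ContinuousOn (fun z => T (F z) (G z)) (Metric.sphere c r) := fun hF hG =>
    (T.continuous.comp_continuousOn hF).clm_apply hG
  have cf : ContinuousOn (fun z => f - χ z) (Metric.sphere c r) := continuousOn_const.sub cχ
  have ha : CircleIntegrable (fun z => (f - χ z) • T (R₁ z) (R₂ z)) c r :=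
    (cf.smul (cT cR₁ cR₂)).circleIntegrable hr
  have hb : CircleIntegrable (fun z => (f - χ z) • T (Q₁ z) (Q₂ z)) c r :=
    (cf.smul (cT cQ₁ cQ₂)).circleIntegrable hr
  have hc : CircleIntegrable (fun z => (f - χ z) • T (H₁ z) (R₂ z)) c r :=
    (cf.smul (cT cH₁ cR₂)).circleIntegrable hr
  have hd : CircleIntegrable (fun z => χ z • T (R₁ z) (H₂ z)) c r :=
    (cχ.smul (cT cR₁ cH₂)).circleIntegrable hr
  have he : CircleIntegrable (fun z => χ z • T (H₁ z) (H₂ z)) c r :=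
    (cχ.smul (cT cH₁ cH₂)).circleIntegrable hr
  have hab : CircleIntegrable (fun z => (f - χ z) • T (R₁ z) (R₂ z) -
    (f - χ z) • T (Q₁ z) (Q₂ z)) c r := ha.sub hb
  have hde : CircleIntegrable (fun z => χ z • T (R₁ z) (H₂ z) - χ z • T (H₁ z) (H₂ z)) c r :=
    hd.sub he
  have habc : CircleIntegrable (fun z => (f - χ z) • T (R₁ z) (R₂ z) -
    (f - χ z) • T (Q₁ z) (Q₂ z) - (f - χ z) • T (H₁ z) (R₂ z)) c r := hab.sub hc
  -- Subtracting the three vanishing integrals in this combination cancels the products `χ T Q₁ H₂`.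
  -- What remains has either a remainder `Rⱼ - Hⱼ - Qⱼ` as a factor or is `f T Q₁ H₂`, which is
  -- harmless after division by `f`.
  have key : (∮ z in C(c, r), (f - χ z) • T (R₁ z) (R₂ z)) -
      (∮ z in C(c, r), (f - χ z) • T (Q₁ z) (Q₂ z)) =
      ∮ z in C(c, r), ((f - χ z) • T (R₁ z - H₁ z - Q₁ z) (R₂ z) +
        (f - χ z) • T (Q₁ z) (R₂ z - H₂ z - Q₂ z) + f • T (Q₁ z) (H₂ z) +
        χ z • T (R₁ z - H₁ z - Q₁ z) (H₂ z)) := by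
    calc _ = ((∮ z in C(c, r), (f - χ z) • T (R₁ z) (R₂ z)) -
          (∮ z in C(c, r), (f - χ z) • T (Q₁ z) (Q₂ z)) -
          ∮ z in C(c, r), (f - χ z) • T (H₁ z) (R₂ z)) +
          ((∮ z in C(c, r), χ z • T (R₁ z) (H₂ z)) - ∮ z in C(c, r), χ z • T (H₁ z) (H₂ z)) := by
          rw [i₁, i₂, i₃, sub_zero, sub_zero, add_zero]
      _ = _ := by
        rw [← circleIntegral.integral_sub ha hb, ← circleIntegral.integral_sub hab hc,
          ← circleIntegral.integral_sub hd he, ← circleIntegral.integral_add habc hde]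
        congr 1
        funext z
        simp only [map_sub, sub_apply]
        module
  have hB : 0 ≤ B := (norm_nonneg _).trans bf
  rw [key]
  refine circleIntegral.norm_integral_le_of_norm_le_const hr fun z hz => ?_
  have hε : 0 ≤ ε := (norm_nonneg _).trans (e₁ z hz)
  have hT : ∀ a b {α β : ℝ}, ‖a‖ ≤ α → ‖b‖ ≤ β → ‖T a b‖ ≤ ‖T‖ * α * β := by
    intro a b α β h1 h2
    refine (T.le_opNorm₂ a b).trans ?_
    have := (norm_nonneg a).trans h1
    gcongr
  have hfχ : ‖f - χ z‖ ≤ 2 * B := (norm_sub_le _ _).trans (by linarith [bχ z hz])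
  have s : ∀ (a : ℂ) (x : E) {α β : ℝ}, ‖a‖ ≤ α → ‖x‖ ≤ β → ‖a • x‖ ≤ α * β := by
    intro a x α β h1 h2
    rw [norm_smul]
    exact mul_le_mul h1 h2 (norm_nonneg _) ((norm_nonneg a).trans h1)
  calc _ ≤ 2 * B * (‖T‖ * ε * B) + 2 * B * (‖T‖ * B * ε) + ‖f‖ * (‖T‖ * B * B) +
        B * (‖T‖ * ε * B) :=
      (norm_add_le _ _).trans (add_le_add ((norm_add_le _ _).trans (add_le_add ((norm_add_le _
        _).trans
        (add_le_add (s _ _ hfχ (hT _ _ (e₁ z hz) (bR₂ z hz)))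
          (s _ _ hfχ (hT _ _ (bQ₁ z hz) (e₂ z hz)))))
          (s _ _ le_rfl (hT _ _ (bQ₁ z hz) (bH₂ z hz)))))
          (s _ _ (bχ z hz) (hT _ _ (e₁ z hz) (bH₂ z hz))))
    _ = _ := by ring

end

open scoped Nat in
/-- The Taylor polynomial in `w` of a family with poles of finite rank, decomposed into a part
holomorphic in `z` near `p` and a principal part of finite rank. -/
lemma exists_truncation {E : Type*} [NormedAddCommGroup E] [NormedSpace ℂ E] [CompleteSpace E]
    {Z : Set (ℂ × ℂ)} {R : ℂ × ℂ → E →L[ℂ] E} (hfin : HasPolesOfFiniteRank Z R) {w₀ p : ℂ}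
    (hp : (w₀, p) ∈ Z) (m : ℕ) :
    ∃ ρ > 0, ∃ (I : Finset (Σ _ : ℕ, ℕ)) (A : (Σ _ : ℕ, ℕ) → E →L[ℂ] E) (H : ℂ × ℂ → E →L[ℂ] E),
      (∀ x, FiniteDimensional ℂ (LinearMap.range (A x).toLinearMap)) ∧
      ContinuousOn H (univ ×ˢ Metric.ball p ρ) ∧
      (∀ w, DifferentiableOn ℂ (fun z => H (w, z)) (Metric.ball p ρ)) ∧
      ∀ z ∈ Metric.ball p ρ, z ≠ p → ∀ w : ℂ,
        ∑ k ∈ Finset.range m, (w - w₀) ^ k •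
          ((k ! : ℂ)⁻¹ • iteratedDeriv k (fun w => R (w, z)) w₀) =
        H (w, z) + ∑ x ∈ I, ((w - w₀) ^ x.1 * ((z - p) ^ x.2)⁻¹) • A x := by
  have h := fun k => (hfin _ hp k).const_smul ((k ! : ℂ)⁻¹)
  -- The finite rank hypothesis is applied to each Taylor coefficient in `w` separately. Since only
  -- `k < m` matter, a common radius in `z` exists.
  choose N A h hh hA hk using h
  have h1 : ∀ᶠ z in 𝓝 p, ∀ k ∈ Finset.range m, AnalyticAt ℂ (h k) z := by
    rw [eventually_all_finset]
    exact fun k _ => (hh k).eventually_analyticAt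
  have h2 : ∀ᶠ z in 𝓝 p, ∀ k ∈ Finset.range m, z ≠ p →
      (k ! : ℂ)⁻¹ • iteratedDeriv k (fun w => R (w, z)) w₀ =
        h k z + ∑ j ∈ Finset.Icc 1 (N k), ((z - p) ^ j)⁻¹ • A k j := by
    rw [eventually_all_finset]
    exact fun k _ => eventually_nhdsWithin_iff.1 (hk k)
  obtain ⟨ρ, hρ, hρ'⟩ := Metric.nhds_basis_ball.mem_iff.1 (h1.and h2)
  have hd : ∀ k ∈ Finset.range m, DifferentiableOn ℂ (h k) (Metric.ball p ρ) := fun k hk z hz =>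
    ((hρ' hz).1 k hk).differentiableAt.differentiableWithinAt
  refine ⟨ρ, hρ, (Finset.range m).sigma fun k => Finset.Icc 1 (N k), fun x => A x.1 x.2,
    fun q => ∑ k ∈ Finset.range m, (q.1 - w₀) ^ k • h k q.2, fun x => hA _ _, ?_, ?_, ?_⟩
  · refine continuousOn_finsetSum _ fun k hk =>
      ContinuousOn.smul (f := fun q : ℂ × ℂ => (q.1 - w₀) ^ k) (by fun_prop) ?_
    exact (hd k hk).continuousOn.comp continuousOn_snd fun q hq => hq.2
  · exact fun w => DifferentiableOn.fun_sum fun k hk =>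
      (hd k hk).fun_const_smul ((w - w₀) ^ k)
  · intro z hz hzp w
    rw [Finset.sum_sigma, ← Finset.sum_add_distrib]
    refine Finset.sum_congr rfl fun k hk => ?_
    rw [(hρ' hz).2 k hk hzp, smul_add, Finset.smul_sum]
    simp only [smul_smul]

/-- The quantifier over large `B` comes first, so that several bounds can later be met by one
constant. -/
lemma eventually_bound {E : Type*} [NormedAddCommGroup E] {U K : Set ℂ} (hK : IsCompact K)
    (hU : IsOpen U) {φ : ℂ × ℂ → E} (hφ : ContinuousOn φ (U ×ˢ K)) {w₀ : ℂ} (hw₀ : w₀ ∈ U) :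
    ∀ᶠ B : ℝ in atTop, ∀ᶠ w in 𝓝 w₀, ∀ z ∈ K, ‖φ (w, z)‖ ≤ B := by
  obtain ⟨r, hr, -, B₀, hB⟩ := exists_ball_bound hK hU hφ hw₀
  filter_upwards [eventually_ge_atTop B₀] with B h
  filter_upwards [Metric.closedBall_mem_nhds w₀ hr] with w hw z hz
  exact (hB w hw z hz).trans h

open scoped Nat in
lemma eventually_norm_sub_taylor_le {E : Type*} [NormedAddCommGroup E] [NormedSpace ℂ E]
    [CompleteSpace E]
    {U K : Set ℂ} (hK : IsCompact K) (hU : IsOpen U) {g : ℂ × ℂ → E}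
    (hg : ContinuousOn g (U ×ˢ K)) (hd : ∀ z ∈ K, DifferentiableOn ℂ (fun w => g (w, z)) U)
    {w₀ : ℂ} (hw₀ : w₀ ∈ U) (m : ℕ) :
    ∀ᶠ B : ℝ in atTop, ∀ᶠ w in 𝓝 w₀, ∀ z ∈ K,
      ‖g (w, z) - ∑ k ∈ Finset.range m, (w - w₀) ^ k •
          ((k ! : ℂ)⁻¹ • iteratedDeriv k (fun w => g (w, z)) w₀)‖ ≤ B * ‖w - w₀‖ ^ m := by
  obtain ⟨r, hr, hrU, B₀, hB⟩ := exists_ball_bound hK hU hg hw₀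
  filter_upwards [eventually_ge_atTop (2 * B₀ * (r⁻¹) ^ m)] with B h
  filter_upwards [Metric.closedBall_mem_nhds w₀ (half_pos hr)] with w hw z hz
  refine (norm_sub_taylor_le hr ((hd z hz).mono hrU) (fun w hw => hB w hw z hz) m
    (mem_closedBall_iff_norm.1 hw)).trans ?_
  gcongr

end SepMer


/-! ### Residues near a common pole -/

namespace SepMer

variable {E₁ E₂ E : Type*} [NormedAddCommGroup E₁] [NormedSpace ℂ E₁] [NormedAddCommGroup E₂]
  [NormedSpace ℂ E₂] [NormedAddCommGroup E] [NormedSpace ℂ E] [CompleteSpace E]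

/-- The residues of `T (x₁⁻¹ s₁) (x₂⁻¹ s₂)` at the zeros of `x₁`, if `f = x₁ v + x₂ u` is a
nonzero constant. -/
lemma eventually_smul_sum_circleIntegral_eq (T : E₁ →L[ℂ] E₂ →L[ℂ] E) {p : ℂ} {r r' ρ : ℝ}
    (hr : 0 < r) (hrr' : r < r') {f : ℂ} {χ x₁ x₂ v u : ℂ → ℂ}
    {s₁ R₁ : ℂ → E₁} {s₂ R₂ : ℂ → E₂} (hr'ρ : r' < ρ)
    (hx₁ : DifferentiableOn ℂ x₁ (Metric.ball p ρ)) (hx₂ : DifferentiableOn ℂ x₂ (Metric.ball p ρ))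
    (hs₁ : DifferentiableOn ℂ s₁ (Metric.ball p ρ)) (hs₂ : DifferentiableOn ℂ s₂ (Metric.ball p ρ))
    (hR₁ : ∀ z ∈ Metric.ball p ρ, x₁ z ≠ 0 → R₁ z = (x₁ z)⁻¹ • s₁ z)
    (hR₂ : ∀ z ∈ Metric.ball p ρ, x₂ z ≠ 0 → R₂ z = (x₂ z)⁻¹ • s₂ z)
    {V : Set ℂ} (hV : IsOpen V) (hVsub : Metric.closedBall p r' ⊆ V) (hVρ : V ⊆ Metric.ball p ρ)
    (hv : DifferentiableOn ℂ v V) (hu : DifferentiableOn ℂ u (Metric.ball p ρ))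
    (hχv : ∀ z ∈ V, χ z = x₁ z * v z) (hχu : ∀ z ∈ Metric.ball p ρ, f - χ z = x₂ z * u z)
    {S : Finset ℂ} (hS : ∀ z, z ∈ S ↔ z ∈ Metric.closedBall p r' ∧ x₁ z = 0)
    (hSr : ∀ b ∈ S, b ∈ Metric.ball p r) (hSx₂ : ∀ b ∈ S, x₂ b ≠ 0)
    (hx₂0 : ∀ z ∈ Metric.sphere p r, x₂ z ≠ 0) :
    ∀ᶠ ε in 𝓝[>] 0, f • ∑ b ∈ S, ∮ z in C(b, ε), T (R₁ z) (R₂ z) =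
      ∮ z in C(p, r), (f - χ z) • T (R₁ z) (R₂ z) := by
  set G : ℂ → E := fun z => T (s₁ z) (s₂ z) with hG
  have hGd : DifferentiableOn ℂ G (Metric.ball p ρ) :=
    (T.differentiable.comp_differentiableOn hs₁).clm_apply hs₂
  have hF : ∀ z ∈ Metric.ball p ρ, x₁ z ≠ 0 → x₂ z ≠ 0 →
      T (R₁ z) (R₂ z) = ((x₁ z)⁻¹ * (x₂ z)⁻¹) • G z := by
    intro z hz h1 h2
    rw [hR₁ z hz h1, hR₂ z hz h2, map_smul, map_smul, smul_apply, smul_smul, mul_comm]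
  have hVx : IsOpen (V ∩ {z | x₂ z ≠ 0}) :=
    (hx₂.continuousOn.mono hVρ).isOpen_inter_preimage hV isOpen_ne
  have hSV : ∀ b ∈ S, b ∈ V ∩ {z | x₂ z ≠ 0} := fun b hb =>
    ⟨hVsub ((hS b).1 hb).1, hSx₂ b hb⟩
  have hεV : ∀ᶠ ε in 𝓝[>] (0 : ℝ), ∀ b ∈ S, Metric.closedBall b ε ⊆ V ∩ {z | x₂ z ≠ 0} := by
    rw [eventually_all_finset]
    exact fun b hb => eventually_closedBall_subset (hVx.mem_nhds (hSV b hb))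
  have hεr : ∀ᶠ ε in 𝓝[>] (0 : ℝ), ∀ b ∈ S, Metric.closedBall b ε ⊆ Metric.ball p r := by
    rw [eventually_all_finset]
    exact fun b hb => eventually_closedBall_subset (Metric.isOpen_ball.mem_nhds (hSr b hb))
  filter_upwards [hεV, hεr, eventually_disjoint_closedBall S, self_mem_nhdsWithin]
    with ε h1 h2 h3 (hε : 0 < ε)
  have hdisj : ∀ b ∈ S, ∀ q ∈ S, b ≠ q → q ∉ Metric.closedBall b ε := fun b hb q hq hbq hqb =>
    disjoint_left.1 (h3 b hb q hq hbq) hqb (Metric.mem_closedBall_self hε.le)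
  -- Dividing `f = x₁ v + x₂ u` by `x₁ x₂` gives `f / (x₁ x₂) = u / x₁ + v / x₂`. The first term
  -- gives `Φ`, whose poles in the disc of radius `r'` are at most at the zeros of `x₁`. The second
  -- gives `Ψ` below, which is holomorphic near those zeros and does not contribute.
  set Φ : ℂ → E := fun z => (x₁ z)⁻¹ • u z • G z with hΦ
  have hr'ball : Metric.ball p r' ⊆ Metric.ball p ρ := Metric.ball_subset_ball hr'ρ.le
  have hsum : ∮ z in C(p, r), Φ z = ∑ b ∈ S, ∮ z in C(b, ε), Φ z := by
    refine circleIntegral_eq_sum_circleIntegral (U := Metric.ball p r') Metric.isOpen_ball hr.le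
      (Metric.closedBall_subset_ball hrr') hSr ?_ (fun b hb => ?_) hε h2 hdisj
    · have hsub : Metric.ball p r' \ S ⊆ Metric.ball p ρ := sdiff_subset.trans hr'ball
      refine DifferentiableOn.smul ((hx₁.mono hsub).inv fun z hz h0 => ?_)
        ((hu.mono hsub).smul (hGd.mono hsub))
      exact hz.2 ((hS z).2 ⟨Metric.ball_subset_closedBall hz.1, h0⟩)
    · have hb' := Metric.isOpen_ball.mem_nhds (hVρ (hSV b hb).1)
      exact ((hx₁.analyticAt hb').meromorphicAt.inv).smul
        ((hu.analyticAt hb').smul (hGd.analyticAt hb')).meromorphicAt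
  have hloc : ∀ b ∈ S, f • ∮ z in C(b, ε), T (R₁ z) (R₂ z) = ∮ z in C(b, ε), Φ z := by
    intro b hb
    have hsV : Metric.sphere b ε ⊆ V ∩ {z | x₂ z ≠ 0} :=
      Metric.sphere_subset_closedBall.trans (h1 b hb)
    have hx₁0 : ∀ z ∈ Metric.sphere b ε, x₁ z ≠ 0 := by
      intro z hz h0
      have hzS : z ∈ S := (hS z).2 ⟨Metric.ball_subset_closedBall (Metric.ball_subset_ball hrr'.le
        (h2 b hb (Metric.sphere_subset_closedBall hz))), h0⟩
      exact hdisj b hb z hzS (fun h => by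
        rw [Metric.mem_sphere, h, dist_self] at hz; exact hε.ne hz)
        (Metric.sphere_subset_closedBall hz)
    set Ψ : ℂ → E := fun z => (v z * (x₂ z)⁻¹) • G z with hΨ
    have hΨd : DifferentiableOn ℂ Ψ (V ∩ {z | x₂ z ≠ 0}) := by
      refine DifferentiableOn.smul ((hv.mono inter_subset_left).mul ((hx₂.mono
        (inter_subset_left.trans hVρ)).inv fun z hz => hz.2)) (hGd.mono (inter_subset_left.trans
          hVρ))
    have hzero : ∮ z in C(b, ε), Ψ z = 0 :=
      circleIntegral_eq_zero_of_differentiableOn hVx hε.le (h1 b hb) hΨd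
    have hsρ : Metric.sphere b ε ⊆ Metric.ball p ρ := fun z hz => hVρ (hsV hz).1
    have hΦc : ContinuousOn Φ (Metric.sphere b ε) :=
      ((hx₁.continuousOn.mono hsρ).inv₀ hx₁0).smul
        ((hu.continuousOn.mono hsρ).smul (hGd.continuousOn.mono hsρ))
    rw [← circleIntegral.integral_smul, ← add_zero (∮ z in C(b, ε), Φ z), ← hzero,
      ← circleIntegral.integral_add (hΦc.circleIntegrable hε.le)
        ((hΨd.continuousOn.mono hsV).circleIntegrable hε.le)]
    refine circleIntegral.integral_congr hε.le fun z hz => ?_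
    have e1 := hx₁0 z hz
    have e2 : x₂ z ≠ 0 := (hsV hz).2
    have e3 : f = x₂ z * u z + x₁ z * v z := by
      rw [← hχv z (hsV hz).1, ← hχu z (hsρ hz)]; ring
    simp only [hΦ, hΨ]
    rw [hF z (hsρ hz) e1 e2, smul_smul, smul_smul, ← add_smul, e3]
    congr 1
    field_simp
  rw [Finset.smul_sum, Finset.sum_congr rfl hloc, ← hsum]
  -- On the large circle both denominators are nonzero, and `Φ` equals `(f - χ) T R₁ R₂` because `f
  -- - χ = x₂ u`.
  refine circleIntegral.integral_congr hr.le fun z hz => ?_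
  have hzρ : z ∈ Metric.ball p ρ := hr'ball
    (Metric.closedBall_subset_ball hrr' (Metric.sphere_subset_closedBall hz))
  have e1 : x₁ z ≠ 0 := fun h0 => by
    have := hSr z ((hS z).2 ⟨Metric.ball_subset_closedBall (Metric.closedBall_subset_ball hrr'
      (Metric.sphere_subset_closedBall hz)), h0⟩)
    exact (Metric.mem_ball.1 this).ne hz
  have e2 := hx₂0 z hz
  simp only [hΦ]
  rw [hF z hzρ e1 e2, hχu z hzρ, smul_smul, smul_smul]
  congr 1
  field_simp

end SepMer


namespace SepMer

/-- Bilinear expansion pulls the constant operators out of the integral and leaves scalar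
coefficient integrals. -/
lemma circleIntegral_smul_sum_sum {E₁ E₂ E : Type*} [NormedAddCommGroup E₁] [NormedSpace ℂ E₁]
    [NormedAddCommGroup E₂] [NormedSpace ℂ E₂] [NormedAddCommGroup E] [NormedSpace ℂ E]
    [CompleteSpace E] (T : E₁ →L[ℂ] E₂ →L[ℂ] E) {ι κ : Type*} (I : Finset ι) (J : Finset κ)
    {a : ι → ℂ → ℂ} {b : κ → ℂ → ℂ} (A : ι → E₁) (B : κ → E₂) {c : ℂ} {r : ℝ} (hr : 0 ≤ r)
    {g : ℂ → ℂ} (hg : ContinuousOn g (Metric.sphere c r))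
    (ha : ∀ i ∈ I, ContinuousOn (a i) (Metric.sphere c r))
    (hb : ∀ j ∈ J, ContinuousOn (b j) (Metric.sphere c r)) :
    ∮ z in C(c, r), g z • T (∑ i ∈ I, a i z • A i) (∑ j ∈ J, b j z • B j) =
      ∑ i ∈ I, ∑ j ∈ J, (∮ z in C(c, r), g z * (a i z * b j z)) • T (A i) (B j) := by
  have h1 : ∀ z, g z • T (∑ i ∈ I, a i z • A i) (∑ j ∈ J, b j z • B j) =
      ∑ i ∈ I, ∑ j ∈ J, (g z * (a i z * b j z)) • T (A i) (B j) := by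
    intro z
    rw [map_sum T, sum_apply, Finset.smul_sum]
    refine Finset.sum_congr rfl fun i _ => ?_
    rw [map_sum, Finset.smul_sum]
    refine Finset.sum_congr rfl fun j _ => ?_
    simp only [map_smul, smul_apply, smul_smul]
    ring_nf
  have h2 : ∀ i ∈ I, ∀ j ∈ J,
      CircleIntegrable (fun z => (g z * (a i z * b j z)) • T (A i) (B j)) c r := fun i hi j hj =>
    ((hg.mul ((ha i hi).mul (hb j hj))).smul continuousOn_const).circleIntegrable hr
  simp only [h1]
  rw [circleIntegral.integral_fun_sum fun i hi => CircleIntegrable.fun_sum J fun j hj => h2 i hi j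
      hj]
  refine Finset.sum_congr rfl fun i hi => ?_
  rw [circleIntegral.integral_fun_sum fun j hj => h2 i hi j hj]
  refine Finset.sum_congr rfl fun j _ => ?_
  rw [circleIntegral.integral_smul_const]

lemma eventually_ne_zero_of_exists {g : ℂ → ℂ} {p : ℂ} {ρ : ℝ}
    (hg : DifferentiableOn ℂ g (Metric.ball p ρ)) (h : ∃ z ∈ Metric.ball p ρ, g z ≠ 0) {z : ℂ}
    (hz : z ∈ Metric.ball p ρ) : ∀ᶠ y in 𝓝[≠] z, g y ≠ 0 := by
  obtain ⟨z', hz', h0⟩ := h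
  refine not_frequently.1 fun hf => h0 ?_
  exact (hg.analyticOnNhd Metric.isOpen_ball).eqOn_zero_of_preconnected_of_frequently_eq_zero
    (convex_ball p ρ).isPreconnected hz hf hz'

section quotient

variable {X : Type*} [NormedAddCommGroup X] [NormedSpace ℂ X] {W Z : Set (ℂ × ℂ)} {R : ℂ × ℂ → X}

/-- The denominator does not vanish identically on the slice through `w₀`, so in a small enough disc
`p` is its only zero there. Stating this for all small radii lets two families share one radius. -/
lemma IsMeromorphicFamily.eventually_quotient (hR : IsMeromorphicFamily W Z R) {w₀ p : ℂ}
    (hp : (w₀, p) ∈ Z) : ∀ᶠ ρ : ℝ in 𝓝[>] 0, ∃ (S : ℂ × ℂ → X) (D : ℂ × ℂ → ℂ),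
      DifferentiableOn ℂ S (Metric.ball w₀ ρ ×ˢ Metric.ball p ρ) ∧
      DifferentiableOn ℂ D (Metric.ball w₀ ρ ×ˢ Metric.ball p ρ) ∧
      (∀ z ∈ Metric.ball p ρ, z ≠ p → D (w₀, z) ≠ 0) ∧
      (∀ q ∈ Metric.ball w₀ ρ ×ˢ Metric.ball p ρ, q ∈ Z ↔ D q = 0) ∧
      ∀ q ∈ Metric.ball w₀ ρ ×ˢ Metric.ball p ρ, D q ≠ 0 → R q = (D q)⁻¹ • S q := by
  obtain ⟨r, hr, S, D, -, hS, hD, hnz, hZ, hq⟩ := hR.quotient (w₀, p) hp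
  simp only at hS hD hnz hZ hq
  have h1 := eventually_ne_zero_of_exists (DifferentiableOn.differentiableOn_slice_right hD
    (Metric.mem_ball_self hr)) (hnz w₀ (Metric.mem_ball_self hr)) (Metric.mem_ball_self hr)
  obtain ⟨r₁, hr₁, h2⟩ := Metric.nhds_basis_ball.mem_iff.1 (eventually_nhdsWithin_iff.1 h1)
  filter_upwards [Ioo_mem_nhdsGT (lt_min hr hr₁)] with ρ hρ
  have hρr : ρ ≤ r := hρ.2.le.trans (min_le_left _ _)
  have hsub : Metric.ball w₀ ρ ×ˢ Metric.ball p ρ ⊆ Metric.ball w₀ r ×ˢ Metric.ball p r :=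
    prod_mono (Metric.ball_subset_ball hρr) (Metric.ball_subset_ball hρr)
  refine ⟨S, D, hS.mono hsub, hD.mono hsub, fun z hz hzp => ?_, fun q hq' => hZ q (hsub hq'),
    fun q hq' h0 => hq q (hsub hq') fun h => h0 ((hZ q (hsub hq')).1 h)⟩
  exact h2 (Metric.ball_subset_ball (hρ.2.le.trans (min_le_right _ _)) hz) hzp

end quotient

variable {H₁ H₂ H : Type*} [NormedAddCommGroup H₁] [NormedSpace ℂ H₁] [CompleteSpace H₁]
  [NormedAddCommGroup H₂] [NormedSpace ℂ H₂] [CompleteSpace H₂]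
  [NormedAddCommGroup H] [NormedSpace ℂ H] [CompleteSpace H]

set_option maxHeartbeats 1000000 in
set_option maxSynthPendingDepth 10 in
/-- The residues of the product `T R₁ R₂` at the poles of `R₁` near a common pole: apart from a
bounded part,
they form a meromorphic family with poles of finite rank. -/
theorem exists_local_residue (T : (H₁ →L[ℂ] H₁) →L[ℂ] (H₂ →L[ℂ] H₂) →L[ℂ] (H →L[ℂ] H))
    (hT : ∀ A B, FiniteDimensional ℂ (LinearMap.range A.toLinearMap) →
      FiniteDimensional ℂ (LinearMap.range B.toLinearMap) →
      FiniteDimensional ℂ (LinearMap.range (T A B).toLinearMap)) {W₁ W₂ Z₁ Z₂ : Set (ℂ × ℂ)} {R₁ :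
        ℂ × ℂ → H₁ →L[ℂ] H₁}
    {R₂ : ℂ × ℂ → H₂ →L[ℂ] H₂} (hR₁ : IsMeromorphicFamily W₁ Z₁ R₁)
    (hR₂ : IsMeromorphicFamily W₂ Z₂ R₂) (hfin₁ : HasPolesOfFiniteRank Z₁ R₁)
    (hfin₂ : HasPolesOfFiniteRank Z₂ R₂) {w₀ p : ℂ} (hp₁ : (w₀, p) ∈ Z₁) (hp₂ : (w₀, p) ∈ Z₂)
    {η : ℝ} (hη : 0 < η) :
    ∃ r' > 0, r' < η ∧ ∃ f : ℂ → ℂ, AnalyticAt ℂ f w₀ ∧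
      (∀ᶠ w in 𝓝 w₀, f w = 0 ↔ ∃ z ∈ Metric.closedBall p r', (w, z) ∈ Z₁ ∧ (w, z) ∈ Z₂) ∧
      ((¬ ∀ᶠ w in 𝓝 w₀, f w = 0) →
        ∃ (M : ℂ → H →L[ℂ] H) (C : ℝ),
          HasFiniteRankPrincipalPartAt M w₀ ∧
          ∀ᶠ w in 𝓝[≠] w₀, ∀ S : Finset ℂ,
            (∀ z, z ∈ S ↔ z ∈ Metric.closedBall p r' ∧ (w, z) ∈ Z₁) →
            (∀ b ∈ S, b ∈ Metric.ball p r') ∧ ∀ᶠ ε in 𝓝[>] 0,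
              ‖(∑ b ∈ S, ∮ z in C(b, ε), T (R₁ (w, z)) (R₂ (w, z))) - M w‖ ≤ C) := by
  obtain ⟨ρ, ⟨S₁, X₁, dS₁, dX₁, hnz₁, hZ₁, hq₁⟩, ⟨S₂, X₂, dS₂, dX₂, hnz₂, hZ₂, hq₂⟩, hρ, hρη⟩ :=
    ((hR₁.eventually_quotient hp₁).and ((hR₂.eventually_quotient hp₂).and
      (Ioo_mem_nhdsGT hη))).exists
  set r' := ρ / 2 with hr'
  have hr'0 : 0 < r' := by positivity
  have hr'ρ : r' < ρ := by rw [hr']; linarith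
  have hcb : Metric.closedBall p r' ⊆ Metric.ball p ρ := Metric.closedBall_subset_ball hr'ρ
  have hprod : IsOpen (Metric.ball w₀ ρ ×ˢ Metric.ball p ρ) := Metric.isOpen_ball.prod
      Metric.isOpen_ball
  obtain ⟨δ, hδ, hδρ, f, χ, df, dχ, hel⟩ := exists_elimination hr'0 hr'ρ dX₁ dX₂ fun z hz => by
    refine hnz₁ z (hcb (Metric.sphere_subset_closedBall hz)) fun h => ?_
    rw [h, Metric.mem_sphere, dist_self] at hz
    exact hr'0.ne hz
  have hδρ' : Metric.ball w₀ δ ⊆ Metric.ball w₀ ρ := Metric.ball_subset_ball hδρ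
  have hfan : AnalyticAt ℂ f w₀ := df.analyticAt (Metric.ball_mem_nhds w₀ hδ)
  refine ⟨r', hr'0, by linarith, f, hfan, ?_, fun hf => ?_⟩
  · filter_upwards [Metric.ball_mem_nhds w₀ hδ] with w hw
    rw [(hel w hw).1]
    refine exists_congr fun z => and_congr_right fun hz => ?_
    rw [hZ₁ (w, z) ⟨hδρ' hw, hcb hz⟩, hZ₂ (w, z) ⟨hδρ' hw, hcb hz⟩]
  -- The order of vanishing `m` of `f` at `w₀` is the order at which the Taylor expansions are cut,
  -- so that the remainders are `O(f)`.
  obtain ⟨m, g, hg, hg0, hfg⟩ := hfan.exists_eventuallyEq_pow_smul_nonzero_iff.2 hf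
  obtain ⟨C₀, hC₀, hfC₀⟩ : ∃ C₀ > 0, ∀ᶠ w in 𝓝 w₀, ‖w - w₀‖ ^ m ≤ C₀ * ‖f w‖ := by
    have h1 := hg.continuousAt.norm.eventually
      (lt_mem_nhds (half_lt_self (norm_pos_iff.2 hg0)))
    refine ⟨2 / ‖g w₀‖, by positivity, ?_⟩
    filter_upwards [h1, hfg] with w h2 h3
    have hg0' := norm_pos_iff.2 hg0
    rw [h3, smul_eq_mul, norm_mul, norm_pow, div_mul_eq_mul_div, le_div_iff₀ hg0']
    nlinarith [pow_nonneg (norm_nonneg (w - w₀)) m]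
  obtain ⟨ρ₁, hρ₁, I₁, A₁, G₁, fA₁, cG₁, dG₁, hT₁⟩ := exists_truncation hfin₁ hp₁ m
  obtain ⟨ρ₂, hρ₂, I₂, A₂, G₂, fA₂, cG₂, dG₂, hT₂⟩ := exists_truncation hfin₂ hp₂ m
  -- A second, smaller radius is needed: the truncations depend on `m`, hence on `f`, which was
  -- built from `r'`, and their radii of validity may be smaller than `r'`.
  obtain ⟨r, hr, hrmin⟩ := exists_between (lt_min hr'0 (lt_min hρ₁ hρ₂))
  have hrr' : r < r' := hrmin.trans_le (min_le_left _ _)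
  have hrρ₁ : Metric.closedBall p r ⊆ Metric.ball p ρ₁ := Metric.closedBall_subset_ball
    (hrmin.trans_le ((min_le_right _ _).trans (min_le_left _ _)))
  have hrρ₂ : Metric.closedBall p r ⊆ Metric.ball p ρ₂ := Metric.closedBall_subset_ball
    (hrmin.trans_le ((min_le_right _ _).trans (min_le_right _ _)))
  have hrρ : Metric.closedBall p r ⊆ Metric.ball p ρ :=
    (Metric.closedBall_subset_closedBall hrr'.le).trans hcb
  have hs := Metric.sphere_subset_closedBall (x := p) (ε := r)
  have hsne : ∀ z ∈ Metric.sphere p r, z ≠ p := fun z hz h => by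
    rw [h, Metric.mem_sphere, dist_self] at hz
    exact hr.ne hz
  -- At `w₀` both denominators are zero-free on this compact annulus, and they remain so for nearby
  -- `w`. All zeros in the larger disc then lie in the smaller one.
  set An : Set ℂ := Metric.closedBall p r' \ Metric.ball p r with hAn
  have hAnc : IsCompact An := (isCompact_closedBall p r').diff Metric.isOpen_ball
  have hsAn : Metric.sphere p r ⊆ An := fun z hz =>
    ⟨Metric.closedBall_subset_closedBall hrr'.le (hs hz), fun h => (Metric.mem_ball.1 h).ne hz⟩
  have hAnp : ∀ z ∈ An, z ≠ p := fun z hz h => hz.2 (h ▸ Metric.mem_ball_self hr)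
  have hAnX₁ := eventually_forall_sphere_ne_zero hprod hAnc dX₁.continuousOn
    (fun z hz => ⟨Metric.mem_ball_self hρ, hcb hz.1⟩) (w₀ := w₀)
    fun z hz => hnz₁ z (hcb hz.1) (hAnp z hz)
  have hAnX₂ := eventually_forall_sphere_ne_zero hprod hAnc dX₂.continuousOn
    (fun z hz => ⟨Metric.mem_ball_self hρ, hcb hz.1⟩) (w₀ := w₀)
    fun z hz => hnz₂ z (hcb hz.1) (hAnp z hz)
  obtain ⟨δ', hδ', hδ's⟩ := Metric.nhds_basis_ball.mem_iff.1
    (hAnX₁.and (hAnX₂.and (Metric.ball_mem_nhds w₀ hδ)))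
  set U := Metric.ball w₀ δ' with hU
  set K := Metric.sphere p r with hK
  have hKc : IsCompact K := isCompact_sphere p r
  have hUo : IsOpen U := Metric.isOpen_ball
  have hw₀U : w₀ ∈ U := Metric.mem_ball_self hδ'
  have hUδ : U ⊆ Metric.ball w₀ δ := fun w hw => (hδ's hw).2.2
  have hUK : U ×ˢ K ⊆ Metric.ball w₀ ρ ×ˢ Metric.ball p ρ :=
    prod_mono (hUδ.trans hδρ') (hs.trans hrρ)
  have hX₁0 : ∀ w ∈ U, ∀ z ∈ An, X₁ (w, z) ≠ 0 := fun w hw => (hδ's hw).1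
  have hX₂0 : ∀ w ∈ U, ∀ z ∈ An, X₂ (w, z) ≠ 0 := fun w hw => (hδ's hw).2.1
  have cR₁ : ContinuousOn R₁ (U ×ˢ K) := by
    refine ContinuousOn.congr (f := fun q => (X₁ q)⁻¹ • S₁ q) (((dX₁.continuousOn.mono hUK).inv₀
      fun q hq => hX₁0 q.1 hq.1 q.2 (hsAn hq.2)).smul (dS₁.continuousOn.mono hUK)) fun q hq => ?_
    exact hq₁ q (hUK hq) (hX₁0 q.1 hq.1 q.2 (hsAn hq.2))
  have cR₂ : ContinuousOn R₂ (U ×ˢ K) := by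
    refine ContinuousOn.congr (f := fun q => (X₂ q)⁻¹ • S₂ q) (((dX₂.continuousOn.mono hUK).inv₀
      fun q hq => hX₂0 q.1 hq.1 q.2 (hsAn hq.2)).smul (dS₂.continuousOn.mono hUK)) fun q hq => ?_
    exact hq₂ q (hUK hq) (hX₂0 q.1 hq.1 q.2 (hsAn hq.2))
  have dR₁ : ∀ z ∈ K, DifferentiableOn ℂ (fun w => R₁ (w, z)) U := by
    intro z hz
    refine DifferentiableOn.congr (f := fun w => (X₁ (w, z))⁻¹ • S₁ (w, z)) (DifferentiableOn.smul
      (DifferentiableOn.inv ?_ fun w hw => hX₁0 w hw z (hsAn hz)) ?_) fun w hw =>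
      hq₁ (w, z) (hUK ⟨hw, hz⟩) (hX₁0 w hw z (hsAn hz))
    · exact DifferentiableOn.differentiableOn_slice_left (dX₁.mono hUK) hz
    · exact DifferentiableOn.differentiableOn_slice_left (dS₁.mono hUK) hz
  have dR₂ : ∀ z ∈ K, DifferentiableOn ℂ (fun w => R₂ (w, z)) U := by
    intro z hz
    refine DifferentiableOn.congr (f := fun w => (X₂ (w, z))⁻¹ • S₂ (w, z)) (DifferentiableOn.smul
      (DifferentiableOn.inv ?_ fun w hw => hX₂0 w hw z (hsAn hz)) ?_) fun w hw =>
      hq₂ (w, z) (hUK ⟨hw, hz⟩) (hX₂0 w hw z (hsAn hz))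
    · exact DifferentiableOn.differentiableOn_slice_left (dX₂.mono hUK) hz
    · exact DifferentiableOn.differentiableOn_slice_left (dS₂.mono hUK) hz
  set Q₁ : ℂ × ℂ → H₁ →L[ℂ] H₁ := fun q =>
    ∑ x ∈ I₁, ((q.1 - w₀) ^ x.1 * ((q.2 - p) ^ x.2)⁻¹) • A₁ x with hQ₁
  set Q₂ : ℂ × ℂ → H₂ →L[ℂ] H₂ := fun q =>
    ∑ x ∈ I₂, ((q.1 - w₀) ^ x.1 * ((q.2 - p) ^ x.2)⁻¹) • A₂ x with hQ₂
  have cpp : ∀ (k l : ℕ), ContinuousOn (fun q : ℂ × ℂ => (q.1 - w₀) ^ k * ((q.2 - p) ^ l)⁻¹)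
      (univ ×ˢ K) := fun k l => ContinuousOn.mul (by fun_prop) (ContinuousOn.inv₀ (by fun_prop)
        fun q hq => pow_ne_zero _ (sub_ne_zero.2 (hsne q.2 hq.2)))
  have cQ₁ : ContinuousOn Q₁ (univ ×ˢ K) :=
    continuousOn_finsetSum _ fun x _ => (cpp _ _).smul continuousOn_const
  have cQ₂ : ContinuousOn Q₂ (univ ×ˢ K) :=
    continuousOn_finsetSum _ fun x _ => (cpp _ _).smul continuousOn_const
  have hE₁ := eventually_norm_sub_taylor_le hKc hUo cR₁ dR₁ hw₀U m
  have hE₂ := eventually_norm_sub_taylor_le hKc hUo cR₂ dR₂ hw₀U m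
  have cχ : ContinuousOn χ (Metric.ball w₀ δ ×ˢ K) :=
    dχ.continuousOn.mono (prod_mono_right (hs.trans hrρ))
  have cf : ContinuousOn (fun q : ℂ × ℂ => f q.1) (Metric.ball w₀ δ ×ˢ K) :=
    df.continuousOn.comp continuousOn_fst fun q hq => hq.1
  have hw₀δ := Metric.mem_ball_self (x := w₀) hδ
  obtain ⟨B, hB1, hB2, hB3, hB4, hB5, hB6, hB7⟩ := (hE₁.and (hE₂.and
    ((eventually_bound hKc Metric.isOpen_ball cχ hw₀δ).and
    ((eventually_bound hKc Metric.isOpen_ball cf hw₀δ).and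
    ((eventually_bound hKc hUo cR₂ hw₀U).and
    ((eventually_bound hKc isOpen_univ (cG₂.mono (prod_mono_right (hs.trans hrρ₂))) (mem_univ
      w₀)).and
    (eventually_bound hKc isOpen_univ cQ₁ (mem_univ w₀)))))))).exists
  obtain ⟨zK, hzK⟩ := (NormedSpace.sphere_nonempty (x := p) (r := r)).2 hr.le
  -- The constant is the replacement estimate with remainder `B * ‖w - w₀‖ ^ m ≤ B * C₀ * ‖f w‖`,
  -- divided by `‖f w‖`.
  refine ⟨fun w => (f w)⁻¹ • ∮ z in C(p, r), (f w - χ (w, z)) • T (Q₁ (w, z)) (Q₂ (w, z)),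
    2 * Real.pi * r * (‖T‖ * (5 * B ^ 2 * (B * C₀) + B ^ 2)), ?_, ?_⟩
  -- After expansion the coefficients of the finite rank operators `T (A₁ x) (A₂ y)` are scalar
  -- holomorphic functions divided by `f`.
  · have hev : ∀ᶠ w in 𝓝[≠] w₀,
        (f w)⁻¹ • ∮ z in C(p, r), (f w - χ (w, z)) • T (Q₁ (w, z)) (Q₂ (w, z)) =
        ∑ x ∈ I₁, ∑ y ∈ I₂, ((f w)⁻¹ * ∮ z in C(p, r), (f w - χ (w, z)) *
          (((w - w₀) ^ x.1 * ((z - p) ^ x.2)⁻¹) * ((w - w₀) ^ y.1 * ((z - p) ^ y.2)⁻¹))) •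
            T (A₁ x) (A₂ y) := by
      filter_upwards [nhdsWithin_le_nhds (Metric.ball_mem_nhds w₀ hδ)] with w hw
      have hsl : ∀ k l : ℕ, ContinuousOn (fun z : ℂ => (w - w₀) ^ k * ((z - p) ^ l)⁻¹) K :=
        fun k l => (cpp k l).comp (f := fun z => (w, z)) (by fun_prop) fun z hz => ⟨mem_univ _, hz⟩
      rw [circleIntegral_smul_sum_sum T I₁ I₂ A₁ A₂ hr.le
        (a := fun x z => (w - w₀) ^ x.1 * ((z - p) ^ x.2)⁻¹)
        (b := fun y z => (w - w₀) ^ y.1 * ((z - p) ^ y.2)⁻¹) (g := fun z => f w - χ (w, z))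
        (continuousOn_const.sub
          (cχ.comp (f := fun z => (w, z)) (by fun_prop) fun z hz => ⟨hw, hz⟩))
        (fun _ _ => hsl _ _) (fun _ _ => hsl _ _), Finset.smul_sum]
      refine Finset.sum_congr rfl fun x _ => ?_
      rw [Finset.smul_sum]
      refine Finset.sum_congr rfl fun y _ => ?_
      rw [smul_smul]
    refine HasFiniteRankPrincipalPartAt.congr (HasFiniteRankPrincipalPartAt.sum _ fun x _ =>
      HasFiniteRankPrincipalPartAt.sum _ fun y _ =>
        MeromorphicAt.hasFiniteRankPrincipalPartAt_smul_const (hfan.meromorphicAt.inv.mul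
          (AnalyticAt.meromorphicAt (DifferentiableOn.analyticAt (s := Metric.ball w₀ δ) ?_
            (Metric.ball_mem_nhds w₀ hδ))))
        (hT _ _ (fA₁ x) (fA₂ y))) hev
    refine differentiableOn_circleIntegral Metric.isOpen_ball hr.le (φ := fun q : ℂ × ℂ =>
      (f q.1 - χ q) * (((q.1 - w₀) ^ x.1 * ((q.2 - p) ^ x.2)⁻¹) *
        ((q.1 - w₀) ^ y.1 * ((q.2 - p) ^ y.2)⁻¹))) ?_ fun z hz => ?_
    · exact (cf.sub cχ).mul (((cpp _ _).mono (prod_mono_left (subset_univ _))).mul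
        ((cpp _ _).mono (prod_mono_left (subset_univ _))))
    · refine DifferentiableOn.mul (df.sub (DifferentiableOn.differentiableOn_slice_left dχ
        (hrρ (hs hz)))) ?_
      have hd : ∀ k l : ℕ, DifferentiableOn ℂ (fun w : ℂ => (w - w₀) ^ k * ((z - p) ^ l)⁻¹)
          (Metric.ball w₀ δ) := fun k l =>
        ((differentiableOn_id.sub_const w₀).fun_pow k).mul_const _
      exact (hd _ _).mul (hd _ _)
  · filter_upwards [nhdsWithin_le_nhds hB1, nhdsWithin_le_nhds hB2, nhdsWithin_le_nhds hB3,
      nhdsWithin_le_nhds hB4, nhdsWithin_le_nhds hB5, nhdsWithin_le_nhds hB6, nhdsWithin_le_nhds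
        hB7,
      nhdsWithin_le_nhds hfC₀, nhdsWithin_le_nhds (hUo.mem_nhds hw₀U), self_mem_nhdsWithin]
      with w b1 b2 b3 b4 b5 b6 b7 hfC hwU (hww₀ : w ≠ w₀) S hS
    have hpos : 0 < ‖w - w₀‖ := norm_pos_iff.2 (sub_ne_zero.2 hww₀)
    have hf0 : f w ≠ 0 := by
      intro h
      rw [h, norm_zero, mul_zero] at hfC
      exact (pow_pos hpos m).not_ge hfC
    have hwδ := hUδ hwU
    have hwρ := hδρ' hwδ
    have hS' : ∀ z, z ∈ S ↔ z ∈ Metric.closedBall p r' ∧ X₁ (w, z) = 0 := fun z => by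
      rw [hS]
      exact and_congr_right fun hz => hZ₁ (w, z) ⟨hwρ, hcb hz⟩
    have hSr : ∀ b ∈ S, b ∈ Metric.ball p r := by
      intro b hb
      by_contra h
      exact hX₁0 w hwU b ⟨((hS' b).1 hb).1, h⟩ ((hS' b).1 hb).2
    refine ⟨fun b hb => Metric.ball_subset_ball hrr'.le (hSr b hb), ?_⟩
    obtain ⟨hfz, ⟨V, v, hVo, hVsub, hVρ, dv, hχv⟩, u, du, hχu⟩ := hel w hwδ
    have dX₁w := DifferentiableOn.differentiableOn_slice_right dX₁ hwρ
    have dX₂w := DifferentiableOn.differentiableOn_slice_right dX₂ hwρ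
    have dS₁w := DifferentiableOn.differentiableOn_slice_right dS₁ hwρ
    have dS₂w := DifferentiableOn.differentiableOn_slice_right dS₂ hwρ
    have dχw := DifferentiableOn.differentiableOn_slice_right dχ hwδ
    have hq₁w : ∀ z ∈ Metric.ball p ρ, X₁ (w, z) ≠ 0 → R₁ (w, z) = (X₁ (w, z))⁻¹ • S₁ (w, z) :=
      fun z hz h => hq₁ (w, z) ⟨hwρ, hz⟩ h
    have hq₂w : ∀ z ∈ Metric.ball p ρ, X₂ (w, z) ≠ 0 → R₂ (w, z) = (X₂ (w, z))⁻¹ • S₂ (w, z) :=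
      fun z hz h => hq₂ (w, z) ⟨hwρ, hz⟩ h
    have hkey := eventually_smul_sum_circleIntegral_eq T hr hrr' hr'ρ dX₁w dX₂w dS₁w dS₂w hq₁w hq₂w
      hVo hVsub hVρ dv du hχv hχu hS' hSr
      (fun b hb h0 => hf0 (hfz.2 ⟨b, ((hS' b).1 hb).1, ((hS' b).1 hb).2, h0⟩))
      (fun z hz => hX₂0 w hwU z (hsAn hz))
    have hpair : ContinuousOn (fun z : ℂ => (w, z)) K := by fun_prop
    -- The factor `X₂` in `f - χ` cancels the denominator of `R₂`. In the next integral the factor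
    -- `X₁` in `χ` cancels that of `R₁` in the same way.
    have i₁ : ∮ z in C(p, r), (f w - χ (w, z)) • T (G₁ (w, z)) (R₂ (w, z)) = 0 := by
      rw [circleIntegral.integral_congr hr.le
        (g := fun z => u z • T (G₁ (w, z)) (S₂ (w, z))) fun z hz => ?_]
      · exact circleIntegral_eq_zero_of_differentiableOn (Metric.isOpen_ball.inter
          Metric.isOpen_ball) hr.le (subset_inter hrρ hrρ₁) ((du.mono inter_subset_left).smul
          ((T.differentiable.comp_differentiableOn ((dG₁ w).mono inter_subset_right)).clm_apply
            (dS₂w.mono inter_subset_left)))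
      · have e := hX₂0 w hwU z (hsAn hz)
        simp only
        rw [hχu z (hrρ (hs hz)), hq₂w z (hrρ (hs hz)) e, map_smul, smul_smul]
        congr 1
        field_simp
    have i₂ : ∮ z in C(p, r), χ (w, z) • T (R₁ (w, z)) (G₂ (w, z)) = 0 := by
      have hrV : Metric.closedBall p r ⊆ V :=
        (Metric.closedBall_subset_closedBall hrr'.le).trans hVsub
      rw [circleIntegral.integral_congr hr.le
        (g := fun z => v z • T (S₁ (w, z)) (G₂ (w, z))) fun z hz => ?_]
      · exact circleIntegral_eq_zero_of_differentiableOn (hVo.inter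
          Metric.isOpen_ball) hr.le (subset_inter hrV hrρ₂) ((dv.mono inter_subset_left).smul
          ((T.differentiable.comp_differentiableOn (dS₁w.mono (inter_subset_left.trans
            hVρ))).clm_apply ((dG₂ w).mono inter_subset_right)))
      · have e := hX₁0 w hwU z (hsAn hz)
        simp only
        rw [hχv z (hrV (hs hz)), hq₁w z (hrρ (hs hz)) e, map_smul, smul_apply, smul_smul]
        congr 1
        field_simp
    have i₃ : ∮ z in C(p, r), χ (w, z) • T (G₁ (w, z)) (G₂ (w, z)) = 0 :=
      circleIntegral_eq_zero_of_differentiableOn (Metric.isOpen_ball.inter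
        (Metric.isOpen_ball.inter Metric.isOpen_ball)) hr.le
        (subset_inter hrρ (subset_inter hrρ₁ hrρ₂)) ((dχw.mono inter_subset_left).smul
        ((T.differentiable.comp_differentiableOn ((dG₁ w).mono (inter_subset_right.trans
          inter_subset_left))).clm_apply ((dG₂ w).mono (inter_subset_right.trans
          inter_subset_right))))
    have hnorm := norm_circleIntegral_sub_le T hr.le (f := f w) (χ := fun z => χ (w, z))
      (R₁ := fun z => R₁ (w, z)) (H₁ := fun z => G₁ (w, z)) (Q₁ := fun z => Q₁ (w, z))
      (R₂ := fun z => R₂ (w, z)) (H₂ := fun z => G₂ (w, z)) (Q₂ := fun z => Q₂ (w, z))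
      (ε := B * ‖w - w₀‖ ^ m)
      (cχ.comp hpair fun z hz => ⟨hwδ, hz⟩) (cR₁.comp hpair fun z hz => ⟨hwU, hz⟩)
      (cR₂.comp hpair fun z hz => ⟨hwU, hz⟩) ((dG₁ w).continuousOn.mono (hs.trans hrρ₁))
      ((dG₂ w).continuousOn.mono (hs.trans hrρ₂)) (cQ₁.comp hpair fun z hz => ⟨mem_univ _, hz⟩)
      (cQ₂.comp hpair fun z hz => ⟨mem_univ _, hz⟩) i₁ i₂ i₃ (b4 zK hzK) b3 b5 b6 b7
      (fun z hz => by
        rw [sub_sub]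
        have := b1 z hz
        rwa [hT₁ z (hrρ₁ (hs hz)) (hsne z hz) w] at this)
      (fun z hz => by
        rw [sub_sub]
        have := b2 z hz
        rwa [hT₂ z (hrρ₂ (hs hz)) (hsne z hz) w] at this)
    have hB0 : 0 ≤ B := (norm_nonneg _).trans (b4 zK hzK)
    have hfn : 0 < ‖f w‖ := norm_pos_iff.2 hf0
    filter_upwards [hkey] with ε hε
    have hε' : (∑ b ∈ S, ∮ z in C(b, ε), T (R₁ (w, z)) (R₂ (w, z))) =
        (f w)⁻¹ • ∮ z in C(p, r), (f w - χ (w, z)) • T (R₁ (w, z)) (R₂ (w, z)) := by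
      rw [← hε, inv_smul_smul₀ hf0]
    rw [hε', ← smul_sub, norm_smul, norm_inv, inv_mul_le_iff₀ hfn]
    refine hnorm.trans ?_
    calc 2 * Real.pi * r * (‖T‖ * (5 * B ^ 2 * (B * ‖w - w₀‖ ^ m) + ‖f w‖ * B ^ 2))
        ≤ 2 * Real.pi * r * (‖T‖ * (5 * B ^ 2 * (B * (C₀ * ‖f w‖)) + ‖f w‖ * B ^ 2)) := by gcongr
      _ = _ := by ring

end SepMer


/-! ### Slices of meromorphic families and tails of contours -/

namespace SepMer

section family

variable {X : Type*} [NormedAddCommGroup X] [NormedSpace ℂ X] {Ω : Set ℂ} {Z : Set (ℂ × ℂ)}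
  {R : ℂ × ℂ → X}

lemma IsMeromorphicFamily.isOpen_sdiff {W : Set (ℂ × ℂ)} (hW : IsOpen W)
    (hR : IsMeromorphicFamily W Z R) : IsOpen (W \ Z) := by
  have h := hW.isOpenMap_subtype_val _ hR.isClosed_divisor.isOpen_compl
  rwa [← preimage_compl, Subtype.image_preimage_coe, ← sdiff_eq_compl_inter.trans
    (inter_comm _ _)] at h

lemma IsMeromorphicFamily.eventually_notMem_slice (hΩ : IsOpen Ω)
    (hR : IsMeromorphicFamily (Ω ×ˢ univ) Z R) {w : ℂ} (hw : w ∈ Ω) (z : ℂ) :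
    ∀ᶠ y in 𝓝[≠] z, y ∉ slice Z w := by
  by_cases hz : (w, z) ∈ Z
  · obtain ⟨ρ, ⟨S, D, -, -, hnz, hZ, -⟩, hρ⟩ :=
      ((hR.eventually_quotient hz).and self_mem_nhdsWithin).exists
    have hρ : 0 < ρ := hρ
    filter_upwards [self_mem_nhdsWithin, nhdsWithin_le_nhds (Metric.ball_mem_nhds z hρ)]
      with y hy hyb hyZ
    exact hnz y hyb hy ((hZ (w, y) ⟨Metric.mem_ball_self hρ, hyb⟩).1 hyZ)
  · have h := (hR.isOpen_sdiff (hΩ.prod isOpen_univ)).mem_nhds (x := (w, z))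
      ⟨⟨hw, mem_univ _⟩, hz⟩
    have hc : ContinuousAt (fun y : ℂ => (w, y)) z := by fun_prop
    exact nhdsWithin_le_nhds ((hc.eventually h).mono fun y hy => hy.2)

lemma IsMeromorphicFamily.finite_slice_inter (hΩ : IsOpen Ω)
    (hR : IsMeromorphicFamily (Ω ×ˢ univ) Z R) {w : ℂ} (hw : w ∈ Ω) {K : Set ℂ}
    (hK : IsCompact K) : (slice Z w ∩ K).Finite :=
  IsCompact.finite_inter_of_eventually_notMem hK fun z _ => hR.eventually_notMem_slice hΩ hw z

lemma IsMeromorphicFamily.isClosed_slice (hΩ : IsOpen Ω)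
    (hR : IsMeromorphicFamily (Ω ×ˢ univ) Z R) {w : ℂ} (hw : w ∈ Ω) : IsClosed (slice Z w) :=
  isClosed_of_finite_inter_closedBall fun R => hR.finite_slice_inter hΩ hw (isCompact_closedBall 0
      R)

lemma IsMeromorphicFamily.differentiableOn_slice (hR : IsMeromorphicFamily (Ω ×ˢ univ) Z R)
    {w : ℂ} (hw : w ∈ Ω) : DifferentiableOn ℂ (fun z => R (w, z)) (slice Z w)ᶜ :=
  hR.holomorphic.comp ((differentiableOn_const w).prodMk differentiableOn_id)
    fun _ hz => ⟨⟨hw, mem_univ _⟩, hz⟩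

lemma IsMeromorphicFamily.meromorphicAt_slice [CompleteSpace X] (hΩ : IsOpen Ω)
    (hR : IsMeromorphicFamily (Ω ×ˢ univ) Z R) {w : ℂ} (hw : w ∈ Ω) (z : ℂ) :
    MeromorphicAt (fun y => R (w, y)) z := by
  by_cases hz : (w, z) ∈ Z
  · obtain ⟨ρ, ⟨S, D, hS, hD, hnz, -, hq⟩, hρ⟩ :=
      ((hR.eventually_quotient hz).and self_mem_nhdsWithin).exists
    have hρ : 0 < ρ := hρ
    have hwρ := Metric.mem_ball_self (x := w) hρ
    have h1 := (DifferentiableOn.differentiableOn_slice_right hD hwρ).analyticAt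
      (Metric.ball_mem_nhds z hρ)
    have h2 := (DifferentiableOn.differentiableOn_slice_right hS hwρ).analyticAt
      (Metric.ball_mem_nhds z hρ)
    refine (h1.meromorphicAt.inv.smul h2.meromorphicAt).congr ?_
    filter_upwards [self_mem_nhdsWithin, nhdsWithin_le_nhds (Metric.ball_mem_nhds z hρ)]
      with y hy hyb
    exact (hq (w, y) ⟨hwρ, hyb⟩ (hnz y hyb hy)).symm
  · exact ((hR.differentiableOn_slice hw).analyticAt
      ((hR.isClosed_slice hΩ hw).isOpen_compl.mem_nhds hz)).meromorphicAt

lemma IsMeromorphicFamily.eventually_forall_notMem (hΩ : IsOpen Ω)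
    (hR : IsMeromorphicFamily (Ω ×ˢ univ) Z R) {w₀ : ℂ} (hw₀ : w₀ ∈ Ω) {K : Set ℂ}
    (hK : IsCompact K) (h : Disjoint K (slice Z w₀)) :
    ∀ᶠ w in 𝓝 w₀, Disjoint K (slice Z w) := by
  have := hK.eventually_forall_of_forall_eventually (P := fun w z => (w, z) ∉ Z) (x₀ := w₀)
    fun z hz => ((hR.isOpen_sdiff (hΩ.prod isOpen_univ)).mem_nhds
      ⟨⟨hw₀, mem_univ z⟩, disjoint_left.1 h hz⟩ |> eventually_of_mem) fun q hq => hq.2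
  exact this.mono fun w hw => disjoint_left.2 hw

end family

section bilinear

variable {E₁ E₂ E : Type*} [NormedAddCommGroup E₁] [NormedSpace ℂ E₁] [NormedAddCommGroup E₂]
  [NormedSpace ℂ E₂] [NormedAddCommGroup E] [NormedSpace ℂ E]

lemma ContinuousLinearMap.meromorphicAt₂ (T : E₁ →L[ℂ] E₂ →L[ℂ] E) {f : ℂ → E₁} {g : ℂ → E₂}
    {z : ℂ} (hf : MeromorphicAt f z) (hg : MeromorphicAt g z) :
    MeromorphicAt (fun y => T (f y) (g y)) z := by
  obtain ⟨n, hn⟩ := hf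
  obtain ⟨m, hm⟩ := hg
  refine ⟨n + m, ((T.analyticAt_bilinear _).comp₂ hn hm).congr (.of_forall fun y => ?_)⟩
  simp only [map_smul, smul_apply, smul_smul, pow_add, mul_comm]

end bilinear

section tails

variable {ψ τ : ℝ} {γ : Contour}

lemma HasTails.abs_arg_line (hψ₀ : 0 < ψ) (hψ₁ : ψ < Real.pi) (h : HasTails ψ τ γ) {t : ℝ}
    (ht : τ ≤ |t|) : |(γ.line t).arg| = ψ := by
  rcases le_or_gt 0 t with h0 | h0
  · rw [abs_of_nonneg h0] at ht
    rw [(h.2 t ht).1, Complex.exp_mul_I, Complex.arg_mul_cos_add_sin_mul_I (h.1.trans_le ht)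
      ⟨by linarith, hψ₁.le⟩, abs_of_pos hψ₀]
  · rw [abs_of_neg h0] at ht
    have h1 := (h.2 (-t) ht).2
    rw [neg_neg] at h1
    rw [h1, ← neg_mul, Complex.exp_mul_I, ← Complex.ofReal_neg ψ,
      Complex.arg_mul_cos_add_sin_mul_I (h.1.trans_le ht)
      ⟨by linarith, by linarith⟩, abs_neg, abs_of_pos hψ₀]

lemma HasTails.norm_deriv_line (h : HasTails ψ τ γ) {t : ℝ} (ht : τ < |t|) :
    ‖deriv γ.line t‖ = 1 := by
  have hs : ∀ᶠ s : ℝ in 𝓝 t, τ < |s| := continuous_abs.continuousAt.eventually (lt_mem_nhds ht)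
  have hid : ∀ c : ℂ, HasDerivAt (fun s : ℝ => (s : ℂ) * c) c t := fun c => by
    simpa using (hasDerivAt_id t).ofReal_comp.mul_const c
  rcases lt_trichotomy t 0 with h0 | h0 | h0
  · have h2 : γ.line =ᶠ[𝓝 t] fun s : ℝ => (s : ℂ) * -Complex.exp (-(ψ * Complex.I)) := by
      filter_upwards [hs, gt_mem_nhds h0] with s h3 h4
      rw [abs_of_neg h4] at h3
      have h1 := (h.2 (-s) h3.le).2
      rw [neg_neg] at h1
      rw [h1]
      push_cast
      ring
    rw [h2.deriv_eq, (hid _).deriv, norm_neg, ← neg_mul, ← Complex.ofReal_neg,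
      Complex.norm_exp_ofReal_mul_I]
  · rw [h0, abs_zero] at ht
    exact absurd h.1 ht.not_gt
  · have h2 : γ.line =ᶠ[𝓝 t] fun s : ℝ => (s : ℂ) * Complex.exp (ψ * Complex.I) := by
      filter_upwards [hs, lt_mem_nhds h0] with s h3 h4
      rw [abs_of_pos h4] at h3
      exact (h.2 s h3.le).1
    rw [h2.deriv_eq, (hid _).deriv, Complex.norm_exp_ofReal_mul_I]

end tails

/-! ### Pairs of decaying families and stability of admissible contours -/

/-- Two meromorphic families which decay in complementary sectors. -/
structure IsDecayingPair {E₁ E₂ : Type*} [NormedAddCommGroup E₁] [NormedSpace ℂ E₁]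
    [NormedAddCommGroup E₂] [NormedSpace ℂ E₂] (Ω : Set ℂ) (ψ : ℝ) (Z₁ Z₂ : Set (ℂ × ℂ))
    (R₁ : ℂ × ℂ → E₁) (R₂ : ℂ × ℂ → E₂) : Prop where
  isOpen : IsOpen Ω
  angle_pos : 0 < ψ
  angle_lt : ψ < Real.pi
  left : IsMeromorphicFamily (Ω ×ˢ univ) Z₁ R₁
  right : IsMeromorphicFamily (Ω ×ˢ univ) Z₂ R₂
  decay : DecaysInSectors Ω ψ Z₁ Z₂ R₁ R₂

namespace IsDecayingPair

variable {E₁ E₂ E : Type*} [NormedAddCommGroup E₁] [NormedSpace ℂ E₁] [NormedAddCommGroup E₂]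
  [NormedSpace ℂ E₂] [NormedAddCommGroup E] [NormedSpace ℂ E] {Ω : Set ℂ} {ψ : ℝ}
  {Z₁ Z₂ : Set (ℂ × ℂ)} {R₁ : ℂ × ℂ → E₁} {R₂ : ℂ × ℂ → E₂}

lemma eventually_decay (h : IsDecayingPair Ω ψ Z₁ Z₂ R₁ R₂) {w₀ : ℂ} (hw₀ : w₀ ∈ Ω) :
    ∃ C ρ : ℝ, 0 < ρ ∧ ∀ᶠ w in 𝓝 w₀, w ∈ Ω ∧ ∀ l : ℂ, ρ ≤ ‖l‖ →
      (|l.arg| ≤ ψ → (w, l) ∉ Z₁ ∧ ‖R₁ (w, l)‖ ≤ C / ‖l‖) ∧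
      (ψ ≤ |l.arg| → (w, l) ∉ Z₂ ∧ ‖R₂ (w, l)‖ ≤ C / ‖l‖) := by
  obtain ⟨r, hr, hsub⟩ := Metric.nhds_basis_closedBall.mem_iff.1 (h.isOpen.mem_nhds hw₀)
  obtain ⟨C, ρ, hρ, hC⟩ := h.decay _ (isCompact_closedBall w₀ r) hsub
  refine ⟨C, ρ, hρ, ?_⟩
  filter_upwards [Metric.closedBall_mem_nhds w₀ hr] with w hw using ⟨hsub hw, hC w hw⟩

/-- Poles cannot enter the compact part of the complement of `V` for `w` close to `w₀`. Far out, the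
complement lies in the sector where the decay condition excludes poles, uniformly in `w`. -/
lemma eventually_slice_left_subset (h : IsDecayingPair Ω ψ Z₁ Z₂ R₁ R₂) {w₀ : ℂ} (hw₀ : w₀ ∈ Ω)
    {V : Set ℂ} (hV : IsOpen V) (hsub : slice Z₁ w₀ ⊆ V) {M : ℝ}
    (hM : ∀ z : ℂ, M ≤ ‖z‖ → z ∉ V → |z.arg| ≤ ψ) : ∀ᶠ w in 𝓝 w₀, slice Z₁ w ⊆ V := by
  obtain ⟨C, ρ, hρ, hC⟩ := h.eventually_decay hw₀
  have hd : Disjoint (Metric.closedBall 0 (max M ρ) \ V) (slice Z₁ w₀) :=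
    disjoint_left.2 fun z hz hz' => hz.2 (hsub hz')
  filter_upwards [hC, h.left.eventually_forall_notMem h.isOpen hw₀
    ((isCompact_closedBall 0 _).diff hV) hd] with w h1 h2 z hz
  by_contra hzV
  rcases le_or_gt ‖z‖ (max M ρ) with h3 | h3
  · exact disjoint_left.1 h2 ⟨mem_closedBall_zero_iff.2 h3, hzV⟩ hz
  · exact ((h1.2 z ((le_max_right _ _).trans h3.le)).1
      (hM z ((le_max_left _ _).trans h3.le) hzV)).1 hz

lemma eventually_slice_right_subset (h : IsDecayingPair Ω ψ Z₁ Z₂ R₁ R₂) {w₀ : ℂ} (hw₀ : w₀ ∈ Ω)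
    {V : Set ℂ} (hV : IsOpen V) (hsub : slice Z₂ w₀ ⊆ V) {M : ℝ}
    (hM : ∀ z : ℂ, M ≤ ‖z‖ → z ∉ V → ψ ≤ |z.arg|) : ∀ᶠ w in 𝓝 w₀, slice Z₂ w ⊆ V := by
  obtain ⟨C, ρ, hρ, hC⟩ := h.eventually_decay hw₀
  have hd : Disjoint (Metric.closedBall 0 (max M ρ) \ V) (slice Z₂ w₀) :=
    disjoint_left.2 fun z hz hz' => hz.2 (hsub hz')
  filter_upwards [hC, h.right.eventually_forall_notMem h.isOpen hw₀
    ((isCompact_closedBall 0 _).diff hV) hd] with w h1 h2 z hz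
  by_contra hzV
  rcases le_or_gt ‖z‖ (max M ρ) with h3 | h3
  · exact disjoint_left.1 h2 ⟨mem_closedBall_zero_iff.2 h3, hzV⟩ hz
  · exact ((h1.2 z ((le_max_right _ _).trans h3.le)).2
      (hM z ((le_max_left _ _).trans h3.le) hzV)).1 hz

/-- A contour which separates the poles of the two families, where the common poles are put to its
right. -/
lemma exists_separates (h : IsDecayingPair Ω ψ Z₁ Z₂ R₁ R₂) {w₀ : ℂ} (hw₀ : w₀ ∈ Ω) :
    ∃ (N : Finset ℂ) (τ : ℝ) (γ : Contour) (Γ₁ Γ₂ : Set ℂ),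
      (∀ z, z ∈ N ↔ (w₀, z) ∈ Z₁ ∧ (w₀, z) ∈ Z₂) ∧ HasTails ψ τ γ ∧ Separates γ Γ₁ Γ₂ ∧
      IsSectorial ψ Γ₁ Γ₂ ∧ slice Z₁ w₀ ⊆ Γ₁ ∪ N ∧ slice Z₂ w₀ ⊆ Γ₂ := by
  obtain ⟨C, ρ, hρ, hC⟩ := h.eventually_decay hw₀
  have hC := hC.self_of_nhds.2
  have h1 : ∀ z ∈ slice Z₁ w₀, ρ ≤ ‖z‖ → ψ < |z.arg| := fun z hz hzρ => by
    by_contra! h2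
    exact ((hC z hzρ).1 h2).1 hz
  have h2 : ∀ z ∈ slice Z₂ w₀, ρ ≤ ‖z‖ → |z.arg| < ψ := fun z hz hzρ => by
    by_contra! h2
    exact ((hC z hzρ).2 h2).1 hz
  have f1 := fun r : ℝ => h.left.finite_slice_inter h.isOpen hw₀ (isCompact_closedBall 0 r)
  have f2 := fun r : ℝ => h.right.finite_slice_inter h.isOpen hw₀ (isCompact_closedBall 0 r)
  -- Outside the disc of radius `ρ` the two pole sets lie in disjoint open sectors, so common poles
  -- are confined to this disc.
  have hfin : (slice Z₁ w₀ ∩ slice Z₂ w₀).Finite := (f1 ρ).subset fun z hz => by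
    refine ⟨hz.1, mem_closedBall_zero_iff.2 ?_⟩
    by_contra! h3
    exact lt_asymm (h1 z hz.1 h3.le) (h2 z hz.2 h3.le)
  obtain ⟨τ, γ, Γ₁, Γ₂, ht, hs, hsec, hs1, hs2⟩ := SepMer.exists_separates h.angle_pos h.angle_lt
    (P₁ := slice Z₁ w₀ \ slice Z₂ w₀) (fun r => (f1 r).subset (inter_subset_inter_left _
      sdiff_subset))
    f2 disjoint_sdiff_left hρ (fun z hz => h1 z hz.1) h2
  refine ⟨hfin.toFinset, τ, γ, Γ₁, Γ₂, fun z => hfin.mem_toFinset, ht, hs, hsec, fun z hz => ?_,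
      hs2⟩
  by_cases hz2 : z ∈ slice Z₂ w₀
  · exact Or.inr (hfin.mem_toFinset.2 ⟨hz, hz2⟩)
  · exact Or.inl (hs1 ⟨hz, hz2⟩)

/-- At a regular point there are no common poles, so the separating contour is admissible. Since the
regions contain the poles stably, the same contour serves all nearby `w`. -/
lemma exists_isAdmissible (h : IsDecayingPair Ω ψ Z₁ Z₂ R₁ R₂) {w₀ : ℂ}
    (hw₀ : w₀ ∈ regularPoints Ω Z₁ Z₂) : ∃ γ τ, HasTails ψ τ γ ∧
      ∀ᶠ w in 𝓝 w₀, IsAdmissible ψ (slice Z₁ w) (slice Z₂ w) γ := by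
  obtain ⟨N, τ, γ, Γ₁, Γ₂, hN, hτ, hs, ⟨M, hM⟩, hs₁, hs₂⟩ := h.exists_separates hw₀.1
  have hs₁ : slice Z₁ w₀ ⊆ Γ₁ := fun z hz => (hs₁ hz).resolve_right fun hz' =>
    disjoint_left.1 hw₀.2 ((hN z).1 hz').1 ((hN z).1 hz').2
  refine ⟨γ, τ, hτ, ?_⟩
  filter_upwards [h.eventually_slice_left_subset hw₀.1 hs.isOpen_left hs₁ fun z hz => (hM z hz).1,
    h.eventually_slice_right_subset hw₀.1 hs.isOpen_right hs₂ fun z hz => (hM z hz).2] with w h1 h2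
  exact isAdmissible_iff.2 ⟨τ, Γ₁, Γ₂, hτ, hs, h1, h2⟩

end IsDecayingPair

end SepMer


/-! ### Convergence, independence and holomorphy of the contour integral -/

namespace SepMer

section parametric

variable {E : Type*} [NormedAddCommGroup E] [NormedSpace ℂ E] {ψ τ C ρ : ℝ} {γ : Contour}
  {F : ℂ × ℂ → E} {U : Set ℂ}

/-- On the tails the speed is `1` and `‖γ.line t‖ = |t|`, so quadratic decay of `F` gives a multiple
of `1 / (1 + t ^ 2)`. The rest of the line is compact. -/
lemma HasTails.exists_dominating (hτ : HasTails ψ τ γ) (hU : IsOpen U)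
    (hF : ContinuousOn F (U ×ˢ γ.image))
    (hC : ∀ w ∈ U, ∀ z ∈ γ.image, ρ ≤ ‖z‖ → ‖F (w, z)‖ ≤ C / ‖z‖ ^ 2) {w₀ : ℂ} (hw₀ : w₀ ∈ U) :
    ∃ r > 0, Metric.closedBall w₀ r ⊆ U ∧ ∃ g : ℝ → ℝ, Integrable g ∧
      ∀ w ∈ Metric.closedBall w₀ r, ∀ t, ‖deriv γ.line t • F (w, γ.line t)‖ ≤ g t := by
  set T := max (τ + 1) (max ρ 1) with hT
  have hTτ : τ < T := (lt_add_one τ).trans_le (le_max_left _ _)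
  have hTρ : ρ ≤ T := (le_max_left _ _).trans (le_max_right _ _)
  have hT1 : 1 ≤ T := (le_max_right _ _).trans (le_max_right _ _)
  have hK : IsCompact (γ.line '' Icc (-T) T) := isCompact_Icc.image γ.line_contDiff.continuous
  obtain ⟨r, hr, hsub, B, hB⟩ := exists_ball_bound hK hU
    (hF.mono (prod_mono_right (image_subset_iff.2 fun t _ => γ.line_mem_image t))) hw₀
  obtain ⟨D, hD⟩ := (isCompact_Icc (a := -T) (b := T)).exists_bound_of_continuousOn
    (γ.line_contDiff.continuous_deriv le_rfl).continuousOn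
  refine ⟨r, hr, hsub, fun t => (|D * B| * (1 + T ^ 2) + 2 * |C|) * (1 + t ^ 2)⁻¹,
    integrable_inv_one_add_sq.const_mul _, fun w hw t => ?_⟩
  have h1 : 0 < 1 + t ^ 2 := by positivity
  simp only
  rw [← div_eq_mul_inv, le_div_iff₀ h1, norm_smul]
  rcases le_or_gt |t| T with ht | ht
  · have ht' := abs_le.1 ht
    have h2 : ‖deriv γ.line t‖ * ‖F (w, γ.line t)‖ ≤ |D * B| :=
      (mul_le_mul (hD t ht') (hB w hw _ (mem_image_of_mem _ ht')) (norm_nonneg _)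
        ((norm_nonneg _).trans (hD t ht'))).trans (le_abs_self _)
    have h3 : t ^ 2 ≤ T ^ 2 := sq_le_sq' ht'.1 ht'.2
    calc _ ≤ |D * B| * (1 + T ^ 2) := by gcongr
      _ ≤ _ := le_add_of_nonneg_right (by positivity)
  · have hn := hτ.norm_line (hTτ.le.trans ht.le)
    have h2 := hC w (hsub hw) _ (γ.line_mem_image t) (by rw [hn]; exact hTρ.trans ht.le)
    rw [hτ.norm_deriv_line (hTτ.trans ht), one_mul]
    rw [hn, sq_abs] at h2
    have h3 : 1 ≤ t ^ 2 := by rw [← sq_abs]; exact one_le_pow₀ (hT1.trans ht.le)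
    have h0 : t ≠ 0 := by rintro rfl; norm_num at h3
    have h4 : C / t ^ 2 ≤ |C| / t ^ 2 := by gcongr; exact le_abs_self C
    calc _ ≤ |C| / t ^ 2 * (t ^ 2 + t ^ 2) := by
          refine mul_le_mul (h2.trans h4) (by gcongr) h1.le (by positivity)
      _ = 2 * |C| := by
          have h5 : t ^ 2 ≠ 0 := by positivity
          rw [← two_mul, mul_left_comm, div_mul_cancel₀ _ h5]
      _ ≤ _ := le_add_of_nonneg_left (by positivity)

lemma HasTails.integrableAlong (hτ : HasTails ψ τ γ) (hU : IsOpen U)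
    (hF : ContinuousOn F (U ×ˢ γ.image))
    (hC : ∀ w ∈ U, ∀ z ∈ γ.image, ρ ≤ ‖z‖ → ‖F (w, z)‖ ≤ C / ‖z‖ ^ 2) {w : ℂ} (hw : w ∈ U) :
    γ.IntegrableAlong fun z => F (w, z) := by
  obtain ⟨r, hr, hsub, g, hg, hgb⟩ := hτ.exists_dominating hU hF hC hw
  have hFw : ContinuousOn (fun z => F (w, z)) γ.image :=
    hF.comp (by fun_prop) fun z hz => ⟨hw, hz⟩
  refine ⟨hg.mono' ?_ (.of_forall (hgb w (Metric.mem_closedBall_self hr.le))), fun i => ?_⟩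
  · exact ((γ.line_contDiff.continuous_deriv le_rfl).smul
      (hFw.comp_continuous γ.line_contDiff.continuous γ.line_mem_image)).aestronglyMeasurable
  · exact (((γ.loop_contDiff i).continuous_deriv le_rfl).smul
      (hFw.comp_continuous (γ.loop_contDiff i).continuous (γ.loop_mem_image i))).intervalIntegrable
        _ _

lemma HasTails.analyticAt_integral [CompleteSpace E] (hτ : HasTails ψ τ γ) (hU : IsOpen U)
    (hF : ContinuousOn F (U ×ˢ γ.image)) (hd : ∀ z ∈ γ.image, DifferentiableOn ℂ (fun w => F (w,
      z)) U)
    (hC : ∀ w ∈ U, ∀ z ∈ γ.image, ρ ≤ ‖z‖ → ‖F (w, z)‖ ≤ C / ‖z‖ ^ 2) {w₀ : ℂ} (hw₀ : w₀ ∈ U) :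
    AnalyticAt ℂ (fun w => γ.integral fun z => F (w, z)) w₀ := by
  have hFw : ∀ w ∈ U, ContinuousOn (fun z => F (w, z)) γ.image := fun w hw =>
    hF.comp (by fun_prop) fun z hz => ⟨hw, hz⟩
  have hline : AnalyticAt ℂ (fun w => ∫ t, deriv γ.line t • F (w, γ.line t)) w₀ := by
    obtain ⟨r, hr, hsub, g, hg, hgb⟩ := hτ.exists_dominating hU hF hC hw₀
    have hsub' := Metric.ball_subset_closedBall.trans hsub
    refine (differentiableOn_integral_of_dominated Metric.isOpen_ball (fun w hw => ?_)
      (.of_forall fun t => ?_) (.of_forall fun t w hw => hgb w (Metric.ball_subset_closedBall hw) t)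
      hg).analyticAt (Metric.ball_mem_nhds w₀ hr)
    · exact ((γ.line_contDiff.continuous_deriv le_rfl).smul ((hFw w (hsub' hw)).comp_continuous
        γ.line_contDiff.continuous γ.line_mem_image)).aestronglyMeasurable
    · exact ((hd _ (γ.line_mem_image t)).mono hsub').const_smul _
  have hloop : ∀ i, AnalyticAt ℂ
      (fun w => ∫ t in (0 : ℝ)..1, deriv (γ.loop i) t • F (w, γ.loop i t)) w₀ := by
    intro i
    obtain ⟨r, hr, hsub, B, hB⟩ := exists_ball_bound (γ.isCompact_range_loop i) hU
      (hF.mono (prod_mono_right (range_subset_iff.2 (γ.loop_mem_image i)))) hw₀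
    have hsub' := Metric.ball_subset_closedBall.trans hsub
    have hcd := (γ.loop_contDiff i).continuous_deriv le_rfl
    simp only [intervalIntegral.integral_of_le zero_le_one]
    refine (differentiableOn_integral_of_dominated (g := fun t => ‖deriv (γ.loop i) t‖ * B)
      Metric.isOpen_ball (fun w hw => ?_)
      (.of_forall fun t => ?_) (.of_forall fun t w hw => ?_) ?_).analyticAt
        (Metric.ball_mem_nhds w₀ hr)
    · exact (hcd.smul ((hFw w (hsub' hw)).comp_continuous
        (γ.loop_contDiff i).continuous (γ.loop_mem_image i))).aestronglyMeasurable
    · exact ((hd _ (γ.loop_mem_image i t)).mono hsub').const_smul _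
    · rw [norm_smul]
      gcongr
      exact hB w (Metric.ball_subset_closedBall hw) _ ⟨t, rfl⟩
    · exact (hcd.norm.mul continuous_const).integrableOn_Ioc
  exact hline.fun_add (Finset.analyticAt_fun_sum _ fun i _ => hloop i)

end parametric

namespace IsDecayingPair

variable {E₁ E₂ E : Type*} [NormedAddCommGroup E₁] [NormedSpace ℂ E₁] [NormedAddCommGroup E₂]
  [NormedSpace ℂ E₂] [NormedAddCommGroup E] [NormedSpace ℂ E] {Ω : Set ℂ} {ψ τ : ℝ}
  {Z₁ Z₂ : Set (ℂ × ℂ)} {R₁ : ℂ × ℂ → E₁} {R₂ : ℂ × ℂ → E₂} {γ γ' : Contour}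

/-- Near a point whose poles avoid the contour, the product of the families is continuous and
decays quadratically along the contour. -/
lemma exists_nhds (h : IsDecayingPair Ω ψ Z₁ Z₂ R₁ R₂) (T : E₁ →L[ℂ] E₂ →L[ℂ] E) {w₀ : ℂ}
    (hw₀ : w₀ ∈ Ω) (hτ : HasTails ψ τ γ) (hd₁ : Disjoint γ.image (slice Z₁ w₀))
    (hd₂ : Disjoint γ.image (slice Z₂ w₀)) :
    ∃ U : Set ℂ, IsOpen U ∧ w₀ ∈ U ∧
      ContinuousOn (fun q => T (R₁ q) (R₂ q)) (U ×ˢ γ.image) ∧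
      (∀ z ∈ γ.image, DifferentiableOn ℂ (fun w => T (R₁ (w, z)) (R₂ (w, z))) U) ∧
      ∃ C ρ : ℝ, ∀ w ∈ U, ∀ z ∈ γ.image, ρ ≤ ‖z‖ → ‖T (R₁ (w, z)) (R₂ (w, z))‖ ≤ C / ‖z‖ ^ 2 := by
  obtain ⟨C, ρ, hρ, hC⟩ := h.eventually_decay hw₀
  set M := max ρ τ with hM
  -- The rays belong to both closed sectors, so both decay estimates hold on them, and their product
  -- is `O(1 / ‖z‖ ^ 2)`.
  have htail : ∀ z ∈ γ.image, z ∉ γ.truncImage M → |z.arg| = ψ ∧ ρ ≤ ‖z‖ := by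
    rintro z (⟨t, rfl⟩ | hz) hzM
    · have ht : M < |t| := by
        by_contra! ht
        refine hzM (Contour.line_mem_truncImage ?_)
        rw [uIcc_of_le (neg_le_self (hτ.1.le.trans (le_max_right _ _)))]
        exact abs_le.1 ht
      have ht' := (le_max_right ρ τ).trans ht.le
      exact ⟨hτ.abs_arg_line h.angle_pos h.angle_lt ht',
        by rw [hτ.norm_line ht']; exact (le_max_left ρ τ).trans ht.le⟩
    · obtain ⟨i, t, rfl⟩ := mem_iUnion.1 hz
      exact absurd (Contour.loop_mem_truncImage i t) hzM
  have hKc : IsCompact (γ.truncImage M) := γ.isCompact_truncImage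
  have hKs : γ.truncImage M ⊆ γ.image := Contour.truncImage_subset_image
  obtain ⟨r, hr, hball⟩ := Metric.nhds_basis_ball.mem_iff.1
    (hC.and ((h.left.eventually_forall_notMem h.isOpen hw₀ hKc (hd₁.mono_left hKs)).and
      (h.right.eventually_forall_notMem h.isOpen hw₀ hKc (hd₂.mono_left hKs))))
  have hZ : ∀ w ∈ Metric.ball w₀ r, ∀ z ∈ γ.image, (w, z) ∉ Z₁ ∧ (w, z) ∉ Z₂ := by
    intro w hw z hz
    obtain ⟨⟨-, h1⟩, h2, h3⟩ := hball hw
    by_cases hzM : z ∈ γ.truncImage M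
    · exact ⟨disjoint_left.1 h2 hzM, disjoint_left.1 h3 hzM⟩
    · obtain ⟨h4, h5⟩ := htail z hz hzM
      exact ⟨((h1 z h5).1 h4.le).1, ((h1 z h5).2 h4.ge).1⟩
  have hs₁ : Metric.ball w₀ r ×ˢ γ.image ⊆ Ω ×ˢ univ \ Z₁ := fun q hq =>
    ⟨⟨(hball hq.1).1.1, mem_univ _⟩, (hZ q.1 hq.1 q.2 hq.2).1⟩
  have hs₂ : Metric.ball w₀ r ×ˢ γ.image ⊆ Ω ×ˢ univ \ Z₂ := fun q hq =>
    ⟨⟨(hball hq.1).1.1, mem_univ _⟩, (hZ q.1 hq.1 q.2 hq.2).2⟩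
  have hd : DifferentiableOn ℂ (fun q => T (R₁ q) (R₂ q)) (Metric.ball w₀ r ×ˢ γ.image) :=
    (T.differentiable.comp_differentiableOn (h.left.holomorphic.mono hs₁)).clm_apply
      (h.right.holomorphic.mono hs₂)
  obtain ⟨B, hB⟩ := hKc.isBounded.subset_ball (0 : ℂ)
  refine ⟨Metric.ball w₀ r, Metric.isOpen_ball, Metric.mem_ball_self hr, hd.continuousOn,
    fun z hz => DifferentiableOn.differentiableOn_slice_left hd hz, ‖T‖ * C ^ 2, B, fun w hw z hz
      hzB => ?_⟩
  obtain ⟨h4, h5⟩ := htail z hz fun h' => (mem_ball_zero_iff.1 (hB h')).not_ge hzB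
  have h1 := (hball hw).1.2 z h5
  have b1 := (h1.1 h4.le).2
  have b2 := (h1.2 h4.ge).2
  calc _ ≤ ‖T‖ * ‖R₁ (w, z)‖ * ‖R₂ (w, z)‖ := T.le_opNorm₂ _ _
    _ ≤ ‖T‖ * (C / ‖z‖) * (C / ‖z‖) := by
        have := (norm_nonneg _).trans b1
        gcongr
    _ = _ := by ring

lemma integrableAlong (h : IsDecayingPair Ω ψ Z₁ Z₂ R₁ R₂) (T : E₁ →L[ℂ] E₂ →L[ℂ] E) {w : ℂ}
    (hw : w ∈ Ω) (hγ : IsAdmissible ψ (slice Z₁ w) (slice Z₂ w) γ) :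
    γ.IntegrableAlong fun z => T (R₁ (w, z)) (R₂ (w, z)) := by
  obtain ⟨τ, Γ₁, Γ₂, hτ, hs, h1, h2⟩ := isAdmissible_iff.1 hγ
  obtain ⟨U, hU, hwU, hF, -, C, ρ, hC⟩ := h.exists_nhds T hw hτ
    (disjoint_left.2 fun z hz hz' => hs.notMem_left (h1 hz') hz)
    (disjoint_left.2 fun z hz hz' => hs.notMem_right (h2 hz') hz)
  exact hτ.integrableAlong (F := fun q => T (R₁ q) (R₂ q)) hU hF hC hwU

lemma integral_eq [CompleteSpace E₁] [CompleteSpace E₂] [CompleteSpace E]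
    (h : IsDecayingPair Ω ψ Z₁ Z₂ R₁ R₂) (T : E₁ →L[ℂ] E₂ →L[ℂ] E) {w : ℂ}
    (hw : w ∈ Ω) (hγ : IsAdmissible ψ (slice Z₁ w) (slice Z₂ w) γ)
    (hγ' : IsAdmissible ψ (slice Z₁ w) (slice Z₂ w) γ') :
    (γ.integral fun z => T (R₁ (w, z)) (R₂ (w, z))) =
      γ'.integral fun z => T (R₁ (w, z)) (R₂ (w, z)) := by
  have hi := h.integrableAlong T hw hγ
  have hi' := h.integrableAlong T hw hγ'
  obtain ⟨τ, Γ₁, Γ₂, hτ, hs, h1, h2⟩ := isAdmissible_iff.1 hγ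
  obtain ⟨τ', Γ₁', Γ₂', hτ', hs', h1', h2'⟩ := isAdmissible_iff.1 hγ'
  -- Beyond the larger of the two thresholds the parametrised tails of both contours agree.
  refine Separates.integral_eq hs hs' (hτ.mono (le_max_left τ τ')) (hτ'.mono (le_max_right τ τ'))
    (P := slice Z₁ w ∪ slice Z₂ w) ?_ (fun R => ?_) ?_ ?_ hi hi'
  · rintro z (hz | hz)
    · exact Or.inl ⟨h1 hz, h1' hz⟩
    · exact Or.inr ⟨h2 hz, h2' hz⟩
  · rw [union_inter_distrib_right]
    exact (h.left.finite_slice_inter h.isOpen hw (isCompact_closedBall 0 R)).union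
      (h.right.finite_slice_inter h.isOpen hw (isCompact_closedBall 0 R))
  · rw [compl_union]
    exact (T.differentiable.comp_differentiableOn ((h.left.differentiableOn_slice hw).mono
      inter_subset_left)).clm_apply ((h.right.differentiableOn_slice hw).mono inter_subset_right)
  · exact fun z _ => ContinuousLinearMap.meromorphicAt₂ T (h.left.meromorphicAt_slice h.isOpen hw z)
      (h.right.meromorphicAt_slice h.isOpen hw z)

lemma analyticAt_integral [CompleteSpace E]
    (h : IsDecayingPair Ω ψ Z₁ Z₂ R₁ R₂) (T : E₁ →L[ℂ] E₂ →L[ℂ] E) {w₀ : ℂ}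
    (hw₀ : w₀ ∈ Ω) (hτ : HasTails ψ τ γ) (hd₁ : Disjoint γ.image (slice Z₁ w₀))
    (hd₂ : Disjoint γ.image (slice Z₂ w₀)) :
    AnalyticAt ℂ (fun w => γ.integral fun z => T (R₁ (w, z)) (R₂ (w, z))) w₀ := by
  obtain ⟨U, hU, hwU, hF, hd, C, ρ, hC⟩ := h.exists_nhds T hw₀ hτ hd₁ hd₂
  exact hτ.analyticAt_integral (F := fun q => T (R₁ q) (R₂ q)) hU hF hd hC hwU

/-- A family given by contour integrals is holomorphic at the regular points. -/
lemma analyticAt_of_eq_integral [CompleteSpace E] (h : IsDecayingPair Ω ψ Z₁ Z₂ R₁ R₂)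
    (T : E₁ →L[ℂ] E₂ →L[ℂ] E)
    (hopen : IsOpen (regularPoints Ω Z₁ Z₂)) {R : ℂ → E}
    (hR : ∀ w ∈ regularPoints Ω Z₁ Z₂, ∀ γ, IsAdmissible ψ (slice Z₁ w) (slice Z₂ w) γ →
      R w = (2 * Real.pi * Complex.I : ℂ)⁻¹ • γ.integral fun z => T (R₁ (w, z)) (R₂ (w, z)))
    {w₀ : ℂ} (hw₀ : w₀ ∈ regularPoints Ω Z₁ Z₂) : AnalyticAt ℂ R w₀ := by
  obtain ⟨γ, τ, hτ, hγ⟩ := h.exists_isAdmissible hw₀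
  obtain ⟨τ', Γ₁, Γ₂, -, hs, h1, h2⟩ := isAdmissible_iff.1 hγ.self_of_nhds
  have han := h.analyticAt_integral T hw₀.1 hτ
    (disjoint_left.2 fun z hz hz' => hs.notMem_left (h1 hz') hz)
    (disjoint_left.2 fun z hz hz' => hs.notMem_right (h2 hz') hz)
  refine (analyticAt_const (v := (2 * Real.pi * Complex.I : ℂ)⁻¹)).smul han |>.congr ?_
  filter_upwards [hγ, hopen.mem_nhds hw₀] with w h3 h4 using (hR w h4 γ h3).symm

end IsDecayingPair

end SepMer


/-! ### Local structure of the non-regular set and meromorphy -/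

namespace SepMer

namespace IsDecayingPair

variable {H₁ H₂ H : Type*} [NormedAddCommGroup H₁] [NormedSpace ℂ H₁] [CompleteSpace H₁]
  [NormedAddCommGroup H₂] [NormedSpace ℂ H₂] [CompleteSpace H₂]
  [NormedAddCommGroup H] [NormedSpace ℂ H] [CompleteSpace H]
  {Ω : Set ℂ} {ψ : ℝ} {Z₁ Z₂ : Set (ℂ × ℂ)} {R₁ : ℂ × ℂ → H₁ →L[ℂ] H₁} {R₂ : ℂ × ℂ → H₂ →L[ℂ] H₂}

/-- The configuration near a point `w₀`: a contour separating the poles of `R₁` and `R₂` except for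
the common poles `p ∈ N`, and discs of radius `r p` about them, to the right of the contour, which
    contain the
remaining poles of `R₁` for `w` near `w₀`. The residues there add up to a meromorphic family, up to
a bounded part. -/
lemma exists_configuration (h : IsDecayingPair Ω ψ Z₁ Z₂ R₁ R₂)
    (T : (H₁ →L[ℂ] H₁) →L[ℂ] (H₂ →L[ℂ] H₂) →L[ℂ] (H →L[ℂ] H))
    (hT : ∀ A B, FiniteDimensional ℂ (LinearMap.range A.toLinearMap) →
      FiniteDimensional ℂ (LinearMap.range B.toLinearMap) →
      FiniteDimensional ℂ (LinearMap.range (T A B).toLinearMap))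
    (hfin₁ : HasPolesOfFiniteRank Z₁ R₁) (hfin₂ : HasPolesOfFiniteRank Z₂ R₂) {w₀ : ℂ}
    (hw₀ : w₀ ∈ Ω) :
    ∃ (N : Finset ℂ) (τ : ℝ) (γ : Contour) (Γ₁ Γ₂ : Set ℂ) (r : ℂ → ℝ) (f : ℂ → ℂ → ℂ),
      HasTails ψ τ γ ∧ Separates γ Γ₁ Γ₂ ∧ slice Z₁ w₀ ⊆ Γ₁ ∪ Γ₂ ∧ slice Z₂ w₀ ⊆ Γ₂ ∧
      (∀ p ∈ N, Metric.closedBall p (r p) ⊆ Γ₂) ∧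
      (∀ p ∈ N, ∀ q ∈ N, p ≠ q → Disjoint (Metric.closedBall p (r p)) (Metric.closedBall q (r q))) ∧
      (∀ᶠ w in 𝓝 w₀, slice Z₁ w ⊆ Γ₁ ∪ ⋃ p ∈ N, Metric.ball p (r p)) ∧
      (∀ᶠ w in 𝓝 w₀, slice Z₂ w ⊆ Γ₂) ∧
      (∀ p ∈ N, AnalyticAt ℂ (f p) w₀) ∧
      (∀ᶠ w in 𝓝 w₀, w ∈ regularPoints Ω Z₁ Z₂ ↔ ∀ p ∈ N, f p w ≠ 0) ∧
      (∀ p ∈ N, (¬ ∀ᶠ w in 𝓝 w₀, f p w = 0) → ∃ (M : ℂ → H →L[ℂ] H) (C : ℝ),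
        HasFiniteRankPrincipalPartAt M w₀ ∧
        ∀ᶠ w in 𝓝[≠] w₀, ∀ S : Finset ℂ,
          (∀ z, z ∈ S ↔ z ∈ Metric.closedBall p (r p) ∧ (w, z) ∈ Z₁) →
          (∀ b ∈ S, b ∈ Metric.ball p (r p)) ∧ ∀ᶠ ε in 𝓝[>] 0,
            ‖(∑ b ∈ S, ∮ z in C(b, ε), T (R₁ (w, z)) (R₂ (w, z))) - M w‖ ≤ C) := by
  obtain ⟨N, τ, γ, Γ₁, Γ₂, hN, hτ, hs, hsec, hs₁, hs₂⟩ := h.exists_separates hw₀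
  have hN₂ : ∀ p ∈ N, Γ₂ ∈ 𝓝 p := fun p hp => hs.isOpen_right.mem_nhds (hs₂ ((hN p).1 hp).2)
  have hball : ∀ᶠ ε : ℝ in 𝓝[>] 0, ∀ p ∈ N, Metric.closedBall p ε ⊆ Γ₂ := by
    rw [eventually_all_finset]
    exact fun p hp => eventually_closedBall_subset (hN₂ p hp)
  -- The radius `η` keeps the discs about the common poles disjoint and to the right of the contour.
  -- The residue discs are chosen inside them.
  obtain ⟨η, ⟨hη₁, hη₂⟩, hη : 0 < η⟩ :=
    ((hball.and (eventually_disjoint_closedBall N)).and self_mem_nhdsWithin).exists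
  have hres : ∀ p : ℂ, ∃ r > 0, r < η ∧ ∃ f : ℂ → ℂ, p ∈ N → AnalyticAt ℂ f w₀ ∧
      (∀ᶠ w in 𝓝 w₀, f w = 0 ↔ ∃ z ∈ Metric.closedBall p r, (w, z) ∈ Z₁ ∧ (w, z) ∈ Z₂) ∧
      ((¬ ∀ᶠ w in 𝓝 w₀, f w = 0) →
        ∃ (M : ℂ → H →L[ℂ] H) (C : ℝ),
          HasFiniteRankPrincipalPartAt M w₀ ∧
          ∀ᶠ w in 𝓝[≠] w₀, ∀ S : Finset ℂ,
            (∀ z, z ∈ S ↔ z ∈ Metric.closedBall p r ∧ (w, z) ∈ Z₁) →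
            (∀ b ∈ S, b ∈ Metric.ball p r) ∧ ∀ᶠ ε in 𝓝[>] 0,
              ‖(∑ b ∈ S, ∮ z in C(b, ε), T (R₁ (w, z)) (R₂ (w, z))) - M w‖ ≤ C) := by
    intro p
    by_cases hp : p ∈ N
    · obtain ⟨r, hr, hrη, f, hf⟩ := exists_local_residue T hT h.left h.right hfin₁ hfin₂
        ((hN p).1 hp).1 ((hN p).1 hp).2 hη
      exact ⟨r, hr, hrη, f, fun _ => hf⟩
    · exact ⟨η / 2, half_pos hη, half_lt_self hη, 0, fun h => absurd h hp⟩
  choose r hr hrη f hf using hres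
  have hrΓ : ∀ p ∈ N, Metric.closedBall p (r p) ⊆ Γ₂ := fun p hp =>
    (Metric.closedBall_subset_closedBall (hrη p).le).trans (hη₁ p hp)
  have hsubΓ : Γ₁ ⊆ Γ₁ ∪ ⋃ p ∈ N, Metric.ball p (r p) := subset_union_left
  obtain ⟨M₁, hM₁⟩ := hsec
  have hZ₁ : ∀ᶠ w in 𝓝 w₀, slice Z₁ w ⊆ Γ₁ ∪ ⋃ p ∈ N, Metric.ball p (r p) := by
    refine h.eventually_slice_left_subset hw₀ (hs.isOpen_left.union
      (isOpen_biUnion fun _ _ => Metric.isOpen_ball)) (hs₁.trans (union_subset_union_right _ ?_))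
      (M := M₁) fun z hz hz' => (hM₁ z hz).1 fun h' => hz' (hsubΓ h')
    exact fun p hp => mem_biUnion hp (Metric.mem_ball_self (hr p))
  have hZ₂ : ∀ᶠ w in 𝓝 w₀, slice Z₂ w ⊆ Γ₂ :=
    h.eventually_slice_right_subset hw₀ hs.isOpen_right hs₂ fun z hz => (hM₁ z hz).2
  refine ⟨N, τ, γ, Γ₁, Γ₂, r, f, hτ, hs, hs₁.trans (union_subset_union_right _ fun p hp =>
    mem_of_mem_nhds (hN₂ p hp)), hs₂, hrΓ,
    fun p hp q hq hpq => (hη₂ p hp q hq hpq).mono (Metric.closedBall_subset_closedBall (hrη p).le)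
      (Metric.closedBall_subset_closedBall (hrη q).le), hZ₁, hZ₂, fun p hp => (hf p hp).1, ?_,
    fun p hp => (hf p hp).2.2⟩
  have hall : ∀ᶠ w in 𝓝 w₀, ∀ p ∈ N,
      (f p w = 0 ↔ ∃ z ∈ Metric.closedBall p (r p), (w, z) ∈ Z₁ ∧ (w, z) ∈ Z₂) := by
    rw [eventually_all_finset]
    exact fun p hp => (hf p hp).2.1
  filter_upwards [hZ₁, hZ₂, hall, h.isOpen.mem_nhds hw₀] with w h1 h2 h3 h4
  constructor
  · rintro ⟨-, hd⟩ p hp h0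
    obtain ⟨z, -, hz₁, hz₂⟩ := (h3 p hp).1 h0
    exact disjoint_left.1 hd hz₁ hz₂
  -- A common pole at nearby `w` cannot lie in `Γ₁`, since the poles of `R₂` stay in `Γ₂`. So it
  -- lies in one of the discs, where the function `f p` detects it.
  · refine fun h0 => ⟨h4, disjoint_left.2 fun z hz₁ hz₂ => ?_⟩
    rcases h1 hz₁ with hz | hz
    · exact disjoint_left.1 hs.disjoint hz (h2 hz₂)
    · obtain ⟨p, hp, hzp⟩ := mem_iUnion₂.1 hz
      exact h0 p hp ((h3 p hp).2 ⟨z, Metric.ball_subset_closedBall hzp, hz₁, hz₂⟩)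

/-- The set of non-regular points is, locally, the zero set of a holomorphic function. -/
lemma exists_regularPoints_eq (h : IsDecayingPair Ω ψ Z₁ Z₂ R₁ R₂)
    (T : (H₁ →L[ℂ] H₁) →L[ℂ] (H₂ →L[ℂ] H₂) →L[ℂ] (H →L[ℂ] H))
    (hT : ∀ A B, FiniteDimensional ℂ (LinearMap.range A.toLinearMap) →
      FiniteDimensional ℂ (LinearMap.range B.toLinearMap) →
      FiniteDimensional ℂ (LinearMap.range (T A B).toLinearMap))
    (hfin₁ : HasPolesOfFiniteRank Z₁ R₁) (hfin₂ : HasPolesOfFiniteRank Z₂ R₂) {w₀ : ℂ}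
    (hw₀ : w₀ ∈ Ω) : ∃ f : ℂ → ℂ, AnalyticAt ℂ f w₀ ∧
      ∀ᶠ w in 𝓝 w₀, w ∈ regularPoints Ω Z₁ Z₂ ↔ f w ≠ 0 := by
  obtain ⟨N, τ, γ, Γ₁, Γ₂, r, f, -, -, -, -, -, -, -, -, hf, hreg, -⟩ :=
    h.exists_configuration T hT hfin₁ hfin₂ hw₀
  refine ⟨fun w => ∏ p ∈ N, f p w, Finset.analyticAt_fun_prod _ hf, hreg.mono fun w hw => ?_⟩
  rw [hw, Finset.prod_ne_zero_iff]

end IsDecayingPair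

/-- A subset of a connected open set which is locally the complement of an analytic set is either
empty or the complement of a discrete set. -/
lemma eventually_mem_of_locally_ne_zero {Ω A : Set ℂ} (hΩ : IsPreconnected Ω) (hA : A ⊆ Ω)
    (hne : A.Nonempty)
    (h : ∀ w₀ ∈ Ω, ∃ f : ℂ → ℂ, AnalyticAt ℂ f w₀ ∧ ∀ᶠ w in 𝓝 w₀, w ∈ A ↔ f w ≠ 0) :
    (∀ w₀ ∈ Ω, ∀ᶠ w in 𝓝[≠] w₀, w ∈ A) ∧ IsOpen A := by
  have hopen : IsOpen A := isOpen_iff_mem_nhds.2 fun w hw => by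
    obtain ⟨f, hf, hfA⟩ := h w (hA hw)
    filter_upwards [hfA, hf.continuousAt.eventually_ne (hfA.self_of_nhds.1 hw)] with y h1 h2
    exact h1.2 h2
  refine ⟨?_, hopen⟩
  have hsub : Ω ⊆ {w | ∀ᶠ y in 𝓝[≠] w, y ∈ A} := by
    -- An analytic function vanishes identically near a point or nowhere in a punctured
    -- neighbourhood. The two alternatives give disjoint open sets covering `Ω`, and nonemptiness of
    -- `A` selects the second.
    refine hΩ.subset_left_of_subset_union (v := {w | ∀ᶠ y in 𝓝 w, y ∉ A}) ?_ ?_ ?_ ?_ ?_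
    · refine isOpen_iff_mem_nhds.2 fun w hw => ?_
      filter_upwards [eventually_eventually_nhds.2 (eventually_nhdsWithin_iff.1 hw)] with y hy
      by_cases hyw : y = w
      · exact hyw ▸ hw
      · filter_upwards [nhdsWithin_le_nhds hy, nhdsWithin_le_nhds (isOpen_ne.mem_nhds hyw)]
          with x h1 h2 using h1 h2
    · exact isOpen_iff_mem_nhds.2 fun w hw => eventually_eventually_nhds.2 hw
    · refine disjoint_left.2 fun w h1 h2 => ?_
      have h1 : ∀ᶠ y in 𝓝[≠] w, y ∈ A := h1
      obtain ⟨y, h3, h4⟩ := (h1.and (nhdsWithin_le_nhds h2)).exists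
      exact h4 h3
    · intro w hw
      obtain ⟨f, hf, hfA⟩ := h w hw
      rcases hf.eventually_eq_zero_or_eventually_ne_zero with h0 | h0
      · exact Or.inr (by filter_upwards [hfA, h0] with y h1 h2 h3 using h1.1 h3 h2)
      · exact Or.inl (by filter_upwards [nhdsWithin_le_nhds hfA, h0] with y h1 h2 using h1.2 h2)
    · obtain ⟨w, hw⟩ := hne
      exact ⟨w, hA hw, nhdsWithin_le_nhds (hopen.mem_nhds hw)⟩
  exact fun w hw => hsub hw

namespace IsDecayingPair

variable {H₁ H₂ H : Type*} [NormedAddCommGroup H₁] [NormedSpace ℂ H₁] [CompleteSpace H₁]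
  [NormedAddCommGroup H₂] [NormedSpace ℂ H₂] [CompleteSpace H₂]
  [NormedAddCommGroup H] [NormedSpace ℂ H] [CompleteSpace H]
  {Ω : Set ℂ} {ψ : ℝ} {Z₁ Z₂ : Set (ℂ × ℂ)} {R₁ : ℂ × ℂ → H₁ →L[ℂ] H₁} {R₂ : ℂ × ℂ → H₂ →L[ℂ] H₂}

/-- A family given by contour integrals at the regular points has poles of finite rank. -/
lemma hasFiniteRankPrincipalPartAt_of_eq_integral (h : IsDecayingPair Ω ψ Z₁ Z₂ R₁ R₂)
    (T : (H₁ →L[ℂ] H₁) →L[ℂ] (H₂ →L[ℂ] H₂) →L[ℂ] (H →L[ℂ] H))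
    (hT : ∀ A B, FiniteDimensional ℂ (LinearMap.range A.toLinearMap) →
      FiniteDimensional ℂ (LinearMap.range B.toLinearMap) →
      FiniteDimensional ℂ (LinearMap.range (T A B).toLinearMap))
    (hfin₁ : HasPolesOfFiniteRank Z₁ R₁) (hfin₂ : HasPolesOfFiniteRank Z₂ R₂)
    (hopen : IsOpen (regularPoints Ω Z₁ Z₂)) {R : ℂ → H →L[ℂ] H}
    (hR : ∀ w ∈ regularPoints Ω Z₁ Z₂, ∀ γ, IsAdmissible ψ (slice Z₁ w) (slice Z₂ w) γ →
      R w = (2 * Real.pi * Complex.I : ℂ)⁻¹ • γ.integral fun z => T (R₁ (w, z)) (R₂ (w, z)))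
    {w₀ : ℂ} (hw₀ : w₀ ∈ Ω) (hreg : ∀ᶠ w in 𝓝[≠] w₀, w ∈ regularPoints Ω Z₁ Z₂) :
    HasFiniteRankPrincipalPartAt R w₀ := by
  classical
  obtain ⟨N, τ, γ, Γ₁, Γ₂, r, f, hτ, hs, hs₁, hs₂, hrΓ, hrd, hZ₁, hZ₂, -, hregf, hres⟩ :=
    h.exists_configuration T hT hfin₁ hfin₂ hw₀
  have hres' : ∀ p : ℂ, ∃ (M : ℂ → H →L[ℂ] H) (C : ℝ), p ∈ N →
      HasFiniteRankPrincipalPartAt M w₀ ∧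
        ∀ᶠ w in 𝓝[≠] w₀, ∀ S : Finset ℂ,
          (∀ z, z ∈ S ↔ z ∈ Metric.closedBall p (r p) ∧ (w, z) ∈ Z₁) →
          (∀ b ∈ S, b ∈ Metric.ball p (r p)) ∧ ∀ᶠ ε in 𝓝[>] 0,
            ‖(∑ b ∈ S, ∮ z in C(b, ε), T (R₁ (w, z)) (R₂ (w, z))) - M w‖ ≤ C := by
    intro p
    by_cases hp : p ∈ N
    -- Regular points accumulate at `w₀`, and `f p` is nonzero at those near `w₀`. This excludes the
    -- case where `f p` vanishes identically.
    · obtain ⟨M, C, hMC⟩ := hres p hp fun h0 => by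
        obtain ⟨w, ⟨h1, h2⟩, h3⟩ :=
          ((hreg.and (nhdsWithin_le_nhds hregf)).and (nhdsWithin_le_nhds h0)).exists
        exact h2.1 h1 p hp h3
      exact ⟨M, C, fun _ => hMC⟩
    · exact ⟨0, 0, fun h => absurd h hp⟩
  choose M C hMC using hres'
  have hγ := h.analyticAt_integral T hw₀ hτ
    (disjoint_left.2 fun z hz hz' => (hs₁ hz').elim (hs.notMem_left · hz) (hs.notMem_right · hz))
    (disjoint_left.2 fun z hz hz' => hs.notMem_right (hs₂ hz') hz)
  set c : ℂ := (2 * Real.pi * Complex.I : ℂ)⁻¹ with hc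
  -- The candidate for the singular behaviour of `R`: the holomorphic integral over the fixed
  -- contour plus the meromorphic models of the residues.
  set G : ℂ → H →L[ℂ] H := fun w =>
    c • ((γ.integral fun z => T (R₁ (w, z)) (R₂ (w, z))) + ∑ p ∈ N, M p w) with hG
  have hGp : HasFiniteRankPrincipalPartAt G w₀ :=
    ((AnalyticAt.hasFiniteRankPrincipalPartAt hγ).add
      (HasFiniteRankPrincipalPartAt.sum N fun p hp => (hMC p hp).1)).const_smul c
  have hall : ∀ᶠ w in 𝓝[≠] w₀, ∀ p ∈ N, ∀ S : Finset ℂ,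
      (∀ z, z ∈ S ↔ z ∈ Metric.closedBall p (r p) ∧ (w, z) ∈ Z₁) →
      (∀ b ∈ S, b ∈ Metric.ball p (r p)) ∧ ∀ᶠ ε in 𝓝[>] 0,
        ‖(∑ b ∈ S, ∮ z in C(b, ε), T (R₁ (w, z)) (R₂ (w, z))) - M p w‖ ≤ C p := by
    rw [eventually_all_finset]
    exact fun p hp => (hMC p hp).2
  have hbound : ∀ᶠ w in 𝓝[≠] w₀, ‖R w - G w‖ ≤ ‖c‖ * ∑ p ∈ N, C p := by
    filter_upwards [hreg, hall, nhdsWithin_le_nhds hZ₁, nhdsWithin_le_nhds hZ₂] with w hw hw' h1 h2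
    have hfin := fun p => h.left.finite_slice_inter h.isOpen hw.1 (isCompact_closedBall p (r p))
    set S : ℂ → Finset ℂ := fun p => (hfin p).toFinset with hS
    have hSmem : ∀ p z, z ∈ S p ↔ z ∈ Metric.closedBall p (r p) ∧ (w, z) ∈ Z₁ := fun p z =>
      (hfin p).mem_toFinset.trans and_comm
    have hSball : ∀ p ∈ N, ∀ b ∈ S p, b ∈ Metric.ball p (r p) := fun p hp =>
      (hw' p hp (S p) (hSmem p)).1
    have hSε : ∀ᶠ ε : ℝ in 𝓝[>] 0, ∀ p ∈ N,
        ‖(∑ b ∈ S p, ∮ z in C(b, ε), T (R₁ (w, z)) (R₂ (w, z))) - M p w‖ ≤ C p := by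
      rw [eventually_all_finset]
      exact fun p hp => (hw' p hp (S p) (hSmem p)).2
    -- Regularity of `w` keeps these poles of `R₁` away from the poles of `R₂`, so they can be
    -- encircled alone.
    have hbΓ : ∀ b ∈ N.biUnion S, b ∈ Γ₂ ∩ (slice Z₂ w)ᶜ := fun b hb => by
      obtain ⟨p, hp, hbp⟩ := Finset.mem_biUnion.1 hb
      exact ⟨hrΓ p hp ((hSmem p b).1 hbp).1, disjoint_left.1 hw.2 ((hSmem p b).1 hbp).2⟩
    have hsubε : ∀ᶠ ε : ℝ in 𝓝[>] 0, ∀ b ∈ N.biUnion S,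
        Metric.closedBall b ε ⊆ Γ₂ ∩ (slice Z₂ w)ᶜ := by
      rw [eventually_all_finset]
      exact fun b hb => eventually_closedBall_subset ((hs.isOpen_right.inter
        (h.right.isClosed_slice h.isOpen hw.1).isOpen_compl).mem_nhds (hbΓ b hb))
    obtain ⟨ε, ⟨⟨h3, h4⟩, h5⟩, hε : 0 < ε⟩ := (((hSε.and hsubε).and
      (eventually_disjoint_closedBall (N.biUnion S))).and self_mem_nhdsWithin).exists
    -- With these circles added, the contour fixed at `w₀` becomes admissible at `w`. The definition
    -- of `R w` thus splits into the fixed integral and the small circle integrals.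
    obtain ⟨γ', hτ', hs', hint⟩ := hs.exists_addCircles hτ hε (N.biUnion S)
      (fun b hb => (h4 b hb).trans inter_subset_left) h5
    have hadm : IsAdmissible ψ (slice Z₁ w) (slice Z₂ w) γ' := by
      refine isAdmissible_iff.2 ⟨τ, _, _, hτ', hs', fun z hz => ?_, fun z hz => ⟨h2 hz, fun hz' =>
        ?_⟩⟩
      · refine (h1 hz).imp_right fun hz' => ?_
        obtain ⟨p, hp, hzp⟩ := mem_iUnion₂.1 hz'
        exact mem_biUnion (Finset.mem_biUnion.2 ⟨p, hp, (hSmem p z).2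
          ⟨Metric.ball_subset_closedBall hzp, hz⟩⟩) (Metric.mem_ball_self hε)
      · obtain ⟨b, hb, hzb⟩ := mem_iUnion₂.1 hz'
        exact (h4 b hb hzb).2 hz
    rw [hR w hw γ' hadm, hint, Finset.sum_biUnion fun p hp q hq hpq =>
      Finset.disjoint_left.2 fun b hb hb' => disjoint_left.1 (hrd p hp q hq hpq)
        ((hSmem p b).1 hb).1 ((hSmem q b).1 hb').1, hG]
    simp only
    rw [← smul_sub, add_sub_add_left_eq_sub, ← Finset.sum_sub_distrib, norm_smul]
    gcongr
    exact norm_sum_le_of_le _ h3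
  have hdiff : ∀ᶠ w in 𝓝[≠] w₀, DifferentiableAt ℂ (fun w => R w - G w) w := by
    filter_upwards [hreg, hGp.meromorphicAt.eventually_analyticAt] with w h1 h2
    exact (h.analyticAt_of_eq_integral T hopen hR h1).differentiableAt.fun_sub h2.differentiableAt
  -- The difference `R - G` is bounded and holomorphic in a punctured neighbourhood, so it extends
  -- analytically. The principal part of `R` is that of `G`.
  obtain ⟨g, hg, hRg⟩ := exists_analyticAt_of_bounded hdiff hbound
  refine (hGp.add (AnalyticAt.hasFiniteRankPrincipalPartAt hg)).congr ?_
  filter_upwards [hRg] with w hw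
  rw [← hw, add_sub_cancel]

/-- The contour integrals of the product define a meromorphic family with poles of finite rank. -/
theorem exists_meromorphic (h : IsDecayingPair Ω ψ Z₁ Z₂ R₁ R₂) (hΩ : IsPreconnected Ω)
    (T : (H₁ →L[ℂ] H₁) →L[ℂ] (H₂ →L[ℂ] H₂) →L[ℂ] (H →L[ℂ] H))
    (hT : ∀ A B, FiniteDimensional ℂ (LinearMap.range A.toLinearMap) →
      FiniteDimensional ℂ (LinearMap.range B.toLinearMap) →
      FiniteDimensional ℂ (LinearMap.range (T A B).toLinearMap))
    (hfin₁ : HasPolesOfFiniteRank Z₁ R₁) (hfin₂ : HasPolesOfFiniteRank Z₂ R₂)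
    (hreg : (regularPoints Ω Z₁ Z₂).Nonempty) :
    (∀ w₀ ∈ Ω, ∀ᶠ w in 𝓝[≠] w₀, w ∈ regularPoints Ω Z₁ Z₂) ∧ IsOpen (regularPoints Ω Z₁ Z₂) ∧
    (∀ w ∈ regularPoints Ω Z₁ Z₂, (∃ γ, IsAdmissible ψ (slice Z₁ w) (slice Z₂ w) γ) ∧
      ∀ γ, IsAdmissible ψ (slice Z₁ w) (slice Z₂ w) γ →
        γ.IntegrableAlong fun z => T (R₁ (w, z)) (R₂ (w, z))) ∧
    ∃ R : ℂ → H →L[ℂ] H,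
      (∀ w ∈ regularPoints Ω Z₁ Z₂, ∀ γ, IsAdmissible ψ (slice Z₁ w) (slice Z₂ w) γ →
        R w = (2 * Real.pi * Complex.I : ℂ)⁻¹ • γ.integral fun z => T (R₁ (w, z)) (R₂ (w, z))) ∧
      DifferentiableOn ℂ R (regularPoints Ω Z₁ Z₂) ∧ IsMeromorphicWithFiniteRankPoles R Ω := by
  obtain ⟨hdisc, hopen⟩ := eventually_mem_of_locally_ne_zero hΩ
    (fun w (hw : w ∈ regularPoints Ω Z₁ Z₂) => hw.1) hreg
    fun w hw => h.exists_regularPoints_eq T hT hfin₁ hfin₂ hw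
  have hex : ∀ w ∈ regularPoints Ω Z₁ Z₂, ∃ γ, IsAdmissible ψ (slice Z₁ w) (slice Z₂ w) γ :=
    fun w hw => by
      obtain ⟨γ, τ, -, hγ⟩ := h.exists_isAdmissible hw
      exact ⟨γ, hγ.self_of_nhds⟩
  -- Independence of the contour makes the value at regular points well defined. Elsewhere the value
  -- `0` is arbitrary, since meromorphy ignores values at isolated points.
  have hR : ∀ w : ℂ, ∃ R : H →L[ℂ] H, w ∈ regularPoints Ω Z₁ Z₂ → ∀ γ,
      IsAdmissible ψ (slice Z₁ w) (slice Z₂ w) γ →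
      R = (2 * Real.pi * Complex.I : ℂ)⁻¹ • γ.integral fun z => T (R₁ (w, z)) (R₂ (w, z)) := by
    intro w
    by_cases hw : w ∈ regularPoints Ω Z₁ Z₂
    · obtain ⟨γ₀, hγ₀⟩ := hex w hw
      refine ⟨(2 * Real.pi * Complex.I : ℂ)⁻¹ • γ₀.integral fun z => T (R₁ (w, z)) (R₂ (w, z)),
        fun _ γ hγ => ?_⟩
      rw [h.integral_eq T hw.1 hγ₀ hγ]
    · exact ⟨0, fun h => absurd h hw⟩
  choose R hR using hR
  have hfin : ∀ w ∈ Ω, HasFiniteRankPrincipalPartAt R w := fun w hw =>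
    h.hasFiniteRankPrincipalPartAt_of_eq_integral T hT hfin₁ hfin₂ hopen hR hw (hdisc w hw)
  exact ⟨hdisc, hopen, fun w hw => ⟨hex w hw, fun γ hγ => h.integrableAlong T hw.1 hγ⟩, R, hR,
    fun w hw => (h.analyticAt_of_eq_integral T hopen hR hw).differentiableAt.differentiableWithinAt,
    fun w hw => (hfin w hw).meromorphicAt, hfin⟩

end IsDecayingPair

end SepMer


/-- The general result for bounded bilinear maps, applied to the operator tensor product. The only
further input is that the tensor product of two finite rank operators has finite rank. -/
theorem mainTheorem7
    {H₁ H₂ : Type*} [NormedAddCommGroup H₁] [InnerProductSpace ℂ H₁] [CompleteSpace H₁]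
    [NormedAddCommGroup H₂] [InnerProductSpace ℂ H₂] [CompleteSpace H₂]
    (Ω : Set ℂ) (hΩ : IsOpen Ω) (hΩc : IsPreconnected Ω)
    (ψ : ℝ) (hψ₀ : 0 < ψ) (hψ₁ : ψ < Real.pi)
    (Z₁ Z₂ : Set (ℂ × ℂ)) (R₁ : ℂ × ℂ → H₁ →L[ℂ] H₁) (R₂ : ℂ × ℂ → H₂ →L[ℂ] H₂)
    (hR₁ : SepMer.IsMeromorphicFamily (Ω ×ˢ univ) Z₁ R₁)
    (hR₂ : SepMer.IsMeromorphicFamily (Ω ×ˢ univ) Z₂ R₂)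
    (hfin₁ : SepMer.HasPolesOfFiniteRank Z₁ R₁)
    (hfin₂ : SepMer.HasPolesOfFiniteRank Z₂ R₂)
    (hdecay : SepMer.DecaysInSectors Ω ψ Z₁ Z₂ R₁ R₂)
    (hreg : (SepMer.regularPoints Ω Z₁ Z₂).Nonempty) :
    -- the non-regular points form a closed discrete subset of `Ω`
    (∀ w₀ ∈ Ω, ∀ᶠ w in 𝓝[≠] w₀, w ∈ SepMer.regularPoints Ω Z₁ Z₂) ∧
    IsOpen (SepMer.regularPoints Ω Z₁ Z₂) ∧
    -- at each regular point there are admissible contours, and the integral converges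
    (∀ w ∈ SepMer.regularPoints Ω Z₁ Z₂,
      (∃ γ, SepMer.IsAdmissible ψ (SepMer.slice Z₁ w) (SepMer.slice Z₂ w) γ) ∧
      ∀ γ, SepMer.IsAdmissible ψ (SepMer.slice Z₁ w) (SepMer.slice Z₂ w) γ →
        γ.IntegrableAlong (fun l => SepMer.tensorOp (R₁ (w, l)) (R₂ (w, l)))) ∧
    -- the integral does not depend on the contour, and it defines a meromorphic family
    ∃ R : ℂ → SepMer.HilbertTensor H₁ H₂ →L[ℂ] SepMer.HilbertTensor H₁ H₂,
      (∀ w ∈ SepMer.regularPoints Ω Z₁ Z₂, ∀ γ,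
        SepMer.IsAdmissible ψ (SepMer.slice Z₁ w) (SepMer.slice Z₂ w) γ →
        R w = (2 * Real.pi * Complex.I : ℂ)⁻¹ •
          γ.integral (fun l => SepMer.tensorOp (R₁ (w, l)) (R₂ (w, l)))) ∧
      DifferentiableOn ℂ R (SepMer.regularPoints Ω Z₁ Z₂) ∧
      SepMer.IsMeromorphicWithFiniteRankPoles R Ω :=
  SepMer.IsDecayingPair.exists_meromorphic ⟨hΩ, hψ₀, hψ₁, hR₁, hR₂, hdecay⟩ hΩc
    (SepMer.tensorOpL H₁ H₂) SepMer.finiteDimensional_range_tensorOp hfin₁ hfin₂ hreg
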